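/- Let $\mathcal S$ be the Selberg class, i.e. the set of functions $L$ given for $\Re s>1$ by an absolutely convergent Dirichlet series $L(s)=\sum_{n\ge 1}a_L(n)n^{-s}$ such that: (i) $a_L(n)\ll_\varepsilon n^{\varepsilon}$ for every $\varepsilon>0$; (ii) for some integer $m\ge 0$, $(s-1)^mL(s)$ extends to an entire function of finite order; (iii) there are $k\ge 0$, $Q>0$, $\lambda_1,\dots,\lambda_k>0$, $\mu_1,\dots,\mu_k\in\mathbb C$ with $\Re\mu_j\ge 0$, and $\theta\in\mathbb C$ with $|\theta|=1$ such that $\Lambda(s):=L(s)Q^s\prod_{j=1}^k\Gamma(\lambda_js+\mu_j)$ satisfies $\Lambda(s)=\theta\,\overline{\Lambda(1-\overline s)}$ as meromorphic functions; (iv) there are complex numbers $b(p^j)$ ($p$ prime, $j\ge1$) with $b(p^j)\ll p^{j\delta}$ for some $\delta<1/2$ such that $L(s)=\prod_p\exp\big(\sum_{j\ge1}b(p^j)p^{-js}\big)$ for $\Re s>1$. Let $L\in\mathcal S$ be such that $L(s)\neq 0$ for all $s\ne 1$ with $\Re s>1/2$, and suppose that for some $\kappa>0$ $$\sum_{p\le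 x}|a_L(p)|=(\kappa+o(1))\frac{x}{\log x}\qquad(x\to\infty),$$ the sum being over primes. Then for every fixed $\sigma\in[1/2,1)$ there exists a constant $c>0$ (which may depend on $L$ and $\sigma$) such that, as $t\to+\infty$, $$L(\sigma+it)\ll\exp\left(c\,\frac{(\log t)^{2-2\sigma}}{\log\log t}\right).$$ Moreover, if $\sum_{p\le x}|a_L(p)|=\kappa\frac{x}{\log x}+O\big(\frac{x}{\log^2x}\big)$ with the same $\kappa$, then, as $t\to+\infty$, $$L(1+it)\ll(\log\log t)^{\kappa}.$$ The implied constants may depend on $L$ and $\sigma$. -/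

import Mathlib

open Filter Asymptotics Topology

noncomputable section

namespace SelbergClass

/-- `F : ℂ → ℂ` is an entire function of finite order: it is holomorphic on `ℂ` and
`F(s) ≪ exp(|s|^ρ)` as `|s| → ∞`, for some real `ρ`. -/
def IsEntireOfFiniteOrder (F : ℂ → ℂ) : Prop :=
  Differentiable ℂ F ∧
    ∃ ρ : ℝ, F =O[cocompact ℂ] fun s : ℂ => Real.exp (‖s‖ ^ ρ)

/-- The Ramanujan hypothesis: `a(n) ≪_ε n^ε` for every `ε > 0`. -/
def RamanujanHypothesis (a : ℕ → ℂ) : Prop :=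
  ∀ ε : ℝ, 0 < ε → a =O[atTop] fun n : ℕ => (n : ℝ) ^ ε

/-- Analytic continuation: for some integer `m ≥ 0` the function `(s - 1)^m L(s)` is (after
removing the singularity at `s = 1`) an entire function of finite order. The value that the
function `L` takes at the point `1` itself plays no role. -/
def AnalyticContinuation (L : ℂ → ℂ) : Prop :=
  ∃ (m : ℕ) (F : ℂ → ℂ), IsEntireOfFiniteOrder F ∧
    ∀ s : ℂ, s ≠ 1 → F s = (s - 1) ^ m * L s

/-- The completed function `Λ(s) = L(s) Q^s ∏_j Γ(l_j s + μ_j)`. -/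
def completed (L : ℂ → ℂ) {k : ℕ} (Q : ℝ) (l : Fin k → ℝ) (μ : Fin k → ℂ) (s : ℂ) : ℂ :=
  L s * (Q : ℂ) ^ s * ∏ j, Complex.Gamma ((l j : ℂ) * s + μ j)

/-- `s` is a point at which no factor of the completed function can have a pole. -/
def IsRegularPoint {k : ℕ} (l : Fin k → ℝ) (μ : Fin k → ℂ) (s : ℂ) : Prop :=
  s ≠ 1 ∧ ∀ (j : Fin k) (n : ℕ), (l j : ℂ) * s + μ j ≠ -(n : ℂ)

/-- The functional equation `Λ(s) = θ * conj (Λ(1 - conj s))` with `|θ| = 1`, `Q > 0`,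
`l_j > 0`, `Re μ_j ≥ 0`. It is an identity of meromorphic functions, hence it is stated at all
points at which no factor on either side has a pole. -/
def FunctionalEquation (L : ℂ → ℂ) : Prop :=
  ∃ (k : ℕ) (Q : ℝ) (l : Fin k → ℝ) (μ : Fin k → ℂ) (θ : ℂ),
    ‖θ‖ = 1 ∧ 0 < Q ∧ (∀ j, 0 < l j) ∧ (∀ j, 0 ≤ (μ j).re) ∧
    ∀ s : ℂ, IsRegularPoint l μ s → IsRegularPoint l μ (1 - starRingEnd ℂ s) →
      completed L Q l μ s =
        θ * starRingEnd ℂ (completed L Q l μ (1 - starRingEnd ℂ s))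

/-- The local factor `L_p(s) = exp (∑_{j ≥ 1} b(p^j) / p^{js})`. -/
def localFactor (b : ℕ → ℂ) (p : ℕ) (s : ℂ) : ℂ :=
  Complex.exp (∑' j : ℕ, b (p ^ (j + 1)) / (p : ℂ) ^ (((j + 1 : ℕ) : ℂ) * s))

/-- The Euler product: there are complex numbers `b(p^j)` with `b(p^j) ≪ p^{jδ}` for some
`δ < 1/2` such that `L(s) = ∏_p L_p(s)` for `Re s > 1`. -/
def EulerProduct (L : ℂ → ℂ) : Prop :=
  ∃ b : ℕ → ℂ,
    (∃ δ C : ℝ, δ < 1 / 2 ∧ ∀ p j : ℕ, p.Prime → 1 ≤ j →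
      ‖b (p ^ j)‖ ≤ C * (p : ℝ) ^ ((j : ℝ) * δ)) ∧
    ∀ s : ℂ, 1 < s.re → HasProd (fun p : Nat.Primes => localFactor b p s) (L s)

/-- `L` is an element of the Selberg class, with Dirichlet coefficients `a`. -/
structure IsSelberg (a : ℕ → ℂ) (L : ℂ → ℂ) : Prop where
  /-- `L(s) = ∑_{n ≥ 1} a(n) n^{-s}` for `Re s > 1` -/
  dirichlet : ∀ s : ℂ, 1 < s.re → LSeriesHasSum a s (L s)
  ramanujan : RamanujanHypothesis a
  continuation : AnalyticContinuation L
  functional : FunctionalEquation L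
  euler : EulerProduct L

/-- `∑_{p ≤ x} |a(p)|`, the sum being over primes. -/
def primeSum (a : ℕ → ℂ) (x : ℝ) : ℝ :=
  ∑ p ∈ Finset.Iic ⌊x⌋₊ with p.Prime, ‖a p‖

/-- `∑_{p ≤ x} |a(p)| = (κ + o(1)) x / log x`. -/
def PrimeAsymptotic (a : ℕ → ℂ) (κ : ℝ) : Prop :=
  (fun x : ℝ => primeSum a x - κ * (x / Real.log x)) =o[atTop] fun x : ℝ => x / Real.log x

/-- `∑_{p ≤ x} |a(p)| = κ x / log x + O(x / log² x)`. -/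
def StrongPrimeAsymptotic (a : ℕ → ℂ) (κ : ℝ) : Prop :=
  (fun x : ℝ => primeSum a x - κ * (x / Real.log x)) =O[atTop]
    fun x : ℝ => x / Real.log x ^ 2

end SelbergClass

end

namespace SelbergClass

section

open Metric Set

/-! ### Functions with nonnegative real part, and Landau's lower bound for Re f'/f -/

/-- Schwarz-Pick for the right half plane: a Cayley transform sends `g` into the unit disc and `g c`
to 0, and the Schwarz lemma bounds the derivative at the centre. -/
theorem norm_deriv_le_of_re_nonneg {g : ℂ → ℂ} {c : ℂ} {r : ℝ} (hr : 0 < r)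
    (hd : DifferentiableOn ℂ g (ball c r)) (hre : ∀ z ∈ ball c r, 0 ≤ (g z).re) :
    ‖deriv g c‖ ≤ 2 * (g c).re / r := by
  have hc : c ∈ ball c r := mem_ball_self hr
  have key : ∀ ε : ℝ, 0 < ε → ‖deriv g c‖ ≤ 2 * ((g c).re + ε) / r := by
    intro ε hε
    -- This is the Cayley transform of g + ε. The shift keeps the denominator away from zero even
    -- where Re g vanishes; ε tends to 0 at the end.
    set w : ℂ := starRingEnd ℂ (g c) + 2 * ε with hw
    have hden : ∀ z ∈ ball c r, g z + w ≠ 0 := by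
      intro z hz h
      have := congrArg Complex.re h
      simp [hw] at this
      linarith [hre z hz, hre c hc]
    have hgc : DifferentiableAt ℂ g c := hd.differentiableAt (isOpen_ball.mem_nhds hc)
    have hφd : DifferentiableOn ℂ (fun z => (g z - g c) / (g z + w)) (ball c r) :=
      (hd.sub_const _).div (hd.add_const _) hden
    have hφ : ‖deriv (fun z => (g z - g c) / (g z + w)) c‖ ≤ 1 / r := by
      refine Complex.norm_deriv_le_div_of_mapsTo_ball hφd ?_ hr
      intro z hz
      have hp : 0 < ‖g z + w‖ := norm_pos_iff.2 (hden z hz)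
      simp only [sub_self, zero_div, mem_closedBall, dist_zero_right, norm_div]
      rw [div_le_one hp, ← sq_le_sq₀ (norm_nonneg _) hp.le, Complex.sq_norm, Complex.sq_norm,
        Complex.normSq_apply, Complex.normSq_apply]
      have h1 := hre z hz
      have h2 := hre c hc
      simp [hw]
      nlinarith [mul_nonneg h1 h2, mul_nonneg h1 hε.le, mul_nonneg h2 hε.le]
    have hder : deriv (fun z => (g z - g c) / (g z + w)) c = deriv g c / (g c + w) := by
      have h := (hgc.hasDerivAt.sub_const (g c)).div (hgc.hasDerivAt.add_const w) (hden c hc)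
      rw [show (fun z => (g z - g c) / (g z + w)) = ((fun z => g z - g c) / fun z => g z + w) from rfl,
        h.deriv]
      have := hden c hc
      field_simp
      ring
    have hval : g c + w = ((2 * ((g c).re + ε) : ℝ) : ℂ) := by
      apply Complex.ext <;> simp [hw]
      ring
    have hpos : 0 < 2 * ((g c).re + ε) := by linarith [hre c hc]
    rw [hder, norm_div, hval, Complex.norm_real, Real.norm_of_nonneg hpos.le,
      div_le_div_iff₀ hpos hr] at hφ
    rw [le_div_iff₀ hr]
    linarith
  have ht : Tendsto (fun ε : ℝ => 2 * ((g c).re + ε) / r) (𝓝[>] 0)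
      (𝓝 (2 * ((g c).re + 0) / r)) := by
    apply Tendsto.mono_left _ nhdsWithin_le_nhds
    exact Continuous.tendsto (by fun_prop) 0
  rw [add_zero] at ht
  exact ge_of_tendsto ht (eventually_mem_nhdsWithin.mono fun ε hε => key ε hε)

theorem exists_eq_mul_exp_of_ne_zero_on_ball {g : ℂ → ℂ} {c : ℂ} {R : ℝ} (hR : 0 < R)
    (hd : DifferentiableOn ℂ g (ball c R)) (h0 : ∀ z ∈ ball c R, g z ≠ 0) :
    ∃ k : ℂ → ℂ, k c = 0 ∧ (∀ z ∈ ball c R, HasDerivAt k (logDeriv g z) z) ∧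
      ∀ z ∈ ball c R, g z = g c * Complex.exp (k z) := by
  have hld : DifferentiableOn ℂ (logDeriv g) (ball c R) :=
    (hd.deriv isOpen_ball).div hd h0
  obtain ⟨k, hk0, hk⟩ := hld.isExactOn_ball.with_val_at c 0
  refine ⟨k, hk0, hk, ?_⟩
  have hconst : ∀ z ∈ ball c R, HasDerivAt (fun z => g z * Complex.exp (-k z)) 0 z := by
    intro z hz
    have h1 := (hd.differentiableAt (isOpen_ball.mem_nhds hz)).hasDerivAt
    have h2 := (hk z hz).neg.cexp
    refine (h1.mul h2).congr_deriv ?_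
    have := h0 z hz
    simp only [logDeriv_apply, Pi.neg_apply]
    field_simp
    ring
  intro z hz
  have := (convex_ball c R).is_const_of_fderivWithin_eq_zero (𝕜 := ℂ)
    (f := fun z => g z * Complex.exp (-k z))
    (fun z hz => (hconst z hz).differentiableAt.differentiableWithinAt)
    (fun z hz => by
      rw [fderivWithin_of_isOpen isOpen_ball hz]
      have := (hconst z hz).hasFDerivAt.fderiv
      rw [this]; ext; simp) hz (mem_ball_self hR)
  simp only [hk0, neg_zero, Complex.exp_zero, mul_one] at this
  rw [← this, mul_assoc, ← Complex.exp_add, neg_add_cancel, Complex.exp_zero, mul_one]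

/-- The logarithm `k` of g/g(c) has real part at most `M`. Borel-Carathéodory bounds k(z), and then
M - k, of nonnegative real part on the ball of radius `R - r` about `z`, has its derivative
controlled by its value at `z`. -/
theorem norm_logDeriv_le_of_ne_zero_on_ball {g : ℂ → ℂ} {c z : ℂ} {R r M : ℝ} (hr : 0 ≤ r)
    (hrR : r < R) (hM : 0 < M) (hd : DifferentiableOn ℂ g (ball c R))
    (h0 : ∀ z ∈ ball c R, g z ≠ 0) (hb : ∀ z ∈ ball c R, ‖g z‖ ≤ Real.exp M * ‖g c‖)
    (hz : ‖z - c‖ ≤ r) :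
    ‖logDeriv g z‖ ≤ 2 * (1 + 2 * r / (R - r)) / (R - r) * M := by
  have hR : 0 < R := hr.trans_lt hrR
  have hRr : 0 < R - r := by linarith
  obtain ⟨k, hk0, hk, hexp⟩ := exists_eq_mul_exp_of_ne_zero_on_ball hR hd h0
  have hkd : DifferentiableOn ℂ k (ball c R) :=
    fun z hz => (hk z hz).differentiableAt.differentiableWithinAt
  have hgc : 0 < ‖g c‖ := norm_pos_iff.2 (h0 c (mem_ball_self hR))
  have hkre : ∀ z ∈ ball c R, (k z).re ≤ M := by
    intro z hz
    have h := hb z hz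
    rw [hexp z hz, norm_mul, Complex.norm_exp, mul_comm] at h
    exact Real.exp_le_exp.1 (le_of_mul_le_mul_right h hgc)
  have hzR : z ∈ ball c R := by
    rw [mem_ball, dist_eq_norm]; linarith
  have hbc : ‖k z‖ ≤ 2 * M * r / (R - r) := by
    have hshift : MapsTo (fun w => w + c) (ball (0 : ℂ) R) (ball c R) := by
      intro w hw
      simpa [mem_ball, dist_eq_norm] using hw
    have h := Complex.borelCaratheodory_zero (f := fun w => k (w + c)) (R := R) (z := z - c) hM
      (hkd.comp (by fun_prop) hshift) (fun w hw => hkre _ (hshift hw)) hR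
      (by rw [mem_ball_zero_iff]; linarith) (by simpa using hk0)
    simp only [sub_add_cancel] at h
    refine h.trans ?_
    gcongr
  have hsub : ball z (R - r) ⊆ ball c R := by
    apply ball_subset_ball'
    rw [dist_eq_norm]; linarith
  have h := norm_deriv_le_of_re_nonneg (g := fun w => M - k w) (c := z) hRr
    ((hkd.mono hsub).const_sub _) (fun w hw => by
      have := hkre w (hsub hw)
      simpa using this)
  rw [((hk z hzR).const_sub (M : ℂ)).deriv, norm_neg] at h
  refine h.trans ?_
  have h1 : ((M : ℂ) - k z).re ≤ M + 2 * M * r / (R - r) := by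
    have := (Complex.abs_re_le_norm (k z)).trans hbc
    have := neg_le_of_abs_le this
    simp
    linarith
  calc 2 * ((M : ℂ) - k z).re / (R - r) ≤ 2 * (M + 2 * M * r / (R - r)) / (R - r) := by gcongr
    _ = _ := by field_simp

/-- A nonzero analytic function has finitely many zeros on a compact ball, and its divisor is
nonnegative, so the exponents are natural numbers. The factorisation holds off a codiscrete set, and
the identity theorem extends it to the whole ball. -/
theorem exists_eq_prod_mul_of_analyticOnNhd {f : ℂ → ℂ} {c : ℂ} {R : ℝ} (hR : 0 < R)
    (hf : AnalyticOnNhd ℂ f (closedBall c R)) (hc : f c ≠ 0) :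
    ∃ (S : Finset ℂ) (n : ℂ → ℕ) (g : ℂ → ℂ), AnalyticOnNhd ℂ g (closedBall c R) ∧
      (∀ z ∈ closedBall c R, g z ≠ 0) ∧
      ∀ z ∈ closedBall c R, f z = (∏ u ∈ S, (z - u) ^ n u) * g z := by
  classical
  set U := closedBall c R with hU
  have hcU : c ∈ U := mem_closedBall_self hR.le
  have hpre : IsPreconnected U := (convex_closedBall c R).isPreconnected
  have hord : ∀ u : U, meromorphicOrderAt f u ≠ ⊤ := by
    intro u
    rw [(hf u u.2).meromorphicOrderAt_eq]
    intro h
    have h1 : analyticOrderAt f u = ⊤ := by simpa using h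
    rw [analyticOrderAt_eq_top] at h1
    exact hc (hf.eqOn_zero_of_preconnected_of_eventuallyEq_zero hpre u.2 h1 hcU)
  have hfin : (MeromorphicOn.divisor f U).support.Finite :=
    (MeromorphicOn.divisor f U).finiteSupport (isCompact_closedBall c R)
  obtain ⟨g, hg, hg0, hfg⟩ := hf.meromorphicOn.extract_zeros_poles hord hfin
  have hD : 0 ≤ MeromorphicOn.divisor f U := MeromorphicOn.AnalyticOnNhd.divisor_nonneg hf
  refine ⟨hfin.toFinset, fun u => (MeromorphicOn.divisor f U u).toNat, g, hg,
    fun z hz => hg0 ⟨z, hz⟩, ?_⟩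
  have hprod : (∏ᶠ u, (fun z : ℂ => z - u) ^ (MeromorphicOn.divisor f U u)) =
      fun z => ∏ u ∈ hfin.toFinset, (z - u) ^ (MeromorphicOn.divisor f U u).toNat := by
    rw [finprod_eq_prod_of_mulSupport_subset (s := hfin.toFinset)]
    · ext z
      rw [Finset.prod_apply]
      refine Finset.prod_congr rfl fun u _ => ?_
      rw [Pi.pow_apply, ← zpow_natCast, Int.toNat_of_nonneg (hD u)]
    · simp [Function.FactorizedRational.mulSupport]
  rw [hprod] at hfg
  have hana : AnalyticOnNhd ℂ (fun z => (∏ u ∈ hfin.toFinset,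
      (z - u) ^ (MeromorphicOn.divisor f U u).toNat) * g z) U := by
    intro z hz
    refine AnalyticAt.mul ?_ (hg z hz)
    exact Finset.analyticAt_fun_prod _ fun u _ => by fun_prop
  apply hf.eqOn_of_preconnected_of_frequently_eq hana hpre hcU
  have hmem : ∀ᶠ z in 𝓝[≠] c, z ∈ U :=
    mem_nhdsWithin_of_mem_nhds (closedBall_mem_nhds c hR)
  rw [EventuallyEq, Filter.Eventually, mem_codiscreteWithin] at hfg
  have h1 := hfg c hcU
  rw [disjoint_principal_right] at h1
  refine Eventually.frequently ?_
  filter_upwards [hmem, h1] with z hz hz'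
  by_contra hne
  exact hz' ⟨hz, hne⟩

/-- Landau's argument. Dividing out the zeros of the inner ball leaves a function with the same
growth bound, hence with bounded logarithmic derivative. Each removed zero u contributes n/(z - u),
whose real part is nonnegative because Re u ≤ Re z, so it can be dropped from a lower bound. -/
theorem neg_le_re_logDeriv {f : ℂ → ℂ} {c z : ℂ} {R r M : ℝ} (hr : 0 ≤ r) (hrR : r < R)
    (hM : 0 < M) (hf : AnalyticOnNhd ℂ f (closedBall c (2 * R))) (hc : f c ≠ 0)
    (hb : ∀ w ∈ closedBall c (2 * R), ‖f w‖ ≤ Real.exp M * ‖f c‖) (hz : ‖z - c‖ ≤ r)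
    (hfz : f z ≠ 0) (hzero : ∀ w ∈ closedBall c R, f w = 0 → w.re ≤ z.re) :
    -(2 * (1 + 2 * r / (R - r)) / (R - r) * M) ≤ (logDeriv f z).re := by
  classical
  have hR : 0 < R := hr.trans_lt hrR
  obtain ⟨S, n, g, hg, hg0, hfg⟩ := exists_eq_prod_mul_of_analyticOnNhd (by positivity) hf hc
  -- A point of exponent zero need not be a zero of `f`, so nothing would be known about its real
  -- part; such points go to `S₂`.
  set S₁ := S.filter fun u => u ∈ closedBall c R ∧ n u ≠ 0 with hS₁
  set S₂ := S.filter fun u => ¬ (u ∈ closedBall c R ∧ n u ≠ 0) with hS₂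
  set P : ℂ → ℂ := fun w => ∏ u ∈ S₁, (w - u) ^ n u with hP
  set g₁ : ℂ → ℂ := fun w => (∏ u ∈ S₂, (w - u) ^ n u) * g w with hg₁
  have hfP : ∀ w ∈ closedBall c (2 * R), f w = P w * g₁ w := by
    intro w hw
    rw [hfg w hw, hP, hg₁, ← mul_assoc, Finset.prod_filter_mul_prod_filter_not]
  have hsub : closedBall c R ⊆ closedBall c (2 * R) := closedBall_subset_closedBall (by linarith)
  have hcR : c ∈ closedBall c R := mem_closedBall_self hR.le
  have hg₁a : AnalyticOnNhd ℂ g₁ (closedBall c (2 * R)) := by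
    intro w hw
    exact (Finset.analyticAt_fun_prod _ fun u _ => by fun_prop).mul (hg w hw)
  have hg₁0 : ∀ w ∈ closedBall c R, g₁ w ≠ 0 := by
    intro w hw
    refine mul_ne_zero (Finset.prod_ne_zero_iff.2 fun u hu => ?_) (hg0 w (hsub hw))
    intro h
    rw [pow_eq_zero_iff'] at h
    rw [sub_eq_zero] at h
    obtain ⟨rfl, h⟩ := h
    exact (Finset.mem_filter.1 hu).2 ⟨hw, h⟩
  have hPc : P c ≠ 0 := fun h => hc (by rw [hfP c (hsub hcR), h, zero_mul])
  -- On the sphere of radius 2R one has |w - u| ≥ R ≥ |c - u| for every removed zero u, so dividing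
  -- by `P` does not spoil the bound relative to the centre.
  have hPge : ∀ w ∈ sphere c (2 * R), ‖P c‖ ≤ ‖P w‖ := by
    intro w hw
    simp only [hP, norm_prod, norm_pow]
    refine Finset.prod_le_prod (fun _ _ => by positivity) fun u hu => ?_
    gcongr
    have hu' : ‖u - c‖ ≤ R := by
      have := (Finset.mem_filter.1 hu).2.1
      rwa [mem_closedBall, dist_eq_norm] at this
    have hw' : ‖w - c‖ = 2 * R := by rwa [mem_sphere, dist_eq_norm] at hw
    have := norm_sub_norm_le (w - c) (u - c)
    rw [sub_sub_sub_cancel_right] at this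
    rw [norm_sub_rev]
    linarith
  have hg₁b : ∀ w ∈ closedBall c (2 * R), ‖g₁ w‖ ≤ Real.exp M * ‖g₁ c‖ := by
    intro w hw
    have hcl : closure (ball c (2 * R)) = closedBall c (2 * R) := closure_ball c (by positivity)
    refine Complex.norm_le_of_forall_mem_frontier_norm_le (U := ball c (2 * R)) isBounded_ball
      ⟨hg₁a.differentiableOn.mono ball_subset_closedBall, ?_⟩ ?_ (by rwa [hcl])
    · rw [hcl]; exact hg₁a.continuousOn
    · intro v hv
      rw [frontier_ball c (by positivity)] at hv
      have hv' := sphere_subset_closedBall hv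
      have h := hb v hv'
      rw [hfP v hv', hfP c (hsub hcR), norm_mul (P v), norm_mul (P c)] at h
      have h1 := hPge v hv
      have h2 : 0 < ‖P c‖ := norm_pos_iff.2 hPc
      have h3 : ‖P c‖ * ‖g₁ v‖ ≤ ‖P c‖ * (Real.exp M * ‖g₁ c‖) := by
        calc ‖P c‖ * ‖g₁ v‖ ≤ ‖P v‖ * ‖g₁ v‖ := by gcongr
          _ ≤ _ := by rw [mul_left_comm]; exact h
      exact le_of_mul_le_mul_left h3 h2
  have hlog := norm_logDeriv_le_of_ne_zero_on_ball (z := z) hr hrR hM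
    (hg₁a.differentiableOn.mono (ball_subset_closedBall.trans hsub))
    (fun w hw => hg₁0 w (ball_subset_closedBall hw))
    (fun w hw => hg₁b w (hsub (ball_subset_closedBall hw))) hz
  have hzR : z ∈ ball c R := by rw [mem_ball, dist_eq_norm]; linarith
  have hzR' := hsub (ball_subset_closedBall hzR)
  have hPz : P z ≠ 0 := fun h => hfz (by rw [hfP z hzR', h, zero_mul])
  have hev : f =ᶠ[𝓝 z] fun w => P w * g₁ w := by
    filter_upwards [isOpen_ball.mem_nhds hzR] with w hw
    exact hfP w (hsub (ball_subset_closedBall hw))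
  have hPd : ∀ u ∈ S₁, z - u ≠ 0 := by
    intro u hu h
    refine hPz (Finset.prod_eq_zero hu ?_)
    rw [h, zero_pow (Finset.mem_filter.1 hu).2.2]
  have hld : logDeriv f z = logDeriv P z + logDeriv g₁ z := by
    rw [show logDeriv f z = logDeriv (fun w => P w * g₁ w) z by
      rw [logDeriv_apply, logDeriv_apply, hev.deriv_eq, hev.eq_of_nhds]]
    exact logDeriv_mul z hPz (hg₁0 z (ball_subset_closedBall hzR)) (by fun_prop)
      (hg₁a z hzR').differentiableAt
  have hPld : logDeriv P z = ∑ u ∈ S₁, (n u : ℂ) / (z - u) := by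
    rw [hP, logDeriv_prod]
    · refine Finset.sum_congr rfl fun u hu => ?_
      have := hPd u hu
      rw [logDeriv_fun_pow (by fun_prop), logDeriv_apply]
      simp [div_eq_mul_inv]
    · intro u hu
      exact pow_ne_zero _ (hPd u hu)
    · intro u _
      fun_prop
  have hPre : 0 ≤ (logDeriv P z).re := by
    rw [hPld, Complex.re_sum]
    refine Finset.sum_nonneg fun u hu => ?_
    have hu1 := (Finset.mem_filter.1 hu).2
    have hfu : f u = 0 := by
      rw [hfP u (hsub hu1.1)]
      have : P u = 0 := Finset.prod_eq_zero hu (by rw [sub_self, zero_pow hu1.2])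
      rw [this, zero_mul]
    have hre := hzero u hu1.1 hfu
    rw [Complex.div_re]
    simp only [Complex.natCast_re, Complex.natCast_im, zero_mul, zero_div, add_zero, Complex.sub_re]
    have : 0 ≤ z.re - u.re := by linarith
    have := Complex.normSq_nonneg (z - u)
    positivity
  rw [hld, Complex.add_re]
  have := neg_le_of_abs_le ((Complex.abs_re_le_norm (logDeriv g₁ z)).trans hlog)
  linarith

/-! ### Maximum principle on a rectangle; growth along horizontal lines -/

theorem norm_le_of_norm_le_on_rectangle {φ : ℂ → ℂ} {a b c d K : ℝ} (hab : a < b) (hcd : c < d)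
    (hφ : ∀ z : ℂ, a ≤ z.re → z.re ≤ b → c ≤ z.im → z.im ≤ d → DifferentiableAt ℂ φ z)
    (hl : ∀ z : ℂ, z.re = a → c ≤ z.im → z.im ≤ d → ‖φ z‖ ≤ K)
    (hr : ∀ z : ℂ, z.re = b → c ≤ z.im → z.im ≤ d → ‖φ z‖ ≤ K)
    (hb : ∀ z : ℂ, z.im = c → a ≤ z.re → z.re ≤ b → ‖φ z‖ ≤ K)
    (ht : ∀ z : ℂ, z.im = d → a ≤ z.re → z.re ≤ b → ‖φ z‖ ≤ K)
    {z : ℂ} (h1 : a ≤ z.re) (h2 : z.re ≤ b) (h3 : c ≤ z.im) (h4 : z.im ≤ d) : ‖φ z‖ ≤ K := by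
  have hcl : closure (Ioo a b ×ℂ Ioo c d) = Icc a b ×ℂ Icc c d := by
    rw [Complex.closure_reProdIm, closure_Ioo hab.ne, closure_Ioo hcd.ne]
  have hd : DifferentiableOn ℂ φ (Icc a b ×ℂ Icc c d) := fun z hz =>
    (hφ z hz.1.1 hz.1.2 hz.2.1 hz.2.2).differentiableWithinAt
  refine Complex.norm_le_of_forall_mem_frontier_norm_le (U := Ioo a b ×ℂ Ioo c d)
    ((isBounded_Ioo a b).reProdIm (isBounded_Ioo c d)) ⟨hd.mono ?_, ?_⟩ ?_ ?_
  · rw [← hcl]; exact subset_closure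
  · rw [hcl]; exact hd.continuousOn
  · intro w hw
    rw [Complex.frontier_reProdIm, closure_Ioo hab.ne, closure_Ioo hcd.ne, frontier_Ioo hab,
      frontier_Ioo hcd] at hw
    rcases hw with ⟨⟨h1, h2⟩, h3 | h3⟩ | ⟨h1 | h1, ⟨h2, h3⟩⟩
    · exact hb w h3 h1 h2
    · exact ht w h3 h1 h2
    · exact hl w h1 h2 h3
    · exact hr w h1 h2 h3
  · rw [hcl]; exact ⟨⟨h1, h2⟩, ⟨h3, h4⟩⟩

theorem hasDerivAt_comp_ofReal_add {g : ℂ → ℂ} {g' : ℂ} {t x : ℝ}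
    (hg : HasDerivAt g g' ((x : ℂ) + t * Complex.I)) :
    HasDerivAt (fun y : ℝ => g ((y : ℂ) + t * Complex.I)) g' x := by
  have h := (hasDerivAt_id (x : ℂ)).add_const ((t : ℂ) * Complex.I)
  have h2 : HasDerivAt (fun z : ℂ => g (z + t * Complex.I)) (g' * 1) (x : ℂ) :=
    HasDerivAt.comp (x : ℂ) (h₂ := g) (by simpa using hg) h
  simpa using h2.comp_ofReal

theorem hasDerivAt_re_comp_ofReal_add {g : ℂ → ℂ} {g' : ℂ} {t x : ℝ}
    (hg : HasDerivAt g g' ((x : ℂ) + t * Complex.I)) :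
    HasDerivAt (fun y : ℝ => (g ((y : ℂ) + t * Complex.I)).re) g'.re x :=
  Complex.reCLM.hasFDerivAt.comp_hasDerivAt x (hasDerivAt_comp_ofReal_add hg)

/-- The ball about σ + it touches the line Re = x₀, so |g'| ≤ 2 Re g/(σ - x₀). This says exactly
that (σ - x₀)² Re g has nonnegative derivative. -/
theorem sq_mul_re_le_of_re_nonneg {g : ℂ → ℂ} {x₀ b t : ℝ}
    (hd : ∀ σ : ℝ, x₀ < σ → σ ≤ b →
      DifferentiableOn ℂ g (ball ((σ : ℂ) + t * Complex.I) (σ - x₀)))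
    (hre : ∀ σ : ℝ, x₀ < σ → σ ≤ b → ∀ z ∈ ball ((σ : ℂ) + t * Complex.I) (σ - x₀), 0 ≤ (g z).re)
    {σ₁ σ₂ : ℝ} (h₁ : x₀ < σ₁) (h₁₂ : σ₁ ≤ σ₂) (h₂ : σ₂ ≤ b) :
    (σ₁ - x₀) ^ 2 * (g ((σ₁ : ℂ) + t * Complex.I)).re ≤
      (σ₂ - x₀) ^ 2 * (g ((σ₂ : ℂ) + t * Complex.I)).re := by
  have hder : ∀ σ ∈ Icc σ₁ σ₂, HasDerivAt
      (fun σ : ℝ => (σ - x₀) ^ 2 * (g ((σ : ℂ) + t * Complex.I)).re)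
      (2 * (σ - x₀) * (g ((σ : ℂ) + t * Complex.I)).re +
        (σ - x₀) ^ 2 * (deriv g ((σ : ℂ) + t * Complex.I)).re) σ := by
    intro σ hσ
    have hσ0 : x₀ < σ := h₁.trans_le hσ.1
    have h1 := ((hd σ hσ0 (hσ.2.trans h₂)).differentiableAt
      (isOpen_ball.mem_nhds (mem_ball_self (by linarith)))).hasDerivAt
    refine ((((hasDerivAt_id σ).sub_const x₀).pow 2).mul
      (hasDerivAt_re_comp_ofReal_add h1)).congr_deriv ?_
    simp
  have hmono : MonotoneOn (fun σ : ℝ => (σ - x₀) ^ 2 * (g ((σ : ℂ) + t * Complex.I)).re)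
      (Icc σ₁ σ₂) := by
    refine monotoneOn_of_deriv_nonneg (convex_Icc _ _)
      (fun σ hσ => (hder σ hσ).continuousAt.continuousWithinAt)
      (fun σ hσ => (hder σ (interior_subset hσ)).differentiableAt.differentiableWithinAt) ?_
    intro σ hσ
    have hσ' := interior_subset hσ
    have hσ0 : x₀ < σ := h₁.trans_le hσ'.1
    rw [(hder σ hσ').deriv]
    have h := norm_deriv_le_of_re_nonneg (sub_pos.2 hσ0) (hd σ hσ0 (hσ'.2.trans h₂))
      (hre σ hσ0 (hσ'.2.trans h₂))
    rw [le_div_iff₀ (sub_pos.2 hσ0)] at h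
    have h' := neg_le_of_abs_le (Complex.abs_re_le_norm (deriv g ((σ : ℂ) + t * Complex.I)))
    have hp : 0 < σ - x₀ := sub_pos.2 hσ0
    nlinarith [mul_le_mul_of_nonneg_left h' hp.le]
  exact hmono ⟨le_rfl, h₁₂⟩ ⟨h₁₂, le_rfl⟩ h₁₂

/-! ### Gamma quotients and polynomial growth of L -/

theorem norm_betaIntegral_le (u v : ℂ) :
    ‖Complex.betaIntegral u v‖ ≤ ∫ x in (0 : ℝ)..1, x ^ (u.re - 1) * (1 - x) ^ (v.re - 1) := by
  unfold Complex.betaIntegral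
  refine (intervalIntegral.norm_integral_le_integral_norm zero_le_one).trans_eq ?_
  simp only [intervalIntegral.integral_of_le zero_le_one, MeasureTheory.integral_Ioc_eq_integral_Ioo]
  refine MeasureTheory.setIntegral_congr_fun measurableSet_Ioo fun x hx => ?_
  have h1 : (1 - x : ℂ) = ((1 - x : ℝ) : ℂ) := by push_cast; rfl
  simp only [norm_mul]
  rw [h1, Complex.norm_cpow_eq_rpow_re_of_pos hx.1,
    Complex.norm_cpow_eq_rpow_re_of_pos (sub_pos.2 hx.2)]
  simp

/-- From Γ(s)Γ(x' - x) = Γ(w)B(s, x' - x): the modulus of the beta integral is at most its value at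
real arguments, uniformly in the height. -/
theorem exists_norm_Gamma_le_of_lt {x x' : ℝ} (hx : 0 < x) (hxx' : x < x') :
    ∃ C : ℝ, 0 < C ∧ ∀ s w : ℂ, s.re = x → w.re = x' → s.im = w.im →
      ‖Complex.Gamma s‖ ≤ C * ‖Complex.Gamma w‖ := by
  set B : ℝ := ∫ y in (0 : ℝ)..1, y ^ (x - 1) * (1 - y) ^ (x' - x - 1) with hB
  have hG : 0 < Real.Gamma (x' - x) := Real.Gamma_pos_of_pos (by linarith)
  refine ⟨(|B| + 1) / Real.Gamma (x' - x), by positivity, fun s w hs hw hsw => ?_⟩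
  have h := Complex.Gamma_mul_Gamma_eq_betaIntegral (s := s) (t := ((x' - x : ℝ) : ℂ))
    (by rw [hs]; exact hx) (by rw [Complex.ofReal_re]; linarith)
  have hsw' : s + ((x' - x : ℝ) : ℂ) = w := by
    apply Complex.ext
    · simp [hs, hw]
    · simp [hsw]
  have hb := norm_betaIntegral_le s ((x' - x : ℝ) : ℂ)
  rw [hs, Complex.ofReal_re, ← hB] at hb
  have h' := congrArg norm h
  rw [norm_mul, norm_mul, hsw', Complex.Gamma_ofReal, Complex.norm_real,
    Real.norm_of_nonneg hG.le] at h'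
  rw [div_mul_eq_mul_div, le_div_iff₀ hG, h', mul_comm]
  gcongr
  linarith [le_abs_self B]

theorem exists_norm_Gamma_add_nat_le (x : ℝ) (n : ℕ) :
    ∃ C : ℝ, 0 < C ∧ ∀ s : ℂ, s.re = x → s.im ≠ 0 →
      ‖Complex.Gamma (s + n)‖ ≤ C * (1 + |s.im|) ^ n * ‖Complex.Gamma s‖ := by
  induction n with
  | zero => exact ⟨1, one_pos, fun s _ _ => by simp⟩
  | succ n ih =>
    obtain ⟨C, hC, h⟩ := ih
    refine ⟨(|x| + n + 1) * C, by positivity, fun s hs hs0 => ?_⟩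
    have hne : s + n ≠ 0 := by
      intro h
      have := congrArg Complex.im h
      simp at this
      exact hs0 this
    have hn : ‖s + n‖ ≤ (|x| + n + 1) * (1 + |s.im|) := by
      calc ‖s + n‖ ≤ |(s + n).re| + |(s + n).im| := Complex.norm_le_abs_re_add_abs_im _
        _ ≤ |x| + n + |s.im| := by
          have := abs_add_le x (n : ℝ)
          rw [Nat.abs_cast] at this
          simp only [Complex.add_re, Complex.natCast_re, Complex.add_im, Complex.natCast_im,
            add_zero, hs]
          linarith
        _ ≤ _ := by nlinarith [abs_nonneg x, abs_nonneg s.im, (Nat.cast_nonneg n : (0 : ℝ) ≤ n),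
            mul_nonneg (abs_nonneg x) (abs_nonneg s.im),
            mul_nonneg (Nat.cast_nonneg n : (0 : ℝ) ≤ n) (abs_nonneg s.im)]
    rw [Nat.cast_succ, ← add_assoc, Complex.Gamma_add_one _ hne, norm_mul]
    calc ‖s + n‖ * ‖Complex.Gamma (s + n)‖
        ≤ ((|x| + n + 1) * (1 + |s.im|)) * (C * (1 + |s.im|) ^ n * ‖Complex.Gamma s‖) := by
          gcongr
          exact h s hs hs0
      _ = _ := by ring

/-- Shift `w` to the right of `s` by an integer, compare there, and undo the shift with Γ(z + 1) =
zΓ(z), which costs a power of the height. This replaces Stirling's formula. -/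
theorem exists_norm_Gamma_le_mul_pow {x : ℝ} (hx : 0 < x) (x' : ℝ) :
    ∃ (C : ℝ) (n : ℕ), 0 < C ∧ ∀ s w : ℂ, s.re = x → w.re = x' → s.im = w.im → w.im ≠ 0 →
      ‖Complex.Gamma s‖ ≤ C * (1 + |w.im|) ^ n * ‖Complex.Gamma w‖ := by
  obtain ⟨n, hn⟩ := exists_nat_gt (x - x')
  obtain ⟨C₁, hC₁, h₁⟩ := exists_norm_Gamma_le_of_lt hx (x' := x' + n) (by linarith)
  obtain ⟨C₂, hC₂, h₂⟩ := exists_norm_Gamma_add_nat_le x' n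
  refine ⟨C₁ * C₂, n, by positivity, fun s w hs hw hsw hw0 => ?_⟩
  calc ‖Complex.Gamma s‖ ≤ C₁ * ‖Complex.Gamma (w + n)‖ :=
        h₁ s (w + n) hs (by simp [hw]) (by simp [hsw])
    _ ≤ C₁ * (C₂ * (1 + |w.im|) ^ n * ‖Complex.Gamma w‖) := by
        gcongr
        exact h₂ w hw hw0
    _ = _ := by ring

theorem exists_norm_le_of_two_le_re {a : ℕ → ℂ} {L : ℂ → ℂ}
    (h : ∀ s : ℂ, 1 < s.re → LSeriesHasSum a s (L s)) :
    ∃ C : ℝ, 0 < C ∧ ∀ s : ℂ, 2 ≤ s.re → ‖L s‖ ≤ C := by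
  have h2 : LSeriesSummable a 2 := (h 2 (by simp)).LSeriesSummable
  refine ⟨(∑' n, ‖LSeries.term a 2 n‖) + 1, ?_, fun s hs => ?_⟩
  · have : 0 ≤ ∑' n, ‖LSeries.term a 2 n‖ := tsum_nonneg fun _ => norm_nonneg _
    linarith
  · have hs1 : 1 < s.re := by linarith
    have hsum := (h s hs1).LSeriesSummable.norm
    rw [← (h s hs1).LSeries_eq, LSeries]
    have h3 := norm_tsum_le_tsum_norm hsum
    have h4 := hsum.tsum_le_tsum
      (fun n => LSeries.norm_term_le_of_re_le_re a (s := 2) (s' := s) (by simpa using hs) n) h2.norm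
    linarith

/-- The functional equation expresses |L(x + it)| as |L(1 - x + it)| times gamma quotients and a
power of `Q`. Since 1 - x ≥ 2 the Dirichlet series is bounded there, and the quotients grow
polynomially. -/
theorem exists_norm_le_pow_on_line {a : ℕ → ℂ} {L : ℂ → ℂ}
    (h : ∀ s : ℂ, 1 < s.re → LSeriesHasSum a s (L s)) (hfe : FunctionalEquation L)
    {x : ℝ} (hx : x ≤ -1) :
    ∃ (C T : ℝ) (n : ℕ), 0 < C ∧ ∀ s : ℂ, s.re = x → T ≤ |s.im| → ‖L s‖ ≤ C * (1 + |s.im|) ^ n := by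
  obtain ⟨k, Q, l, μ, θ, hθ, hQ, hl, hμ, hfe⟩ := hfe
  obtain ⟨C₀, hC₀, hL⟩ := exists_norm_le_of_two_le_re h
  have hΓ : ∀ j : Fin k, ∃ (C : ℝ) (n : ℕ), 0 < C ∧ ∀ s w : ℂ,
      s.re = l j * (1 - x) + (μ j).re → w.re = l j * x + (μ j).re → s.im = w.im → w.im ≠ 0 →
      ‖Complex.Gamma s‖ ≤ C * (1 + |w.im|) ^ n * ‖Complex.Gamma w‖ := fun j =>
    exists_norm_Gamma_le_mul_pow (by
      have := mul_pos (hl j) (show 0 < 1 - x by linarith)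
      linarith [hμ j]) _
  choose C n hC hΓ using hΓ
  -- The height threshold forces every l_j Im s + Im μ_j to be nonzero, so both `s` and its
  -- reflection, which has the same imaginary part, are regular points.
  refine ⟨C₀ * Q ^ (1 - 2 * x) * ∏ j, (C j * (1 + l j + |(μ j).im|) ^ n j),
    1 + ∑ j, (1 + |(μ j).im|) / l j, ∑ j, n j, ?_, fun s hs hT => ?_⟩
  · have : 0 < ∏ j, (C j * (1 + l j + |(μ j).im|) ^ n j) := Finset.prod_pos fun j _ => by
      have := hl j
      have := hC j
      positivity
    have := Real.rpow_pos_of_pos hQ (1 - 2 * x)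
    positivity
  have hterm : ∀ j, 0 ≤ (1 + |(μ j).im|) / l j := fun j => by
    have := hl j
    positivity
  have him : ∀ j, ∀ e : ℝ, |e| = |s.im| → l j * e + (μ j).im ≠ 0 := by
    intro j e he h0
    have h1 : (1 + |(μ j).im|) / l j ≤ |s.im| := by
      refine le_trans ?_ ((le_add_of_nonneg_left zero_le_one).trans hT)
      exact Finset.single_le_sum (f := fun j => (1 + |(μ j).im|) / l j)
        (fun j _ => hterm j) (Finset.mem_univ j)
    rw [div_le_iff₀ (hl j), ← he] at h1
    have h2 : |l j * e| = |(μ j).im| := by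
      rw [← abs_neg (μ j).im]; congr 1; linarith
    rw [abs_mul, abs_of_pos (hl j)] at h2
    linarith
  have hs1 : 1 ≤ |s.im| := by
    have : 0 ≤ ∑ j, (1 + |(μ j).im|) / l j := Finset.sum_nonneg fun j _ => hterm j
    linarith
  have hs0 : s.im ≠ 0 := fun h0 => by rw [h0, abs_zero] at hs1; linarith
  have hreg : ∀ w : ℂ, w.im = s.im → IsRegularPoint l μ w := by
    intro w hw
    refine ⟨fun h1 => hs0 (by rw [← hw, h1, Complex.one_im]), fun j m hm => ?_⟩
    have := congrArg Complex.im hm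
    simp at this
    exact him j w.im (by rw [hw]) this
  have heq := congrArg norm (hfe s (hreg s rfl) (hreg _ (by simp)))
  set w : ℂ := 1 - starRingEnd ℂ s with hw
  have hwim : w.im = s.im := by simp [hw]
  have hwre : w.re = 1 - x := by simp [hw, hs]
  rw [norm_mul, hθ, one_mul, RCLike.norm_conj, completed, completed, norm_mul, norm_mul, norm_mul,
    norm_mul, norm_prod, norm_prod, Complex.norm_cpow_eq_rpow_re_of_pos hQ,
    Complex.norm_cpow_eq_rpow_re_of_pos hQ, hs, hwre] at heq
  have hΓ0 : ∀ j, 0 < ‖Complex.Gamma (l j * s + μ j)‖ := by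
    intro j
    refine norm_pos_iff.2 (Complex.Gamma_ne_zero fun m hm => ?_)
    exact (hreg s rfl).2 j m hm
  have hprod : ∏ j, ‖Complex.Gamma (l j * w + μ j)‖ ≤
      (∏ j, (C j * (1 + l j + |(μ j).im|) ^ n j)) * (1 + |s.im|) ^ (∑ j, n j) *
        ∏ j, ‖Complex.Gamma (l j * s + μ j)‖ := by
    rw [← Finset.prod_pow_eq_pow_sum, ← Finset.prod_mul_distrib, ← Finset.prod_mul_distrib]
    refine Finset.prod_le_prod (fun _ _ => norm_nonneg _) fun j _ => ?_
    have h1 := hΓ j (l j * w + μ j) (l j * s + μ j) (by simp [hwre]) (by simp [hs])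
      (by simp [hwim]) (by simpa using him j s.im rfl)
    refine h1.trans ?_
    have hlj := hl j
    have hCj := hC j
    refine mul_le_mul_of_nonneg_right ?_ (norm_nonneg _)
    rw [mul_assoc, ← mul_pow]
    gcongr
    simp only [Complex.add_im, Complex.mul_im, Complex.ofReal_re, Complex.ofReal_im, zero_mul,
      add_zero]
    have h2 := abs_add_le (l j * s.im) (μ j).im
    rw [abs_mul, abs_of_pos (hl j)] at h2
    nlinarith [abs_nonneg (μ j).im, mul_nonneg (abs_nonneg (μ j).im) (abs_nonneg s.im)]
  have hP : 0 < ∏ j, ‖Complex.Gamma (l j * s + μ j)‖ := Finset.prod_pos fun j _ => hΓ0 j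
  have hQx : Q ^ (1 - x) = Q ^ (1 - 2 * x) * Q ^ x := by
    rw [← Real.rpow_add hQ]; congr 1; ring
  have hQp := Real.rpow_pos_of_pos hQ x
  have hQp' := Real.rpow_pos_of_pos hQ (1 - 2 * x)
  refine le_of_mul_le_mul_right ?_ (mul_pos hQp hP)
  calc ‖L s‖ * (Q ^ x * ∏ j, ‖Complex.Gamma (l j * s + μ j)‖)
      = ‖L w‖ * Q ^ (1 - x) * ∏ j, ‖Complex.Gamma (l j * w + μ j)‖ := by rw [← heq]; ring
    _ ≤ C₀ * Q ^ (1 - x) * ((∏ j, (C j * (1 + l j + |(μ j).im|) ^ n j)) *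
        (1 + |s.im|) ^ (∑ j, n j) * ∏ j, ‖Complex.Gamma (l j * s + μ j)‖) := by
        have := hL w (by rw [hwre]; linarith)
        gcongr
    _ = _ := by rw [hQx]; ring

/-- Finite order supplies the growth hypothesis of Phragmén-Lindelöf: the strip used has width 5,
and the rate 1/2 is below π/5. -/
theorem isBigO_exp_exp_of_finite_order {F : ℂ → ℂ} {ρ : ℝ}
    (hF : F =O[cocompact ℂ] fun s : ℂ => Real.exp (‖s‖ ^ ρ)) (a b : ℝ) :
    F =O[comap (_root_.abs ∘ Complex.im) atTop ⊓ 𝓟 (Complex.re ⁻¹' Ioo a b)]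
      fun z => Real.exp (1 * Real.exp (1 / 2 * |z.im|)) := by
  set l := comap (_root_.abs ∘ Complex.im) atTop ⊓ 𝓟 (Complex.re ⁻¹' Ioo a b) with hl
  have him : Tendsto (fun z : ℂ => |z.im|) l atTop := tendsto_comap.mono_left inf_le_left
  have hnorm : Tendsto (fun z : ℂ => ‖z‖) l atTop :=
    tendsto_atTop_mono (fun z => Complex.abs_im_le_norm z) him
  have hle : l ≤ cocompact ℂ := by
    rw [← Metric.cobounded_eq_cocompact, ← comap_norm_atTop]
    exact hnorm.le_comap
  refine (hF.mono hle).trans (IsBigO.of_bound 1 ?_)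
  set D : ℝ := |a| + |b| with hD
  have hlim : ∀ᶠ y : ℝ in atTop, (y + D) ^ |ρ| ≤ Real.exp (1 / 2 * y) := by
    have h := (isLittleO_rpow_exp_pos_mul_atTop |ρ| (show (0 : ℝ) < 1 / 2 by norm_num)).bound
      (Real.exp_pos (-(1 / 2 * D)))
    have h2 := (tendsto_atTop_add_const_right atTop D tendsto_id).eventually h
    filter_upwards [h2, eventually_ge_atTop (0 : ℝ)] with y hy hy0
    have hD0 : 0 ≤ D := by positivity
    simp only [id, Real.norm_of_nonneg (Real.exp_pos _).le,
      Real.norm_of_nonneg (Real.rpow_nonneg (add_nonneg hy0 hD0) _), ← Real.exp_add] at hy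
    convert hy using 2
    ring
  filter_upwards [him.eventually hlim, hnorm.eventually (eventually_ge_atTop 1),
    mem_inf_of_right (mem_principal_self _)] with z h1 h2 h3
  rw [Real.norm_of_nonneg (Real.exp_pos _).le, Real.norm_of_nonneg (Real.exp_pos _).le, one_mul,
    one_mul]
  refine Real.exp_le_exp.2 (le_trans ?_ h1)
  have h4 : |z.re| ≤ D := abs_le.2
    ⟨by linarith [h3.1, neg_abs_le a, abs_nonneg b], by linarith [h3.2, le_abs_self b, abs_nonneg a]⟩
  calc ‖z‖ ^ ρ ≤ ‖z‖ ^ |ρ| := Real.rpow_le_rpow_of_exponent_le h2 (le_abs_self ρ)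
    _ ≤ _ := by
      refine Real.rpow_le_rpow (norm_nonneg _) ?_ (abs_nonneg _)
      linarith [Complex.norm_le_abs_re_add_abs_im z]

/-- Phragmén-Lindelöf for F(s)/(s + 4)^N between Re s = -3 (functional equation) and Re s = 2
(absolute convergence). The abscissa -3 is where discs of radius 6 centred on Re s = 3 end. -/
theorem IsSelberg.exists_norm_le_exp_mul_log {a : ℕ → ℂ} {L : ℂ → ℂ} (hL : IsSelberg a L) :
    ∃ A : ℝ, 0 < A ∧ ∀ s : ℂ, -3 ≤ s.re → 2 ≤ s.im → ‖L s‖ ≤ Real.exp (A * Real.log s.im) := by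
  obtain ⟨m, F, ⟨hFd, ρ, hF⟩, hFL⟩ := hL.continuation
  obtain ⟨C₀, hC₀, hL2⟩ := exists_norm_le_of_two_le_re hL.dirichlet
  obtain ⟨C, T, n, hC, hL3⟩ := exists_norm_le_pow_on_line hL.dirichlet hL.functional
    (x := -3) (by norm_num)
  -- Covers the bounded part of the line Re s = -3, where the functional equation bound is not
  -- available.
  obtain ⟨D, hD⟩ := (isCompact_closedBall (0 : ℂ) (3 + |T|)).exists_bound_of_continuousOn
    hFd.continuous.continuousOn
  set N := m + n with hN
  set K : ℝ := 5 ^ m * (C * 2 ^ n) + |D| + 5 ^ m * C₀ with hK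
  have hK0 : 0 < K := by positivity
  have hs4 : ∀ s : ℂ, -3 ≤ s.re → 1 ≤ ‖s + 4‖ := by
    intro s hs
    refine le_trans ?_ (Complex.re_le_norm _)
    simp
    linarith
  have hs4' : ∀ s : ℂ, -3 ≤ s.re → s + 4 ≠ 0 := fun s hs =>
    norm_pos_iff.1 (zero_lt_one.trans_le (hs4 s hs))
  have hsim : ∀ s : ℂ, |s.im| ≤ ‖s + 4‖ := fun s => by
    simpa using Complex.abs_im_le_norm (s + 4)
  have hsub : ∀ s : ℂ, -3 ≤ s.re → s.re ≤ 2 → ‖s - 1‖ ≤ 5 * ‖s + 4‖ := by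
    intro s h1 h2
    have h3 := Complex.norm_le_abs_re_add_abs_im (s - 1)
    have h4 : |(s - 1).re| ≤ 4 := by
      simp only [Complex.sub_re, Complex.one_re]
      exact abs_le.2 ⟨by linarith, by linarith⟩
    have h5 : (s - 1).im = s.im := by simp
    rw [h5] at h3
    linarith [hs4 s h1, hsim s]
  have hK1 : 5 ^ m * (C * 2 ^ n) ≤ K := by
    have : (0 : ℝ) ≤ |D| + 5 ^ m * C₀ := by positivity
    linarith
  have hK2 : |D| ≤ K := by
    have : (0 : ℝ) ≤ 5 ^ m * (C * 2 ^ n) + 5 ^ m * C₀ := by positivity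
    linarith
  have hK3 : 5 ^ m * C₀ ≤ K := by
    have : (0 : ℝ) ≤ 5 ^ m * (C * 2 ^ n) + |D| := by positivity
    linarith
  have hstrip : ∀ s : ℂ, -3 ≤ s.re → s.re ≤ 2 → ‖F s / (s + 4) ^ N‖ ≤ K := by
    intro s h1 h2
    refine PhragmenLindelof.vertical_strip (f := fun s => F s / (s + 4) ^ N) (a := -3) (b := 2)
      ⟨?_, ?_⟩ ⟨1 / 2, ?_, 1, ?_⟩ ?_ ?_ h1 h2
    · intro z hz
      have : (z + 4) ^ N ≠ 0 := pow_ne_zero _ (hs4' z hz.1.le)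
      exact (DifferentiableAt.div (hFd z) (by fun_prop) this).differentiableWithinAt
    · intro z hz
      rw [Complex.closure_preimage_re, closure_Ioo (by norm_num)] at hz
      have : (z + 4) ^ N ≠ 0 := pow_ne_zero _ (hs4' z hz.1)
      exact (DifferentiableAt.div (hFd z) (by fun_prop) this).continuousAt.continuousWithinAt
    · rw [lt_div_iff₀ (by norm_num)]
      linarith [Real.pi_gt_three]
    · refine IsBigO.trans (IsBigO.of_bound 1 ?_) (isBigO_exp_exp_of_finite_order hF (-3) 2)
      filter_upwards [mem_inf_of_right (mem_principal_self _)] with z hz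
      rw [norm_div, norm_pow, one_mul]
      exact div_le_self (norm_nonneg _) (one_le_pow₀ (hs4 z hz.1.le))
    · intro z hz
      have hz4 := hs4 z hz.ge
      have hzp : 0 < ‖z + 4‖ ^ N := by positivity
      rw [norm_div, norm_pow, div_le_iff₀ hzp]
      rcases le_or_gt T |z.im| with hT | hT
      · have hz1 : z ≠ 1 := fun h => by rw [h] at hz; norm_num at hz
        rw [hFL z hz1, norm_mul, norm_pow]
        calc ‖z - 1‖ ^ m * ‖L z‖ ≤ (5 * ‖z + 4‖) ^ m * (C * (2 * ‖z + 4‖) ^ n) := by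
              have h3 := hL3 z hz hT
              have h4 : 1 + |z.im| ≤ 2 * ‖z + 4‖ := by linarith [hsim z]
              have h5 := hsub z hz.ge (by rw [hz]; norm_num)
              have h6 : (1 + |z.im|) ^ n ≤ (2 * ‖z + 4‖) ^ n := by gcongr
              gcongr
              exact h3.trans (by gcongr)
          _ = 5 ^ m * (C * 2 ^ n) * ‖z + 4‖ ^ N := by rw [hN]; ring
          _ ≤ _ := by gcongr
      · have h3 : ‖F z‖ ≤ D := hD z (by
          rw [mem_closedBall_zero_iff]
          refine (Complex.norm_le_abs_re_add_abs_im z).trans ?_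
          rw [hz, abs_neg]
          have := le_abs_self T
          norm_num
          linarith)
        calc ‖F z‖ ≤ K * 1 := by linarith [le_abs_self D]
          _ ≤ _ := by gcongr; exact one_le_pow₀ hz4
    · intro z hz
      have hz3 : -3 ≤ z.re := by rw [hz]; norm_num
      have hz4 := hs4 z hz3
      have hzp : 0 < ‖z + 4‖ ^ N := by positivity
      rw [norm_div, norm_pow, div_le_iff₀ hzp]
      have hz1 : z ≠ 1 := fun h => by rw [h] at hz; norm_num at hz
      rw [hFL z hz1, norm_mul, norm_pow]
      calc ‖z - 1‖ ^ m * ‖L z‖ ≤ (5 * ‖z + 4‖) ^ m * C₀ := by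
            have h5 := hsub z hz3 hz.le
            have h6 := hL2 z hz.ge
            gcongr
        _ = 5 ^ m * C₀ * ‖z + 4‖ ^ m := by ring
        _ ≤ K * ‖z + 4‖ ^ N := by
            gcongr
            omega
  have hlog2 : 0 < Real.log 2 := Real.log_pos one_lt_two
  -- As Im s ≥ 2, a constant K + 1 is at most (Im s)^{log(K+1)/log 2}; the term 4N comes from |s +
  -- 4| ≤ (Im s)⁴.
  set A : ℝ := Real.log (K + 1) / Real.log 2 + 4 * N + Real.log (C₀ + 1) / Real.log 2 with hA
  have hA1 : 0 < Real.log (K + 1) := Real.log_pos (by linarith)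
  have hA2 : 0 < Real.log (C₀ + 1) := Real.log_pos (by linarith)
  refine ⟨A, by positivity, fun s hs3 hs2 => ?_⟩
  have hlog : Real.log 2 ≤ Real.log s.im := Real.log_le_log two_pos hs2
  have hlogp : 0 < Real.log s.im := hlog2.trans_le hlog
  rcases le_or_gt s.re 2 with hs | hs
  · have h := hstrip s hs3 hs
    have h4 := hs4 s hs3
    have hs1 : s ≠ 1 := fun h => by rw [h] at hs2; norm_num at hs2
    rw [norm_div, norm_pow, div_le_iff₀ (by positivity), hFL s hs1, norm_mul, norm_pow] at h
    have h5 : 1 ≤ ‖s - 1‖ ^ m := by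
      refine one_le_pow₀ (le_trans ?_ ((le_abs_self _).trans (Complex.abs_im_le_norm (s - 1))))
      simp
      linarith
    have h6 : ‖s + 4‖ ≤ s.im ^ 4 := by
      refine (Complex.norm_le_abs_re_add_abs_im _).trans ?_
      simp only [Complex.add_re, Complex.add_im, Complex.re_ofNat, Complex.im_ofNat, add_zero]
      rw [abs_of_nonneg (by linarith), abs_of_nonneg (by linarith)]
      have : 2 ^ 3 ≤ s.im ^ 3 := by gcongr
      nlinarith
    have h7 : ‖L s‖ ≤ K * (s.im ^ 4) ^ N := by
      calc ‖L s‖ ≤ ‖s - 1‖ ^ m * ‖L s‖ := le_mul_of_one_le_left (norm_nonneg _) h5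
        _ ≤ K * ‖s + 4‖ ^ N := h
        _ ≤ _ := by gcongr
    refine h7.trans ?_
    have h8 : (s.im ^ 4) ^ N = Real.exp (4 * N * Real.log s.im) := by
      rw [← pow_mul, ← Real.exp_log (show 0 < s.im by linarith), ← Real.exp_nat_mul, Real.log_exp]
      push_cast
      rfl
    have h9 : K ≤ Real.exp (Real.log (K + 1) / Real.log 2 * Real.log s.im) := by
      have : Real.log (K + 1) ≤ Real.log (K + 1) / Real.log 2 * Real.log s.im := by
        rw [div_mul_eq_mul_div, le_div_iff₀ hlog2]
        gcongr
      refine le_trans ?_ (Real.exp_le_exp.2 this)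
      rw [Real.exp_log (by linarith)]
      linarith
    calc K * (s.im ^ 4) ^ N ≤ Real.exp (Real.log (K + 1) / Real.log 2 * Real.log s.im) *
          Real.exp (4 * N * Real.log s.im) := by rw [h8]; gcongr
      _ = Real.exp ((Real.log (K + 1) / Real.log 2 + 4 * N) * Real.log s.im) := by
          rw [← Real.exp_add]; ring_nf
      _ ≤ _ := by
          gcongr
          rw [hA]
          have : 0 < Real.log (C₀ + 1) / Real.log 2 := by positivity
          linarith
  · have h := hL2 s hs.le
    have h1 : Real.log (C₀ + 1) ≤ A * Real.log s.im := by
      have : Real.log (C₀ + 1) ≤ Real.log (C₀ + 1) / Real.log 2 * Real.log s.im := by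
        rw [div_mul_eq_mul_div, le_div_iff₀ hlog2]
        gcongr
      refine this.trans ?_
      gcongr
      rw [hA]
      have : 0 ≤ Real.log (K + 1) / Real.log 2 + 4 * N := by positivity
      linarith
    refine le_trans ?_ (Real.exp_le_exp.2 h1)
    rw [Real.exp_log (by linarith)]
    linarith

/-! ### The Dirichlet coefficients of log L -/

/-- The function supported on prime powers which agrees there with `b`. -/
noncomputable def primePowCoeff (b : ℕ → ℂ) (n : ℕ) : ℂ :=
  open scoped Classical in if IsPrimePow n then b n else 0

theorem primePowCoeff_of_isPrimePow {b : ℕ → ℂ} {n : ℕ} (h : IsPrimePow n) :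
    primePowCoeff b n = b n := if_pos h

theorem primePowCoeff_of_not_isPrimePow {b : ℕ → ℂ} {n : ℕ} (h : ¬ IsPrimePow n) :
    primePowCoeff b n = 0 := if_neg h

theorem primePowCoeff_one (b : ℕ → ℂ) : primePowCoeff b 1 = 0 :=
  primePowCoeff_of_not_isPrimePow not_isPrimePow_one

theorem exists_norm_primePowCoeff_le {b : ℕ → ℂ}
    (hb : ∃ δ C : ℝ, δ < 1 / 2 ∧ ∀ p j : ℕ, p.Prime → 1 ≤ j →
      ‖b (p ^ j)‖ ≤ C * (p : ℝ) ^ ((j : ℝ) * δ)) :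
    ∃ δ C : ℝ, 0 ≤ δ ∧ δ < 1 / 2 ∧ 0 < C ∧ ∀ n : ℕ, ‖primePowCoeff b n‖ ≤ C * (n : ℝ) ^ δ := by
  obtain ⟨δ, C, hδ, h⟩ := hb
  -- A nonnegative exponent makes n^δ monotone, so that it can be bounded by N^δ in later sums.
  refine ⟨max δ 0, |C| + 1, le_max_right _ _, max_lt hδ (by norm_num), by positivity, fun n => ?_⟩
  by_cases hn : IsPrimePow n
  · rw [primePowCoeff_of_isPrimePow hn]
    obtain ⟨p, k, hp, hk, rfl⟩ := (isPrimePow_nat_iff n).1 hn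
    have hp1 : (1 : ℝ) ≤ p := by exact_mod_cast hp.one_lt.le
    calc ‖b (p ^ k)‖ ≤ C * (p : ℝ) ^ ((k : ℝ) * δ) := h p k hp hk
      _ ≤ (|C| + 1) * (p : ℝ) ^ ((k : ℝ) * max δ 0) := by
        gcongr
        · linarith [le_abs_self C]
        · exact le_max_left _ _
      _ = _ := by
        rw [Nat.cast_pow, ← Real.rpow_natCast, ← Real.rpow_mul (by linarith)]
  · rw [primePowCoeff_of_not_isPrimePow hn, norm_zero]
    positivity

theorem abscissaOfAbsConv_primePowCoeff_le {b : ℕ → ℂ}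
    (hb : ∃ δ C : ℝ, δ < 1 / 2 ∧ ∀ p j : ℕ, p.Prime → 1 ≤ j →
      ‖b (p ^ j)‖ ≤ C * (p : ℝ) ^ ((j : ℝ) * δ)) :
    LSeries.abscissaOfAbsConv (primePowCoeff b) ≤ ((3 / 2 : ℝ) : EReal) := by
  obtain ⟨δ, C, _, hδ, _, h⟩ := exists_norm_primePowCoeff_le hb
  refine (LSeries.abscissaOfAbsConv_le_of_le_const_mul_rpow ⟨C, fun n _ => h n⟩).trans ?_
  rw [show (1 : EReal) = ((1 : ℝ) : EReal) from rfl, ← EReal.coe_add, EReal.coe_le_coe_iff]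
  linarith

theorem lt_re_of_abscissaOfAbsConv_le {β : ℕ → ℂ}
    (h : LSeries.abscissaOfAbsConv β ≤ ((3 / 2 : ℝ) : EReal)) {s : ℂ} (hs : 3 / 2 < s.re) :
    LSeries.abscissaOfAbsConv β < s.re :=
  h.trans_lt (EReal.coe_lt_coe_iff.2 hs)

/-- Absolute convergence allows the series over prime powers to be regrouped by primes, and the
exponential turns the resulting sum into the Euler product. -/
theorem eq_exp_LSeries_of_hasProd {b : ℕ → ℂ} {s L : ℂ}
    (hsum : LSeriesSummable (primePowCoeff b) s)
    (h : HasProd (fun p : Nat.Primes => localFactor b p s) L) :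
    L = Complex.exp (LSeries (primePowCoeff b) s) := by
  have hterm : ∀ x : Nat.Primes × ℕ, LSeries.term (primePowCoeff b) s
      (Nat.Primes.prodNatEquiv x : ℕ) =
      b ((x.1 : ℕ) ^ (x.2 + 1)) / ((x.1 : ℕ) : ℂ) ^ (((x.2 + 1 : ℕ) : ℂ) * s) := by
    rintro ⟨p, k⟩
    have hp := p.2
    rw [Nat.Primes.coe_prodNatEquiv_apply, LSeries.term_of_ne_zero (pow_ne_zero _ hp.ne_zero),
      primePowCoeff_of_isPrimePow (hp.isPrimePow.pow (Nat.succ_ne_zero k)),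
      Complex.natCast_cpow_natCast_mul, Nat.cast_pow]
  have h1 : HasSum (LSeries.term (primePowCoeff b) s) (LSeries (primePowCoeff b) s) :=
    hsum.LSeriesHasSum
  have h2 : HasSum (fun n : {n : ℕ // IsPrimePow n} => LSeries.term (primePowCoeff b) s n)
      (LSeries (primePowCoeff b) s) := by
    refine (hasSum_subtype_iff_of_support_subset (s := {n : ℕ | IsPrimePow n}) ?_).2 h1
    intro n hn
    by_contra hne
    refine hn ?_
    rw [LSeries.term_def]
    split_ifs
    · rfl
    · rw [primePowCoeff_of_not_isPrimePow hne, zero_div]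
  rw [← Nat.Primes.prodNatEquiv.hasSum_iff] at h2
  have h3 : HasSum (fun x : Nat.Primes × ℕ =>
      b ((x.1 : ℕ) ^ (x.2 + 1)) / ((x.1 : ℕ) : ℂ) ^ (((x.2 + 1 : ℕ) : ℂ) * s))
      (LSeries (primePowCoeff b) s) := by
    convert h2 using 1
    ext x
    exact (hterm x).symm
  have h4 := (h3.prod_fiberwise fun p => (h3.summable.prod_factor p).hasSum).cexp
  exact h.unique h4

/-- Differentiating L = exp(log L) gives L' = L · (log L)'. Comparing coefficients at p yields a(p)
log p = a(1) b(p) log p, and a(1) = 1 follows by letting s tend to +∞. -/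
theorem apply_prime_eq_of_LSeries_eq_exp {a b : ℕ → ℂ} {L : ℂ → ℂ}
    (ha : ∀ s : ℂ, 1 < s.re → LSeriesHasSum a s (L s))
    (hβ : LSeries.abscissaOfAbsConv (primePowCoeff b) ≤ ((3 / 2 : ℝ) : EReal))
    (h : ∀ s : ℂ, 3 / 2 < s.re → L s = Complex.exp (LSeries (primePowCoeff b) s))
    {p : ℕ} (hp : p.Prime) : b p = a p := by
  set β := primePowCoeff b with hβdef
  have hβtop : LSeries.abscissaOfAbsConv β < ⊤ := hβ.trans_lt (EReal.coe_lt_top _)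
  have ha1 : LSeries.abscissaOfAbsConv a ≤ ((1 : ℝ) : EReal) :=
    LSeries.abscissaOfAbsConv_le_of_forall_lt_LSeriesSummable fun y hy =>
      (ha y (by simpa using hy)).LSeriesSummable
  have hatop : LSeries.abscissaOfAbsConv a < ⊤ := ha1.trans_lt (EReal.coe_lt_top _)
  have hlt : ∀ s : ℂ, 3 / 2 < s.re → LSeries.abscissaOfAbsConv a < s.re := fun s hs =>
    ha1.trans_lt (EReal.coe_lt_coe_iff.2 (by linarith))
  have heq : ∀ s : ℂ, 3 / 2 < s.re → LSeries a s = Complex.exp (LSeries β s) := fun s hs => by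
    rw [← h s hs, (ha s (by linarith)).LSeries_eq]
  have hone : a 1 = 1 := by
    have h1 := LSeries.tendsto_atTop hatop
    have h2 := (Complex.continuous_exp.tendsto _).comp (LSeries.tendsto_atTop hβtop)
    rw [hβdef, primePowCoeff_one, Complex.exp_zero] at h2
    refine tendsto_nhds_unique h1 (h2.congr' ?_)
    filter_upwards [eventually_gt_atTop (3 / 2 : ℝ)] with x hx
    exact (heq x (by simpa using hx)).symm
  have hder : ∀ s : ℂ, 3 / 2 < s.re → LSeries (LSeries.logMul a) s =
      LSeries (LSeries.convolution a (LSeries.logMul β)) s := by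
    intro s hs
    have hsβ := lt_re_of_abscissaOfAbsConv_le hβ hs
    have h1 := LSeries_hasDerivAt (hlt s hs)
    have h2 := (LSeries_hasDerivAt hsβ).cexp
    have hev : LSeries a =ᶠ[𝓝 s] fun s => Complex.exp (LSeries β s) := by
      filter_upwards [(isOpen_lt continuous_const Complex.continuous_re).mem_nhds hs] with z hz
      exact heq z hz
    have h3 := h1.unique (h2.congr_of_eventuallyEq hev)
    rw [← heq s hs, mul_neg, neg_inj] at h3
    rw [h3, LSeries_convolution (hlt s hs) (by rw [LSeries.abscissaOfAbsConv_logMul]; exact hsβ)]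
  have hcoef := LSeries.eq_of_LSeries_eventually_eq (f := LSeries.logMul a)
    (g := LSeries.convolution a (LSeries.logMul β))
    (by rw [LSeries.abscissaOfAbsConv_logMul]; exact hatop)
    (by
      refine (LSeries.abscissaOfAbsConv_convolution_le _ _).trans_lt ?_
      rw [LSeries.abscissaOfAbsConv_logMul]
      exact max_lt hatop hβtop)
    (by
      filter_upwards [eventually_gt_atTop (3 / 2 : ℝ)] with x hx
      exact hder x (by simpa using hx)) hp.ne_zero
  rw [LSeries.convolution_def] at hcoef
  simp only [LSeries.logMul] at hcoef
  rw [Nat.sum_divisorsAntidiagonal (f := fun i j => a i * (Complex.log j * β j)),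
    hp.sum_divisors, Nat.div_self hp.pos, Nat.div_one] at hcoef
  have hlogp : Complex.log p ≠ 0 := by
    rw [← Complex.natCast_log, Complex.ofReal_ne_zero]
    exact (Real.log_pos (by exact_mod_cast hp.one_lt)).ne'
  simp only [hone, Nat.cast_one, Complex.log_one, zero_mul, mul_zero, zero_add, one_mul] at hcoef
  rw [hβdef, primePowCoeff_of_isPrimePow hp.isPrimePow] at hcoef
  exact (mul_left_cancel₀ hlogp hcoef).symm

open ArithmeticFunction in
-- On prime powers Λ ≥ log 2, so the coefficients are O(N^δ Λ(n)); the non-prime part of ∑ Λ is ψ -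
-- θ = O(√N). The exponent δ + 1/2 is below 1 because δ < 1/2.
theorem exists_sum_norm_primePowCoeff_not_prime_le {b : ℕ → ℂ}
    (hb : ∃ δ C : ℝ, δ < 1 / 2 ∧ ∀ p j : ℕ, p.Prime → 1 ≤ j →
      ‖b (p ^ j)‖ ≤ C * (p : ℝ) ^ ((j : ℝ) * δ)) :
    ∃ r C : ℝ, 0 ≤ r ∧ r < 1 ∧ 0 < C ∧
      ∀ N : ℕ, ∑ n ∈ Finset.Icc 1 N with ¬ n.Prime, ‖primePowCoeff b n‖ ≤ C * (N : ℝ) ^ r := by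
  obtain ⟨δ, C, hδ0, hδ, hC, h⟩ := exists_norm_primePowCoeff_le hb
  obtain ⟨K, hK⟩ := Chebyshev.psi_sub_theta_le_mul_sqrt
  have hlog2 : 0 < Real.log 2 := Real.log_pos one_lt_two
  refine ⟨δ + 1 / 2, C / Real.log 2 * (|K| + 1), by linarith, by linarith, by positivity,
    fun N => ?_⟩
  have hterm : ∀ n ∈ Finset.Icc 1 N, ‖primePowCoeff b n‖ ≤
      C * (N : ℝ) ^ δ / Real.log 2 * vonMangoldt n := by
    intro n hn
    rw [Finset.mem_Icc] at hn
    by_cases hpp : IsPrimePow n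
    · have h1 : Real.log 2 ≤ vonMangoldt n := by
        rw [vonMangoldt_apply, if_pos hpp]
        have : 2 ≤ n.minFac := (Nat.minFac_prime hpp.ne_one).two_le
        exact Real.log_le_log two_pos (by exact_mod_cast this)
      calc ‖primePowCoeff b n‖ ≤ C * (n : ℝ) ^ δ := h n
        _ ≤ C * (N : ℝ) ^ δ := by
          gcongr
          exact hn.2
        _ = C * (N : ℝ) ^ δ / Real.log 2 * Real.log 2 := by field_simp
        _ ≤ _ := by gcongr
    · rw [primePowCoeff_of_not_isPrimePow hpp, norm_zero]
      have : 0 ≤ vonMangoldt n := vonMangoldt_nonneg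
      positivity
  have hψ : ∑ n ∈ Finset.Icc 1 N with ¬ n.Prime, vonMangoldt n ≤ (|K| + 1) * Real.sqrt N := by
    have h1 := hK N
    have h2 : Chebyshev.psi N = ∑ n ∈ Finset.Icc 1 N, vonMangoldt n := by
      rw [Chebyshev.psi, Nat.floor_natCast]; rfl
    have h3 : Chebyshev.theta N = ∑ n ∈ Finset.Icc 1 N with n.Prime, vonMangoldt n := by
      rw [Chebyshev.theta, Nat.floor_natCast]
      refine Finset.sum_congr rfl fun p hp => ?_
      rw [vonMangoldt_apply_prime (Finset.mem_filter.1 hp).2]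
    rw [h2, h3, ← Finset.sum_filter_add_sum_filter_not (Finset.Icc 1 N) Nat.Prime,
      add_sub_cancel_left] at h1
    refine h1.trans ?_
    gcongr
    linarith [le_abs_self K]
  calc ∑ n ∈ Finset.Icc 1 N with ¬ n.Prime, ‖primePowCoeff b n‖
      ≤ ∑ n ∈ Finset.Icc 1 N with ¬ n.Prime, C * (N : ℝ) ^ δ / Real.log 2 * vonMangoldt n :=
        Finset.sum_le_sum fun n hn => hterm n (Finset.mem_filter.1 hn).1
    _ = C * (N : ℝ) ^ δ / Real.log 2 * ∑ n ∈ Finset.Icc 1 N with ¬ n.Prime, vonMangoldt n := by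
        rw [Finset.mul_sum]
    _ ≤ C * (N : ℝ) ^ δ / Real.log 2 * ((|K| + 1) * Real.sqrt N) := by gcongr
    _ = C / Real.log 2 * (|K| + 1) * (N : ℝ) ^ (δ + 1 / 2) := by
        rw [Real.sqrt_eq_rpow, Real.rpow_add' (Nat.cast_nonneg _) (by linarith)]
        ring

theorem primeSum_natCast (a : ℕ → ℂ) (N : ℕ) :
    primeSum a N = ∑ p ∈ Finset.Icc 1 N with p.Prime, ‖a p‖ := by
  rw [primeSum, Nat.floor_natCast]
  refine Finset.sum_congr ?_ fun _ _ => rfl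
  ext n
  simp only [Finset.mem_filter, Finset.mem_Iic, Finset.mem_Icc]
  exact ⟨fun h => ⟨⟨h.2.one_lt.le, h.1⟩, h.2⟩, fun h => ⟨h.1.2, h.2⟩⟩

theorem PrimeAsymptotic.isBigO {a : ℕ → ℂ} {κ : ℝ} (h : PrimeAsymptotic a κ) :
    primeSum a =O[atTop] fun x : ℝ => x / Real.log x := by
  have h1 := (IsLittleO.isBigO h).add
    ((isBigO_refl (fun x : ℝ => x / Real.log x) atTop).const_mul_left κ)
  exact h1.congr_left fun x => by ring

theorem exists_sum_prime_log_le {a : ℕ → ℂ}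
    (h : primeSum a =O[atTop] fun x : ℝ => x / Real.log x) :
    ∃ C : ℝ, 0 < C ∧ ∀ N : ℕ, ∑ p ∈ Finset.Icc 1 N with p.Prime, ‖a p‖ * Real.log p ≤ C * N := by
  obtain ⟨C, hC⟩ := (h.comp_tendsto tendsto_natCast_atTop_atTop).bound
  obtain ⟨N₀, hN₀⟩ := eventually_atTop.1 hC
  set S : ℕ → ℝ := fun N => ∑ p ∈ Finset.Icc 1 N with p.Prime, ‖a p‖ * Real.log p with hS
  have hS0 : ∀ N, 0 ≤ S N := fun N => Finset.sum_nonneg fun p _ => by positivity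
  refine ⟨|C| + S (max N₀ 2) + 1, by linarith [abs_nonneg C, hS0 (max N₀ 2)], fun N => ?_⟩
  rcases le_or_gt (max N₀ 2) N with hN | hN
  · have hN2 : (1 : ℝ) < N := by exact_mod_cast (le_max_right N₀ 2).trans hN
    have hlog : 0 < Real.log N := Real.log_pos hN2
    have h1 := hN₀ N ((le_max_left _ _).trans hN)
    simp only [Function.comp_apply] at h1
    rw [Real.norm_of_nonneg (by positivity : (0 : ℝ) ≤ N / Real.log N)] at h1
    have h2 := (le_abs_self _).trans (h1.trans (mul_le_mul_of_nonneg_right (le_abs_self C)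
      (by positivity)))
    calc S N ≤ ∑ p ∈ Finset.Icc 1 N with p.Prime, ‖a p‖ * Real.log N := by
          refine Finset.sum_le_sum fun p hp => ?_
          have hp1 := Finset.mem_Icc.1 (Finset.mem_filter.1 hp).1
          have hp0 : (0 : ℝ) < p := by exact_mod_cast hp1.1
          gcongr
          exact hp1.2
      _ = primeSum a N * Real.log N := by rw [primeSum_natCast, Finset.sum_mul]
      _ ≤ |C| * (N / Real.log N) * Real.log N := by gcongr
      _ = |C| * N := by field_simp
      _ ≤ _ := by
          gcongr
          linarith [hS0 (max N₀ 2)]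
  · rcases Nat.eq_zero_or_pos N with rfl | hN0
    · simp
    have hN1 : (1 : ℝ) ≤ N := by exact_mod_cast hN0
    calc S N ≤ S (max N₀ 2) := by
          refine Finset.sum_le_sum_of_subset_of_nonneg ?_ fun p _ _ => by positivity
          exact Finset.filter_subset_filter _ (Finset.Icc_subset_Icc_right hN.le)
      _ ≤ (|C| + S (max N₀ 2) + 1) * 1 := by linarith [abs_nonneg C]
      _ ≤ _ := by
          have := hS0 (max N₀ 2)
          gcongr

/-- The Chebyshev bound for the coefficients of L'/L. The primes give O(N) by hypothesis, and the
other prime powers give O(N^r log N) with r < 1. -/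
theorem exists_sum_norm_primePowCoeff_mul_log_le {a b : ℕ → ℂ}
    (h : primeSum a =O[atTop] fun x : ℝ => x / Real.log x)
    (hb : ∃ δ C : ℝ, δ < 1 / 2 ∧ ∀ p j : ℕ, p.Prime → 1 ≤ j →
      ‖b (p ^ j)‖ ≤ C * (p : ℝ) ^ ((j : ℝ) * δ))
    (hab : ∀ p : ℕ, p.Prime → b p = a p) :
    ∃ C : ℝ, 0 < C ∧
      ∀ N : ℕ, ∑ n ∈ Finset.Icc 1 N, ‖primePowCoeff b n‖ * Real.log n ≤ C * N := by
  obtain ⟨C₁, hC₁, h₁⟩ := exists_sum_prime_log_le h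
  obtain ⟨r, C₂, hr0, hr, hC₂, h₂⟩ := exists_sum_norm_primePowCoeff_not_prime_le hb
  have hr' : 0 < 1 - r := by linarith
  refine ⟨C₁ + C₂ / (1 - r), by positivity, fun N => ?_⟩
  rcases Nat.eq_zero_or_pos N with rfl | hN0
  · simp
  have hN1 : (0 : ℝ) < N := by exact_mod_cast hN0
  rw [← Finset.sum_filter_add_sum_filter_not (Finset.Icc 1 N) Nat.Prime, add_mul]
  refine add_le_add ?_ ?_
  · refine le_of_eq_of_le (Finset.sum_congr rfl fun p hp => ?_) (h₁ N)
    have hp := (Finset.mem_filter.1 hp).2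
    rw [primePowCoeff_of_isPrimePow hp.isPrimePow, hab p hp]
  · calc ∑ n ∈ Finset.Icc 1 N with ¬ n.Prime, ‖primePowCoeff b n‖ * Real.log n
        ≤ ∑ n ∈ Finset.Icc 1 N with ¬ n.Prime, ‖primePowCoeff b n‖ * Real.log N := by
          refine Finset.sum_le_sum fun p hp => ?_
          have hp1 := Finset.mem_Icc.1 (Finset.mem_filter.1 hp).1
          have hp0 : (0 : ℝ) < p := by exact_mod_cast hp1.1
          gcongr
          exact hp1.2
      _ ≤ C₂ * (N : ℝ) ^ r * ((N : ℝ) ^ (1 - r) / (1 - r)) := by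
          rw [← Finset.sum_mul]
          have hlog := Real.log_le_rpow_div hN1.le hr'
          have hlog0 : 0 ≤ Real.log N := Real.log_natCast_nonneg N
          exact mul_le_mul (h₂ N) hlog hlog0 (by positivity)
      _ = C₂ / (1 - r) * ((N : ℝ) ^ r * (N : ℝ) ^ (1 - r)) := by ring
      _ = _ := by rw [← Real.rpow_add hN1]; simp

/-! ### Partial summation against a Chebyshev bound -/

theorem sum_mul_antitone_le {w φ : ℕ → ℝ} {C : ℝ} (hw : ∀ N : ℕ, ∑ n ∈ Finset.Icc 1 N, w n ≤ C * N)
    (hφ : ∀ n, 1 ≤ n → φ (n + 1) ≤ φ n) (hφ0 : ∀ n, 0 ≤ φ n) (N : ℕ) :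
    ∑ n ∈ Finset.Icc 1 N, w n * φ n ≤ C * ∑ n ∈ Finset.Icc 1 N, φ n := by
  -- Abel summation as an induction: the claim is strengthened by the nonnegative boundary term.
  suffices h : ∑ n ∈ Finset.Icc 1 N, w n * φ n + (C * N - ∑ n ∈ Finset.Icc 1 N, w n) * φ N ≤
      C * ∑ n ∈ Finset.Icc 1 N, φ n by
    have := mul_nonneg (sub_nonneg.2 (hw N)) (hφ0 N)
    linarith
  induction N with
  | zero => simp
  | succ N ih =>
    rw [Finset.sum_Icc_succ_top (by omega), Finset.sum_Icc_succ_top (by omega),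
      Finset.sum_Icc_succ_top (by omega)]
    rcases Nat.eq_zero_or_pos N with rfl | hN
    · simp
      linarith
    have := mul_le_mul_of_nonneg_left (hφ N hN) (sub_nonneg.2 (hw N))
    push_cast
    linarith

/-- The integral comparison in discrete form: Bernoulli's inequality for (1 - 1/y)^{1-α} bounds each
term by the increment of y^{1-α}/(1 - α). -/
theorem sum_rpow_neg_le {α : ℝ} (h0 : 0 ≤ α) (h1 : α < 1) (N : ℕ) :
    ∑ n ∈ Finset.Icc 1 N, (n : ℝ) ^ (-α) ≤ (N : ℝ) ^ (1 - α) / (1 - α) := by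
  have hα : 0 < 1 - α := by linarith
  induction N with
  | zero => simp [hα.ne']
  | succ N ih =>
    rw [Finset.sum_Icc_succ_top (by omega)]
    set y : ℝ := ((N + 1 : ℕ) : ℝ) with hy
    have hy1 : 1 ≤ y := by rw [hy]; exact_mod_cast Nat.succ_pos N
    have hy0 : 0 < y := by linarith
    have hN : (N : ℝ) = y * (1 + -(1 / y)) := by
      rw [hy]; push_cast; field_simp; ring
    have hb := rpow_one_add_le_one_add_mul_self (s := -(1 / y))
      (by rw [neg_le_neg_iff, div_le_one hy0]; exact hy1) hα.le (by linarith)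
    have hb0 : 0 ≤ 1 + -(1 / y) := by
      have : 1 / y ≤ 1 := by rw [div_le_one hy0]; exact hy1
      linarith
    have h2 : (N : ℝ) ^ (1 - α) ≤ y ^ (1 - α) - (1 - α) * y ^ (-α) := by
      rw [hN, Real.mul_rpow hy0.le hb0]
      calc y ^ (1 - α) * (1 + -(1 / y)) ^ (1 - α) ≤ y ^ (1 - α) * (1 + (1 - α) * -(1 / y)) := by
            gcongr
        _ = y ^ (1 - α) - (1 - α) * (y ^ (1 - α) / y) := by ring
        _ = _ := by
            rw [← Real.rpow_sub_one hy0.ne']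
            congr 3
            ring
    calc _ ≤ (N : ℝ) ^ (1 - α) / (1 - α) + y ^ (-α) := by gcongr
      _ ≤ (y ^ (1 - α) - (1 - α) * y ^ (-α)) / (1 - α) + y ^ (-α) := by gcongr
      _ = _ := by field_simp; ring

theorem sum_mul_rpow_neg_le {w : ℕ → ℝ} {C α : ℝ} (hC : 0 ≤ C)
    (hw : ∀ N : ℕ, ∑ n ∈ Finset.Icc 1 N, w n ≤ C * N)
    (h0 : 0 ≤ α) (h1 : α < 1) (N : ℕ) :
    ∑ n ∈ Finset.Icc 1 N, w n * (n : ℝ) ^ (-α) ≤ C / (1 - α) * (N : ℝ) ^ (1 - α) := by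
  have h := sum_mul_antitone_le (φ := fun n : ℕ => (n : ℝ) ^ (-α)) hw (fun n hn => by
    have : (0 : ℝ) < n := by exact_mod_cast hn
    refine Real.rpow_le_rpow_of_nonpos this ?_ (by linarith)
    push_cast; linarith) (fun n => by positivity) N
  refine h.trans ?_
  calc _ ≤ C * ((N : ℝ) ^ (1 - α) / (1 - α)) := by
        gcongr
        exact sum_rpow_neg_le h0 h1 N
    _ = _ := by ring

theorem sum_Ioc_mul_inv_sq_le {w : ℕ → ℝ} {C : ℝ} (hC : 0 ≤ C)
    (hw0 : ∀ n, 0 ≤ w n) (hw : ∀ N : ℕ, ∑ n ∈ Finset.Icc 1 N, w n ≤ C * N) {N : ℕ} (hN : 1 ≤ N)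
    (M : ℕ) : ∑ n ∈ Finset.Ioc N M, w n * ((n : ℝ) ^ 2)⁻¹ ≤ 2 * C / N := by
  have hN0 : (0 : ℝ) < N := by exact_mod_cast hN
  rcases le_or_gt M N with hMN | hMN
  · rw [Finset.Ioc_eq_empty (by omega), Finset.sum_empty]
    positivity
  -- Freezing the weight at N^{-2} for n ≤ N makes it antitone from the start. That initial block
  -- and the tail each contribute at most C/N.
  set φ : ℕ → ℝ := fun n => ((max n N : ℕ) : ℝ)⁻¹ ^ 2 with hφ
  have h := sum_mul_antitone_le (φ := φ) hw (fun n hn => by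
    have h1 : (0 : ℝ) < (max n N : ℕ) := by
      exact_mod_cast lt_max_of_lt_left (show 0 < n from hn)
    have h2 : ((max n N : ℕ) : ℝ) ≤ (max (n + 1) N : ℕ) := by
      exact_mod_cast max_le_max (Nat.le_succ n) le_rfl
    simp only [hφ]
    gcongr) (fun n => by positivity) M
  have hsplit : Finset.Icc 1 M = Finset.Icc 1 N ∪ Finset.Ioc N M := by
    ext n; simp only [Finset.mem_union, Finset.mem_Icc, Finset.mem_Ioc]; omega
  have hdisj : Disjoint (Finset.Icc 1 N) (Finset.Ioc N M) := by
    rw [Finset.disjoint_left]; intro n; simp only [Finset.mem_Icc, Finset.mem_Ioc]; omega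
  rw [hsplit, Finset.sum_union hdisj, Finset.sum_union hdisj] at h
  have h3 : ∀ n ∈ Finset.Ioc N M, φ n = ((n : ℝ) ^ 2)⁻¹ := by
    intro n hn
    rw [Finset.mem_Ioc] at hn
    simp only [hφ, max_eq_left hn.1.le, inv_pow]
  have h4 : ∀ n ∈ Finset.Icc 1 N, φ n = (N : ℝ)⁻¹ ^ 2 := by
    intro n hn
    rw [Finset.mem_Icc] at hn
    simp only [hφ, max_eq_right hn.2]
  have h5 : ∑ n ∈ Finset.Ioc N M, w n * φ n = ∑ n ∈ Finset.Ioc N M, w n * ((n : ℝ) ^ 2)⁻¹ :=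
    Finset.sum_congr rfl fun n hn => by rw [h3 n hn]
  have h6 : ∑ n ∈ Finset.Icc 1 N, φ n = (N : ℝ)⁻¹ := by
    rw [Finset.sum_congr rfl h4, Finset.sum_const, Nat.card_Icc, nsmul_eq_mul, Nat.add_sub_cancel]
    field_simp
  have h7 : ∑ n ∈ Finset.Ioc N M, φ n ≤ (N : ℝ)⁻¹ := by
    rw [Finset.sum_congr rfl h3]
    refine (sum_Ioc_inv_sq_le_sub (by omega) hMN.le).trans ?_
    have : (0 : ℝ) ≤ (M : ℝ)⁻¹ := by positivity
    linarith
  have h8 : 0 ≤ ∑ n ∈ Finset.Icc 1 N, w n * φ n :=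
    Finset.sum_nonneg fun n _ => mul_nonneg (hw0 n) (by positivity)
  rw [h5, h6] at h
  have h9 := mul_le_mul_of_nonneg_left h7 hC
  rw [div_eq_mul_inv]
  linarith

/-- To gain the factor 1/log x, use log x ≤ K₁ log n (x/n)^ε for 2 ≤ n ≤ x. The loss (x/n)^ε is
harmless because σ + ε < 1. The term n = 1 has no logarithm, but β(1) = 0. -/
theorem exists_sum_norm_mul_rpow_neg_le {β : ℕ → ℂ} {C σ : ℝ} (hC : 0 < C) (hβ1 : β 1 = 0)
    (hβ : ∀ N : ℕ, ∑ n ∈ Finset.Icc 1 N, ‖β n‖ * Real.log n ≤ C * N) (h0 : 0 ≤ σ) (h1 : σ < 1) :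
    ∃ K : ℝ, 0 < K ∧ ∀ x : ℝ, 2 ≤ x →
      ∑ n ∈ Finset.Icc 1 ⌊x⌋₊, ‖β n‖ * (n : ℝ) ^ (-σ) ≤ K * (x ^ (1 - σ) / Real.log x) := by
  set ε : ℝ := (1 - σ) / 2 with hε
  have hε0 : 0 < ε := by rw [hε]; linarith
  have hlog2 : 0 < Real.log 2 := Real.log_pos one_lt_two
  have h1' : 0 < 1 - (σ + ε) := by rw [hε]; linarith
  set K₁ : ℝ := 1 + 1 / (ε * Real.log 2) with hK₁
  refine ⟨K₁ * (C / (1 - (σ + ε))), by positivity, fun x hx => ?_⟩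
  have hx0 : 0 < x := by linarith
  have hlogx : 0 < Real.log x := Real.log_pos (by linarith)
  have hterm : ∀ n ∈ Finset.Icc 1 ⌊x⌋₊, ‖β n‖ * (n : ℝ) ^ (-σ) ≤
      K₁ / Real.log x * x ^ ε * (‖β n‖ * Real.log n * (n : ℝ) ^ (-(σ + ε))) := by
    intro n hn
    rw [Finset.mem_Icc] at hn
    rcases eq_or_lt_of_le hn.1 with h | h
    · rw [← h, hβ1]; simp
    have hn2 : (2 : ℝ) ≤ n := by exact_mod_cast h
    have hn0 : (0 : ℝ) < n := by linarith
    have hnx : (n : ℝ) ≤ x := (Nat.le_floor_iff hx0.le).1 hn.2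
    have hlogn : Real.log 2 ≤ Real.log n := Real.log_le_log two_pos hn2
    have hr : 1 ≤ (x / n) ^ ε := Real.one_le_rpow (by rwa [one_le_div hn0]) hε0.le
    have hlog : Real.log x ≤ K₁ * (Real.log n * (x / n) ^ ε) := by
      have h3 := Real.log_le_rpow_div (div_pos hx0 hn0).le hε0
      rw [Real.log_div hx0.ne' hn0.ne'] at h3
      have h4 : (x / n) ^ ε / ε ≤ 1 / (ε * Real.log 2) * (Real.log n * (x / n) ^ ε) := by
        rw [show 1 / (ε * Real.log 2) * (Real.log n * (x / n) ^ ε) =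
          (x / n) ^ ε / ε * (Real.log n / Real.log 2) by ring_nf]
        refine le_mul_of_one_le_right (by positivity) ?_
        rwa [one_le_div hlog2]
      have h5 : Real.log n ≤ Real.log n * (x / n) ^ ε :=
        le_mul_of_one_le_right (by linarith) hr
      rw [hK₁]
      linarith
    have h6 : (x / n) ^ ε = x ^ ε * (n : ℝ) ^ (-ε) := by
      rw [Real.div_rpow hx0.le hn0.le, Real.rpow_neg hn0.le, div_eq_mul_inv]
    have h7 : (n : ℝ) ^ (-(σ + ε)) = (n : ℝ) ^ (-σ) * (n : ℝ) ^ (-ε) := by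
      rw [← Real.rpow_add hn0, neg_add]
    calc ‖β n‖ * (n : ℝ) ^ (-σ) = ‖β n‖ * (n : ℝ) ^ (-σ) / Real.log x * Real.log x := by
          field_simp
      _ ≤ ‖β n‖ * (n : ℝ) ^ (-σ) / Real.log x * (K₁ * (Real.log n * (x / n) ^ ε)) := by gcongr
      _ = _ := by rw [h6, h7]; ring
  have hfl : ((⌊x⌋₊ : ℕ) : ℝ) ≤ x := Nat.floor_le hx0.le
  calc _ ≤ ∑ n ∈ Finset.Icc 1 ⌊x⌋₊,
        K₁ / Real.log x * x ^ ε * (‖β n‖ * Real.log n * (n : ℝ) ^ (-(σ + ε))) :=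
        Finset.sum_le_sum hterm
    _ = K₁ / Real.log x * x ^ ε *
        ∑ n ∈ Finset.Icc 1 ⌊x⌋₊, ‖β n‖ * Real.log n * (n : ℝ) ^ (-(σ + ε)) := by
        rw [Finset.mul_sum]
    _ ≤ K₁ / Real.log x * x ^ ε * (C / (1 - (σ + ε)) * x ^ (1 - (σ + ε))) := by
        gcongr
        refine (sum_mul_rpow_neg_le hC.le hβ (by linarith) (by linarith) _).trans ?_
        gcongr
    _ = K₁ * (C / (1 - (σ + ε))) * ((x ^ ε * x ^ (1 - (σ + ε))) / Real.log x) := by ring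
    _ = _ := by
        rw [← Real.rpow_add hx0, show ε + (1 - (σ + ε)) = 1 - σ by ring]

/-! ### Dirichlet polynomials: size for Re s ≥ 1/2 and truncation error on Re s = 3 -/

/-- `∑_{n ≤ N} β(n) (-log n)^k n^{-s}`, the `k`-th derivative of a Dirichlet polynomial. -/
noncomputable def dirichletPoly (β : ℕ → ℂ) (N k : ℕ) (s : ℂ) : ℂ :=
  ∑ n ∈ Finset.Icc 1 N, β n * (-(Real.log n : ℂ)) ^ k * (n : ℂ) ^ (-s)

theorem hasDerivAt_dirichletPoly (β : ℕ → ℂ) (N k : ℕ) (s : ℂ) :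
    HasDerivAt (dirichletPoly β N k) (dirichletPoly β N (k + 1) s) s := by
  unfold dirichletPoly
  refine HasDerivAt.fun_sum fun n hn => ?_
  have hn0 : (n : ℂ) ≠ 0 := by
    have := (Finset.mem_Icc.1 hn).1
    exact_mod_cast (by omega : n ≠ 0)
  refine (((hasDerivAt_neg s).const_cpow (Or.inl hn0)).const_mul
    (β n * (-(Real.log n : ℂ)) ^ k)).congr_deriv ?_
  rw [Complex.natCast_log]
  ring

theorem norm_dirichletPoly_le (β : ℕ → ℂ) (N k : ℕ) (s : ℂ) :
    ‖dirichletPoly β N k s‖ ≤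
      ∑ n ∈ Finset.Icc 1 N, ‖β n‖ * Real.log n ^ k * (n : ℝ) ^ (-s.re) := by
  refine (norm_sum_le _ _).trans (Finset.sum_le_sum fun n hn => ?_)
  have hn0 : 0 < n := (Finset.mem_Icc.1 hn).1
  rw [norm_mul, norm_mul, norm_pow, norm_neg, Complex.norm_real,
    Real.norm_of_nonneg (Real.log_natCast_nonneg n), Complex.norm_natCast_cpow_of_pos hn0,
    Complex.neg_re]

theorem norm_dirichletPoly_succ_le {β : ℕ → ℂ} {C x : ℝ} (hC : 0 < C)
    (hβ : ∀ N : ℕ, ∑ n ∈ Finset.Icc 1 N, ‖β n‖ * Real.log n ≤ C * N) (hx : 1 ≤ x) (k : ℕ)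
    {s : ℂ} (hs : 1 / 2 ≤ s.re) :
    ‖dirichletPoly β ⌊x⌋₊ (k + 1) s‖ ≤ 2 * C * Real.log x ^ k * Real.sqrt x := by
  have hx0 : 0 < x := by linarith
  have hfl : ((⌊x⌋₊ : ℕ) : ℝ) ≤ x := Nat.floor_le hx0.le
  have hlogx : 0 ≤ Real.log x := Real.log_nonneg hx
  refine (norm_dirichletPoly_le _ _ _ _).trans ?_
  calc _ ≤ ∑ n ∈ Finset.Icc 1 ⌊x⌋₊,
        Real.log x ^ k * (‖β n‖ * Real.log n * (n : ℝ) ^ (-(1 / 2) : ℝ)) := by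
        refine Finset.sum_le_sum fun n hn => ?_
        rw [Finset.mem_Icc] at hn
        have hn1 : (1 : ℝ) ≤ n := by exact_mod_cast hn.1
        have hlogn : 0 ≤ Real.log n := Real.log_natCast_nonneg n
        have hnx : (n : ℝ) ≤ x := (Nat.le_floor_iff hx0.le).1 hn.2
        have h1 : Real.log n ^ k ≤ Real.log x ^ k := by gcongr
        have h2 : (n : ℝ) ^ (-s.re) ≤ (n : ℝ) ^ (-(1 / 2) : ℝ) :=
          Real.rpow_le_rpow_of_exponent_le hn1 (by linarith)
        calc ‖β n‖ * Real.log n ^ (k + 1) * (n : ℝ) ^ (-s.re)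
            = Real.log n ^ k * (‖β n‖ * Real.log n * (n : ℝ) ^ (-s.re)) := by ring
          _ ≤ _ := by gcongr
    _ = Real.log x ^ k * ∑ n ∈ Finset.Icc 1 ⌊x⌋₊, ‖β n‖ * Real.log n * (n : ℝ) ^ (-(1 / 2) : ℝ) := by
        rw [Finset.mul_sum]
    _ ≤ Real.log x ^ k * (C / (1 - 1 / 2) * x ^ (1 - 1 / 2 : ℝ)) := by
        gcongr
        refine (sum_mul_rpow_neg_le hC.le hβ (by norm_num) (by norm_num) _).trans ?_
        gcongr
    _ = _ := by
        rw [Real.sqrt_eq_rpow, show (1 - 1 / 2 : ℝ) = 1 / 2 by norm_num]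
        ring

/-- Of n^{-3}, one factor 1/n absorbs the extra logarithm, since log t/t decreases beyond e (whence
3 ≤ x), and n^{-2} is summed by the Chebyshev tail bound. The cases k = 0, 1 serve L'/L and its
derivative. -/
theorem norm_tsum_sub_dirichletPoly_le {β : ℕ → ℂ} {C x : ℝ} (hC : 0 < C)
    (hβ : ∀ N : ℕ, ∑ n ∈ Finset.Icc 1 N, ‖β n‖ * Real.log n ≤ C * N) (hx : 3 ≤ x) {k : ℕ}
    (hk : k ≤ 1) {s : ℂ} (hs : s.re = 3)
    {S : ℂ} (hS : HasSum (fun n : ℕ => if n = 0 then 0 else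
      β n * (-(Real.log n : ℂ)) ^ (k + 1) * (n : ℂ) ^ (-s)) S) :
    ‖S - dirichletPoly β ⌊x⌋₊ (k + 1) s‖ ≤ 16 * C * Real.log x ^ k / x ^ 2 := by
  have hx0 : 0 < x := by linarith
  set N := ⌊x⌋₊ with hN
  have hfl : (N : ℝ) ≤ x := Nat.floor_le hx0.le
  have hfl2 : x / 2 ≤ N := by
    have := Nat.lt_floor_add_one x
    rw [← hN] at this
    linarith
  have hN1 : 1 ≤ N := Nat.le_floor (by norm_num; linarith)
  have hN0 : (0 : ℝ) < N := by exact_mod_cast hN1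
  have hlogx : 0 ≤ Real.log x := Real.log_nonneg (by linarith)
  have hlim := (hS.tendsto_sum_nat.comp (tendsto_add_atTop_nat 1)).sub_const
    (dirichletPoly β N (k + 1) s)
  refine le_of_tendsto hlim.norm ?_
  filter_upwards [eventually_ge_atTop N] with M hM
  have hsum : ∑ n ∈ Finset.range (M + 1), (if n = 0 then 0 else
      β n * (-(Real.log n : ℂ)) ^ (k + 1) * (n : ℂ) ^ (-s)) = dirichletPoly β M (k + 1) s := by
    rw [dirichletPoly, Finset.range_eq_Ico, Finset.sum_eq_sum_Ico_succ_bot (by omega)]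
    simp only [if_true, zero_add]
    refine Finset.sum_congr ?_ fun n hn => ?_
    · ext n; simp only [Finset.mem_Ico, Finset.mem_Icc]; omega
    · rw [if_neg (by have := (Finset.mem_Icc.1 hn).1; omega)]
  have hsplit : Finset.Icc 1 M = Finset.Icc 1 N ∪ Finset.Ioc N M := by
    ext n; simp only [Finset.mem_union, Finset.mem_Icc, Finset.mem_Ioc]; omega
  have hdisj : Disjoint (Finset.Icc 1 N) (Finset.Ioc N M) := by
    rw [Finset.disjoint_left]; intro n; simp only [Finset.mem_Icc, Finset.mem_Ioc]; omega
  simp only [Function.comp_apply]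
  rw [hsum, dirichletPoly, dirichletPoly, hsplit, Finset.sum_union hdisj, add_sub_cancel_left]
  refine (norm_sum_le _ _).trans ?_
  have hterm : ∀ n ∈ Finset.Ioc N M, ‖β n * (-(Real.log n : ℂ)) ^ (k + 1) * (n : ℂ) ^ (-s)‖ ≤
      4 * Real.log x ^ k / x * (‖β n‖ * Real.log n * ((n : ℝ) ^ 2)⁻¹) := by
    intro n hn
    rw [Finset.mem_Ioc] at hn
    have hnN : (N : ℝ) + 1 ≤ n := by exact_mod_cast hn.1
    have hn0 : 0 < n := by omega
    have hn0' : (0 : ℝ) < n := by exact_mod_cast hn0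
    have hxn : x ≤ n := by
      have := Nat.lt_floor_add_one x
      rw [← hN] at this
      linarith
    have hlogn : 0 ≤ Real.log n := Real.log_natCast_nonneg n
    rw [norm_mul, norm_mul, norm_pow, norm_neg, Complex.norm_real,
      Real.norm_of_nonneg hlogn, Complex.norm_natCast_cpow_of_pos hn0, Complex.neg_re, hs]
    have h3 : (n : ℝ) ^ (-3 : ℝ) = ((n : ℝ) ^ 2)⁻¹ * (n : ℝ)⁻¹ := by
      rw [Real.rpow_neg hn0'.le, show (3 : ℝ) = ((3 : ℕ) : ℝ) by norm_num, Real.rpow_natCast,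
        ← mul_inv]
      congr 1
    have h4 : Real.log n ^ k * (n : ℝ)⁻¹ ≤ Real.log x ^ k / x := by
      interval_cases k
      · simp only [pow_zero, one_mul, one_div]
        gcongr
      · simp only [pow_one]
        have he : Real.exp 1 ≤ x := by
          have := Real.exp_one_lt_d9
          linarith
        have := Real.log_div_self_antitoneOn (show x ∈ Ici (Real.exp 1) from he)
          (show (n : ℝ) ∈ Ici (Real.exp 1) from he.trans hxn) hxn
        simpa [div_eq_mul_inv] using this
    calc ‖β n‖ * Real.log n ^ (k + 1) * (n : ℝ) ^ (-3 : ℝ)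
        = Real.log n ^ k * (n : ℝ)⁻¹ * (‖β n‖ * Real.log n * ((n : ℝ) ^ 2)⁻¹) := by
          rw [h3]; ring
      _ ≤ Real.log x ^ k / x * (‖β n‖ * Real.log n * ((n : ℝ) ^ 2)⁻¹) := by gcongr
      _ ≤ _ := by
          gcongr
          have : 0 ≤ Real.log x ^ k := by positivity
          linarith
  calc _ ≤ ∑ n ∈ Finset.Ioc N M,
        4 * Real.log x ^ k / x * (‖β n‖ * Real.log n * ((n : ℝ) ^ 2)⁻¹) := Finset.sum_le_sum hterm
    _ = 4 * Real.log x ^ k / x *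
        ∑ n ∈ Finset.Ioc N M, ‖β n‖ * Real.log n * ((n : ℝ) ^ 2)⁻¹ := by rw [Finset.mul_sum]
    _ ≤ 4 * Real.log x ^ k / x * (2 * C / (x / 2)) := by
        gcongr
        refine (sum_Ioc_mul_inv_sq_le hC.le (fun n => mul_nonneg (norm_nonneg _)
          (Real.log_natCast_nonneg n)) hβ hN1 M).trans ?_
        gcongr
    _ = _ := by field_simp; ring

/-! ### Zero-free L-functions and the one-sided bound for Re L'/L -/

/-- A function holomorphic and of polynomial growth in the upper half plane, without zeros
to the right of the critical line, and whose logarithm is given by a Dirichlet series with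
coefficients satisfying a Chebyshev bound. -/
structure IsZeroFreeLFunction (L : ℂ → ℂ) (β : ℕ → ℂ) (A C : ℝ) : Prop where
  growth_pos : 0 < A
  chebyshev_pos : 0 < C
  differentiableAt : ∀ s : ℂ, 0 < s.im → DifferentiableAt ℂ L s
  growth : ∀ s : ℂ, -3 ≤ s.re → 2 ≤ s.im → ‖L s‖ ≤ Real.exp (A * Real.log s.im)
  ne_zero : ∀ s : ℂ, 1 / 2 < s.re → 0 < s.im → L s ≠ 0
  abscissa_le : LSeries.abscissaOfAbsConv β ≤ ((3 / 2 : ℝ) : EReal)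
  eq_exp : ∀ s : ℂ, 3 / 2 < s.re → L s = Complex.exp (LSeries β s)
  chebyshev : ∀ N : ℕ, ∑ n ∈ Finset.Icc 1 N, ‖β n‖ * Real.log n ≤ C * N

namespace IsZeroFreeLFunction

variable {L : ℂ → ℂ} {β : ℕ → ℂ} {A C : ℝ}

theorem logDeriv_eq (h : IsZeroFreeLFunction L β A C) {s : ℂ} (hs : 3 / 2 < s.re) :
    logDeriv L s = -LSeries (LSeries.logMul β) s := by
  have hd := (LSeries_hasDerivAt (lt_re_of_abscissaOfAbsConv_le h.abscissa_le hs)).cexp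
  have hev : L =ᶠ[𝓝 s] fun s => Complex.exp (LSeries β s) := by
    filter_upwards [(isOpen_lt continuous_const Complex.continuous_re).mem_nhds hs] with z hz
    exact h.eq_exp z hz
  rw [logDeriv_apply, hev.deriv_eq, hd.deriv, h.eq_exp s hs]
  have := Complex.exp_ne_zero (LSeries β s)
  field_simp

theorem deriv_logDeriv_eq (h : IsZeroFreeLFunction L β A C) {s : ℂ} (hs : 3 / 2 < s.re) :
    deriv (logDeriv L) s = LSeries (LSeries.logMul (LSeries.logMul β)) s := by
  have hd := (LSeries_hasDerivAt (f := LSeries.logMul β) (by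
    rw [LSeries.abscissaOfAbsConv_logMul]
    exact lt_re_of_abscissaOfAbsConv_le h.abscissa_le hs)).neg
  have hev : logDeriv L =ᶠ[𝓝 s] -LSeries (LSeries.logMul β) := by
    filter_upwards [(isOpen_lt continuous_const Complex.continuous_re).mem_nhds hs] with z hz
    exact h.logDeriv_eq hz
  rw [hev.deriv_eq, hd.deriv, neg_neg]

theorem norm_logDeriv_sub_dirichletPoly_le (h : IsZeroFreeLFunction L β A C) {s : ℂ}
    (hs : s.re = 3) {x : ℝ} (hx : 3 ≤ x) :
    ‖logDeriv L s - dirichletPoly β ⌊x⌋₊ 1 s‖ ≤ 16 * C / x ^ 2 := by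
  have hs' : 3 / 2 < s.re := by rw [hs]; norm_num
  have hsum := (LSeriesSummable_logMul_of_lt_re
    (lt_re_of_abscissaOfAbsConv_le h.abscissa_le hs')).LSeriesHasSum.neg
  have := norm_tsum_sub_dirichletPoly_le h.chebyshev_pos h.chebyshev hx (k := 0) zero_le_one hs
    (S := logDeriv L s) (by
      rw [h.logDeriv_eq hs']
      unfold LSeriesHasSum at hsum
      convert hsum using 1
      ext n
      rcases eq_or_ne n 0 with rfl | hn
      · simp
      · rw [if_neg hn, LSeries.term_of_ne_zero hn, Pi.neg_apply, LSeries.logMul, Complex.cpow_neg,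
          Complex.natCast_log]
        ring)
  simpa using this

theorem norm_deriv_logDeriv_sub_dirichletPoly_le (h : IsZeroFreeLFunction L β A C) {s : ℂ}
    (hs : s.re = 3) {x : ℝ} (hx : 3 ≤ x) :
    ‖deriv (logDeriv L) s - dirichletPoly β ⌊x⌋₊ 2 s‖ ≤ 16 * C * Real.log x / x ^ 2 := by
  have hs' : 3 / 2 < s.re := by rw [hs]; norm_num
  have hsum := (LSeriesSummable_logMul_of_lt_re (f := LSeries.logMul β) (by
    rw [LSeries.abscissaOfAbsConv_logMul]
    exact lt_re_of_abscissaOfAbsConv_le h.abscissa_le hs')).LSeriesHasSum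
  have := norm_tsum_sub_dirichletPoly_le h.chebyshev_pos h.chebyshev hx (k := 1) le_rfl hs
    (S := deriv (logDeriv L) s) (by
      rw [h.deriv_logDeriv_eq hs']
      unfold LSeriesHasSum at hsum
      convert hsum using 1
      ext n
      rcases eq_or_ne n 0 with rfl | hn
      · simp
      · rw [if_neg hn, LSeries.term_of_ne_zero hn, LSeries.logMul, LSeries.logMul,
          Complex.cpow_neg, Complex.natCast_log]
        ring)
  simpa using this

theorem exists_bounds_right (h : IsZeroFreeLFunction L β A C) :
    ∃ K : ℝ, 0 < K ∧ (∀ s : ℂ, 3 ≤ s.re → ‖logDeriv L s‖ ≤ K) ∧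
      (∀ s : ℂ, 3 ≤ s.re → Real.exp (-K) ≤ ‖L s‖) ∧ (∀ s : ℂ, 3 ≤ s.re → ‖L s‖ ≤ Real.exp K) ∧
      ∀ (s : ℂ) (N : ℕ), s.re = 3 → ‖dirichletPoly β N 0 s‖ ≤ K := by
  have h3 : (3 / 2 : ℝ) < (3 : ℂ).re := by norm_num
  have hlt := lt_re_of_abscissaOfAbsConv_le h.abscissa_le h3
  have hs1 : LSeriesSummable β 3 := LSeriesSummable_of_abscissaOfAbsConv_lt_re hlt
  have hs2 : LSeriesSummable (LSeries.logMul β) 3 := LSeriesSummable_logMul_of_lt_re hlt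
  have hbound : ∀ f : ℕ → ℂ, LSeriesSummable f 3 → ∀ s : ℂ, 3 ≤ s.re →
      ‖LSeries f s‖ ≤ ∑' n, ‖LSeries.term f 3 n‖ := by
    intro f hf s hs
    have hre : (3 : ℂ).re ≤ s.re := by simpa using hs
    have hsum := (hf.of_re_le_re hre).norm
    exact (norm_tsum_le_tsum_norm hsum).trans (hsum.tsum_le_tsum
      (fun n => LSeries.norm_term_le_of_re_le_re f hre n) hf.norm)
  set K₁ := ∑' n, ‖LSeries.term β 3 n‖ with hK₁
  set K₂ := ∑' n, ‖LSeries.term (LSeries.logMul β) 3 n‖ with hK₂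
  have hK₁0 : 0 ≤ K₁ := tsum_nonneg fun _ => norm_nonneg _
  have hK₂0 : 0 ≤ K₂ := tsum_nonneg fun _ => norm_nonneg _
  refine ⟨K₁ + K₂ + 1, by linarith, fun s hs => ?_, fun s hs => ?_, fun s hs => ?_,
    fun s N hs => ?_⟩
  · rw [h.logDeriv_eq (by linarith), norm_neg]
    linarith [hbound _ hs2 s hs]
  · rw [h.eq_exp s (by linarith), Complex.norm_exp, Real.exp_le_exp]
    have := neg_le_of_abs_le ((Complex.abs_re_le_norm _).trans (hbound _ hs1 s hs))
    linarith
  · rw [h.eq_exp s (by linarith), Complex.norm_exp, Real.exp_le_exp]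
    have := (Complex.re_le_norm _).trans (hbound _ hs1 s hs)
    linarith
  · refine (norm_dirichletPoly_le _ _ _ _).trans ?_
    have : ∑ n ∈ Finset.Icc 1 N, ‖β n‖ * Real.log n ^ 0 * (n : ℝ) ^ (-s.re) ≤ K₁ := by
      refine le_of_eq_of_le (Finset.sum_congr rfl fun n hn => ?_)
        (hs1.norm.sum_le_tsum (Finset.Icc 1 N) fun _ _ => norm_nonneg _)
      have hn0 : 0 < n := (Finset.mem_Icc.1 hn).1
      rw [LSeries.norm_term_eq, if_neg hn0.ne', hs, pow_zero, mul_one, Real.rpow_neg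
        (Nat.cast_nonneg n), div_eq_mul_inv]
      simp
    linarith

/-- Landau's bound with centre 3 + i Im z. The disc of radius 6 stays in Re ≥ -3, Im ≥ 2, where
growth is polynomial, and every zero in the disc of radius 3 has real part at most 1/2. -/
theorem exists_neg_le_re_logDeriv (h : IsZeroFreeLFunction L β A C) :
    ∃ C₀ : ℝ, 0 < C₀ ∧ ∀ z : ℂ, 1 / 2 < z.re → 8 ≤ z.im →
      -(C₀ * Real.log z.im) ≤ (logDeriv L z).re := by
  obtain ⟨K, hK, hK1, hK2, -, -⟩ := h.exists_bounds_right
  have hA := h.growth_pos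
  -- 44 is 2(1 + 2r/(R - r))/(R - r) at R = 3, r = 5/2. The sum 2A log Im z + K compares the growth
  -- on the disc, where Im w ≤ (Im z)², with |L(c)| ≥ e^{-K}.
  refine ⟨44 * (2 * A + K) + K, by positivity, fun z hz hz8 => ?_⟩
  have hlog : 1 ≤ Real.log z.im := by
    rw [Real.le_log_iff_exp_le (by linarith)]
    linarith [Real.exp_one_lt_d9]
  rcases le_or_gt 3 z.re with hz3 | hz3
  · have := neg_le_of_abs_le ((Complex.abs_re_le_norm _).trans (hK1 z hz3))
    refine le_trans ?_ this
    rw [neg_le_neg_iff]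
    nlinarith
  set c : ℂ := ⟨3, z.im⟩ with hc
  have hLc := hK2 c (le_of_eq rfl)
  have hcim : c.im = z.im := rfl
  have hcre : c.re = 3 := rfl
  have hM : 0 < 2 * A * Real.log z.im + K := by positivity
  have hball : ∀ w ∈ closedBall c (2 * 3), -3 ≤ w.re ∧ 2 ≤ w.im ∧ w.im ≤ z.im ^ 2 := by
    intro w hw
    rw [mem_closedBall, dist_eq_norm] at hw
    have h1 := abs_le.1 ((Complex.abs_re_le_norm (w - c)).trans hw)
    have h2 := abs_le.1 ((Complex.abs_im_le_norm (w - c)).trans hw)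
    rw [Complex.sub_re, hcre] at h1
    rw [Complex.sub_im, hcim] at h2
    exact ⟨by linarith, by linarith, by nlinarith⟩
  have hzc : ‖z - c‖ ≤ 5 / 2 := by
    refine (Complex.norm_le_abs_re_add_abs_im _).trans ?_
    rw [Complex.sub_im, Complex.sub_re, hcim, hcre, sub_self, abs_zero, add_zero,
      abs_of_neg (by linarith)]
    linarith
  have hana : AnalyticOnNhd ℂ L (closedBall c (2 * 3)) := by
    intro w hw
    have hopen : IsOpen {s : ℂ | 0 < s.im} := isOpen_lt continuous_const Complex.continuous_im
    exact DifferentiableOn.analyticAt (fun s hs => (h.differentiableAt s hs).differentiableWithinAt)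
      (hopen.mem_nhds (show 0 < w.im by linarith [(hball w hw).2.1]))
  have key := neg_le_re_logDeriv (f := L) (c := c) (z := z) (R := 3) (r := 5 / 2)
    (M := 2 * A * Real.log z.im + K) (by norm_num) (by norm_num) hM hana
    (h.ne_zero c (by rw [hcre]; norm_num) (by rw [hcim]; linarith)) (fun w hw => by
      obtain ⟨h1, h2, h3⟩ := hball w hw
      refine (h.growth w h1 h2).trans ?_
      have hl : Real.log w.im ≤ 2 * Real.log z.im := by
        have := Real.log_le_log (by linarith) h3
        rwa [Real.log_pow, Nat.cast_ofNat] at this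
      calc Real.exp (A * Real.log w.im) ≤ Real.exp (A * (2 * Real.log z.im)) := by gcongr
        _ = Real.exp (2 * A * Real.log z.im + K) * Real.exp (-K) := by
          rw [← Real.exp_add]; congr 1; ring
        _ ≤ _ := by gcongr) hzc
    (h.ne_zero z hz (by linarith)) (fun w hw hw0 => by
      have hw' := hball w (closedBall_subset_closedBall (by norm_num) hw)
      by_contra hlt
      exact h.ne_zero w (by linarith) (by linarith) hw0)
  refine le_trans ?_ key
  norm_num
  nlinarith

end IsZeroFreeLFunction

/-! ### Comparison of (L'/L)' and L'/L with Dirichlet polynomials of length ℓ² -/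

theorem norm_le_of_norm_deriv_le_exp {f f' : ℝ → ℂ} {a b B Y K : ℝ} (hK : 0 ≤ K)
    (hf : ∀ σ ∈ Icc a b, HasDerivAt f (f' σ) σ)
    (hf' : ∀ σ ∈ Icc a b, ‖f' σ‖ ≤ K * Y * Real.exp (-(σ - a) * Y)) (hb : ‖f b‖ ≤ B)
    {σ : ℝ} (hσ : σ ∈ Icc a b) : ‖f σ‖ ≤ B + K * Real.exp (-(σ - a) * Y) := by
  -- The value is known at the right end `b`, whereas the comparison theorem starts from the left
  -- end; hence the reflection σ = -y.
  have hder : ∀ y ∈ Icc (-b) (-a), HasDerivAt (fun y => f (-y)) (-f' (-y)) y := by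
    intro y hy
    have h1 := hf (-y) ⟨by linarith [hy.2], by linarith [hy.1]⟩
    exact (HasDerivAt.scomp y h1 (hasDerivAt_neg y)).congr_deriv (by simp)
  have hder2 : ∀ y, HasDerivAt (fun y => B + K * Real.exp ((y + a) * Y))
      (K * (Real.exp ((y + a) * Y) * (1 * Y))) y := by
    intro y
    exact (((((hasDerivAt_id y).add_const a).mul_const Y).exp).const_mul K).const_add B
  have := image_norm_le_of_norm_deriv_right_le_deriv_boundary' (f := fun y => f (-y))
    (f' := fun y => -f' (-y)) (a := -b) (b := -a)
    (B := fun y => B + K * Real.exp ((y + a) * Y))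
    (B' := fun y => K * (Real.exp ((y + a) * Y) * (1 * Y)))
    (fun y hy => (hder y hy).continuousAt.continuousWithinAt)
    (fun y hy => (hder y ⟨hy.1, hy.2.le⟩).hasDerivWithinAt)
    (by
      have : 0 ≤ K * Real.exp ((-b + a) * Y) := by positivity
      simp only [neg_neg]
      linarith)
    (fun y _ => (hder2 y).continuousAt.continuousWithinAt)
    (fun y _ => (hder2 y).hasDerivWithinAt)
    (fun y hy => by
      rw [norm_neg]
      refine (hf' (-y) ⟨by linarith [hy.2], by linarith [hy.1]⟩).trans (le_of_eq ?_)
      rw [show -(-y - a) * Y = (y + a) * Y by ring]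
      ring)
    (show -σ ∈ Icc (-b) (-a) from ⟨by linarith [hσ.2], by linarith [hσ.1]⟩)
  simp only [neg_neg] at this
  rwa [show (-σ + a) * Y = -(σ - a) * Y by ring] at this

namespace IsZeroFreeLFunction

variable {L : ℂ → ℂ} {β : ℕ → ℂ} {A C : ℝ}

theorem isOpen_region : IsOpen {s : ℂ | 1 / 2 < s.re ∧ 0 < s.im} :=
  (isOpen_lt continuous_const Complex.continuous_re).inter
    (isOpen_lt continuous_const Complex.continuous_im)

theorem differentiableOn_logDeriv (h : IsZeroFreeLFunction L β A C) :
    DifferentiableOn ℂ (logDeriv L) {s : ℂ | 1 / 2 < s.re ∧ 0 < s.im} := by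
  have hd : DifferentiableOn ℂ L {s : ℂ | 1 / 2 < s.re ∧ 0 < s.im} := fun s hs =>
    (h.differentiableAt s hs.2).differentiableWithinAt
  exact (hd.deriv isOpen_region).div hd fun s hs => h.ne_zero s hs.1 hs.2

theorem hasDerivAt_logDeriv (h : IsZeroFreeLFunction L β A C) {s : ℂ} (hs : 1 / 2 < s.re)
    (hs' : 0 < s.im) : HasDerivAt (logDeriv L) (deriv (logDeriv L) s) s :=
  (h.differentiableOn_logDeriv.differentiableAt (isOpen_region.mem_nhds ⟨hs, hs'⟩)).hasDerivAt

theorem differentiableAt_deriv_logDeriv (h : IsZeroFreeLFunction L β A C) {s : ℂ}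
    (hs : 1 / 2 < s.re) (hs' : 0 < s.im) : DifferentiableAt ℂ (deriv (logDeriv L)) s :=
  (h.differentiableOn_logDeriv.deriv isOpen_region).differentiableAt
    (isOpen_region.mem_nhds ⟨hs, hs'⟩)

/-- The real part of `L'/L`, shifted so as to be nonnegative at height about `T`. -/
noncomputable def shiftedRe (L : ℂ → ℂ) (D : ℝ) (z : ℂ) : ℝ := (logDeriv L z + D).re

/-- The radius σ - 1/2 is at most 5/2, so a margin of 3 in height keeps the ball where the shifted
real part is nonnegative. -/
theorem ball_subset_region {σ t T : ℝ} (hσ' : σ ≤ 3)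
    (ht : T / 2 + 3 ≤ t) (ht' : t ≤ 2 * T - 3) {z : ℂ}
    (hz : z ∈ ball ((σ : ℂ) + t * Complex.I) (σ - 1 / 2)) :
    1 / 2 < z.re ∧ T / 2 ≤ z.im ∧ z.im ≤ 2 * T := by
  rw [mem_ball, dist_eq_norm] at hz
  have h1 := abs_lt.1 ((Complex.abs_re_le_norm _).trans_lt hz)
  have h2 := abs_lt.1 ((Complex.abs_im_le_norm _).trans_lt hz)
  simp only [Complex.sub_re, Complex.sub_im, Complex.add_re, Complex.add_im, Complex.ofReal_re,
    Complex.ofReal_im, Complex.mul_re, Complex.mul_im, Complex.I_re, Complex.I_im, mul_zero,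
    mul_one, zero_add, add_zero, sub_self] at h1 h2
  exact ⟨by linarith, by linarith, by linarith⟩

theorem differentiableOn_ball (h : IsZeroFreeLFunction L β A C) {σ t T D : ℝ} (hT : 16 ≤ T)
    (hσ' : σ ≤ 3) (ht : T / 2 + 3 ≤ t) (ht' : t ≤ 2 * T - 3) :
    DifferentiableOn ℂ (fun z => logDeriv L z + D)
      (ball ((σ : ℂ) + t * Complex.I) (σ - 1 / 2)) := by
  refine (h.differentiableOn_logDeriv.mono fun z hz => ?_).add_const _
  obtain ⟨h1, h2, -⟩ := ball_subset_region hσ' ht ht' hz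
  exact ⟨h1, by linarith⟩

theorem norm_deriv_logDeriv_le (h : IsZeroFreeLFunction L β A C) {σ t T D : ℝ} (hT : 16 ≤ T)
    (hD : ∀ z : ℂ, 1 / 2 < z.re → T / 2 ≤ z.im → z.im ≤ 2 * T → 0 ≤ shiftedRe L D z)
    (hσ : 1 / 2 < σ) (hσ' : σ ≤ 3) (ht : T / 2 + 3 ≤ t) (ht' : t ≤ 2 * T - 3) :
    ‖deriv (logDeriv L) ((σ : ℂ) + t * Complex.I)‖ ≤
      2 * shiftedRe L D ((σ : ℂ) + t * Complex.I) / (σ - 1 / 2) := by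
  have h1 := norm_deriv_le_of_re_nonneg (sub_pos.2 hσ)
    (h.differentiableOn_ball (D := D) hT hσ' ht ht') (fun z hz => by
      obtain ⟨h1, h2, h3⟩ := ball_subset_region hσ' ht ht' hz
      exact hD z h1 h2 h3)
  rwa [deriv_add_const] at h1

theorem sq_mul_shiftedRe_le (h : IsZeroFreeLFunction L β A C) {σ₁ σ₂ t T D : ℝ} (hT : 16 ≤ T)
    (hD : ∀ z : ℂ, 1 / 2 < z.re → T / 2 ≤ z.im → z.im ≤ 2 * T → 0 ≤ shiftedRe L D z)
    (h₁ : 1 / 2 < σ₁) (h₁₂ : σ₁ ≤ σ₂) (h₂ : σ₂ ≤ 3) (ht : T / 2 + 3 ≤ t) (ht' : t ≤ 2 * T - 3) :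
    (σ₁ - 1 / 2) ^ 2 * shiftedRe L D ((σ₁ : ℂ) + t * Complex.I) ≤
      (σ₂ - 1 / 2) ^ 2 * shiftedRe L D ((σ₂ : ℂ) + t * Complex.I) :=
  sq_mul_re_le_of_re_nonneg (g := fun z => logDeriv L z + D)
    (fun _ _ hσ' => h.differentiableOn_ball hT hσ' ht ht') (fun _ _ hσ' z hz => by
      obtain ⟨h1, h2, h3⟩ := ball_subset_region hσ' ht ht' hz
      exact hD z h1 h2 h3) h₁ h₁₂ h₂

/-- The crude bound that starts the iteration: compare with Re s = 3 by monotonicity. The constant 7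
exceeds (3 - 1/2)². -/
theorem shiftedRe_le_div_sq (h : IsZeroFreeLFunction L β A C) {σ t T D K : ℝ} (hT : 16 ≤ T)
    (hD : ∀ z : ℂ, 1 / 2 < z.re → T / 2 ≤ z.im → z.im ≤ 2 * T → 0 ≤ shiftedRe L D z)
    (hK : ∀ s : ℂ, 3 ≤ s.re → ‖logDeriv L s‖ ≤ K)
    (hσ : 1 / 2 < σ) (hσ' : σ ≤ 3) (ht : T / 2 + 3 ≤ t) (ht' : t ≤ 2 * T - 3) :
    shiftedRe L D ((σ : ℂ) + t * Complex.I) ≤ 7 * (K + D) / (σ - 1 / 2) ^ 2 := by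
  have h1 := h.sq_mul_shiftedRe_le hT hD hσ hσ' le_rfl ht ht'
  have h2 : shiftedRe L D (((3 : ℝ) : ℂ) + t * Complex.I) ≤ K + D := by
    have := (Complex.re_le_norm _).trans (hK (((3 : ℝ) : ℂ) + t * Complex.I) (by simp))
    rw [shiftedRe, Complex.add_re, Complex.ofReal_re]
    linarith
  have h3 : 0 ≤ shiftedRe L D (((3 : ℝ) : ℂ) + t * Complex.I) :=
    hD _ (by norm_num) (by simp; linarith) (by simp; linarith)
  have hp : 0 < (σ - 1 / 2) ^ 2 := by
    have : 0 < σ - 1 / 2 := by linarith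
    positivity
  rw [le_div_iff₀ hp, mul_comm]
  nlinarith

set_option maxHeartbeats 1000000 in
/-- Convexity estimate for the derivative of the difference between `L'/L` and a Dirichlet
polynomial of length `ℓ ^ 2`. -/
theorem norm_deriv_sub_dirichletPoly_le (h : IsZeroFreeLFunction L β A C) {T ℓ D K N δ t σ : ℝ}
    (hT : 16 ≤ T) (hℓ : 3 ≤ ℓ)
    (hD : ∀ z : ℂ, 1 / 2 < z.re → T / 2 ≤ z.im → z.im ≤ 2 * T → 0 ≤ shiftedRe L D z)
    (hK : ∀ s : ℂ, 3 ≤ s.re → ‖logDeriv L s‖ ≤ K) (hK0 : 0 ≤ K) (hD0 : 0 ≤ D)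
    (hδ : δ = 5 / Real.log ℓ) (hδ1 : δ ≤ 1)
    (hsmall : (Real.log ℓ ^ 2 * (K + D) + 2 * C * ℓ) * (ℓ ^ 5 * Real.exp (-ℓ ^ 2)) ≤ 1)
    (ht : T / 2 + 3 ≤ t - ℓ) (ht' : t + ℓ ≤ 2 * T - 3)
    (hN : ∀ u : ℝ, t - ℓ ≤ u → u ≤ t + ℓ →
      shiftedRe L D (((1 / 2 + 2 * δ : ℝ) : ℂ) + u * Complex.I) ≤ N)
    (hσ : 1 / 2 + δ ≤ σ) (hσ' : σ ≤ 3) :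
    ‖deriv (logDeriv L) ((σ : ℂ) + t * Complex.I) -
        dirichletPoly β ⌊ℓ ^ 2⌋₊ 2 ((σ : ℂ) + t * Complex.I)‖ ≤
      Real.exp 7 * (4 / 5 * N + (18 * C + 1) * ℓ) * (2 * Real.log ℓ) *
        Real.exp (-(σ - (1 / 2 + δ)) * (2 * Real.log ℓ)) := by
  have hC := h.chebyshev_pos
  have hℓ0 : 0 < ℓ := by linarith
  have hlogℓ : 1 ≤ Real.log ℓ := by
    rw [Real.le_log_iff_exp_le hℓ0]
    linarith [Real.exp_one_lt_d9]
  have hδ0 : 0 < δ := by rw [hδ]; positivity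
  set Y : ℝ := 2 * Real.log ℓ with hY
  have hY0 : 2 ≤ Y := by linarith
  clear_value Y
  -- δ is chosen so that δY = 10, with Y the logarithm of the length of the polynomial.
  have hδY : 1 / δ = Y / 10 := by rw [hδ, hY]; field_simp; norm_num
  have hx1 : 1 ≤ ℓ ^ 2 := by nlinarith
  have hx3 : 3 ≤ ℓ ^ 2 := by nlinarith
  have hlogx : Real.log (ℓ ^ 2) = Y := by rw [Real.log_pow]; simp [hY]
  have hexpY : Real.exp Y = ℓ ^ 2 := by rw [← hlogx, Real.exp_log (by positivity)]
  have hexp5 : Real.exp (5 / 2 * Y) = ℓ ^ 5 := by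
    rw [show 5 / 2 * Y = (5 : ℕ) * Real.log ℓ by rw [hY]; push_cast; ring, Real.exp_nat_mul,
      Real.exp_log hℓ0]
  have hN0 : 0 ≤ N := (hD _ (by
      simp only [Complex.add_re, Complex.ofReal_re, Complex.mul_re, Complex.I_re, mul_zero,
        Complex.ofReal_im, zero_mul, sub_zero, add_zero]
      linarith) (by simp; linarith) (by simp; linarith)).trans
    (hN t (by linarith) (by linarith))
  have hpoly : ∀ s : ℂ, 1 / 2 ≤ s.re → ‖dirichletPoly β ⌊ℓ ^ 2⌋₊ 2 s‖ ≤ 2 * C * Y * ℓ := by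
    intro s hs
    have := norm_dirichletPoly_succ_le hC h.chebyshev hx1 1 hs
    rwa [pow_one, hlogx, Real.sqrt_sq hℓ0.le] at this
  set s₀ : ℂ := (σ : ℂ) + t * Complex.I with hs₀
  have hs₀re : s₀.re = σ := by simp [hs₀]
  have hs₀im : s₀.im = t := by simp [hs₀]
  set H : ℂ → ℂ := fun z => deriv (logDeriv L) z - dirichletPoly β ⌊ℓ ^ 2⌋₊ 2 z with hH
  -- The factor with `Y` balances the left and right edges and produces the decay in σ. The Gaussian
  -- equals 1 at `s₀` and is negligible on the horizontal edges, at distance ℓ.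
  set φ : ℂ → ℂ := fun z => H z * (Complex.exp ((z - (1 / 2 + δ : ℝ)) * Y) *
    Complex.exp ((z - s₀) ^ 2)) with hφ
  have hnormφ : ∀ z : ℂ, ‖φ z‖ = ‖H z‖ * (Real.exp ((z.re - (1 / 2 + δ)) * Y) *
      Real.exp ((z.re - σ) ^ 2 - (z.im - t) ^ 2)) := by
    intro z
    rw [hφ]
    simp only [norm_mul, Complex.norm_exp]
    congr 3
    · simp
    · rw [pow_two, Complex.mul_re, Complex.sub_re, Complex.sub_im, hs₀re, hs₀im]
      ring
  -- Source of `Real.exp 7`: (5/2)² ≤ 7 bounds the growth of the Gaussian in the real direction.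
  have hsq : ∀ x : ℝ, 1 / 2 + δ ≤ x → x ≤ 3 → (x - σ) ^ 2 ≤ 7 := by
    intro x h1 h2
    have := abs_le.2 (⟨by linarith, by linarith⟩ : -(5 / 2) ≤ x - σ ∧ x - σ ≤ 5 / 2)
    have := sq_le_sq' (by linarith [abs_le.1 this] : -(5 / 2) ≤ x - σ) (by linarith [abs_le.1 this])
    linarith
  have hexpZ : ∀ x : ℝ, x ≤ 3 → Real.exp ((x - (1 / 2 + δ)) * Y) ≤ ℓ ^ 5 := by
    intro x hx
    rw [← hexp5, Real.exp_le_exp]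
    exact mul_le_mul_of_nonneg_right (by linarith) (by linarith)
  set K₀ : ℝ := Real.exp 7 * (4 / 5 * N + (18 * C + 1) * ℓ) * Y with hK₀
  clear_value K₀
  have hpt : ∀ z : ℂ, z = ((z.re : ℝ) : ℂ) + (z.im : ℝ) * Complex.I := fun z =>
    (Complex.re_add_im z).symm
  -- Here only the crude bound O((K + D)/δ³) is available for (L'/L)'; the Gaussian factor exp(-ℓ²)
  -- compensates through `hsmall`.
  have hedge : ∀ z : ℂ, (z.im = t - ℓ ∨ z.im = t + ℓ) → 1 / 2 + δ ≤ z.re → z.re ≤ 3 →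
      ‖φ z‖ ≤ K₀ := by
    intro z hz h1 h2
    have hz1 : T / 2 + 3 ≤ z.im := by rcases hz with hz | hz <;> linarith
    have hz2 : z.im ≤ 2 * T - 3 := by rcases hz with hz | hz <;> linarith
    have hz3 : (z.im - t) ^ 2 = ℓ ^ 2 := by rcases hz with hz | hz <;> rw [hz] <;> ring
    have hzre : 0 < z.re - 1 / 2 := by linarith
    have hder := h.norm_deriv_logDeriv_le hT hD (by linarith) h2 hz1 hz2
    have hre := h.shiftedRe_le_div_sq hT hD hK (by linarith) h2 hz1 hz2
    rw [← hpt] at hder hre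
    have hHz : ‖H z‖ ≤ 14 * (K + D) * (Y / 10) ^ 3 + 2 * C * Y * ℓ := by
      refine (norm_sub_le _ _).trans (add_le_add ?_ (hpoly z (by linarith)))
      refine hder.trans ?_
      calc 2 * shiftedRe L D z / (z.re - 1 / 2)
          ≤ 2 * (7 * (K + D) / (z.re - 1 / 2) ^ 2) / (z.re - 1 / 2) := by gcongr
        _ = 14 * (K + D) * (1 / (z.re - 1 / 2)) ^ 3 := by field_simp; ring
        _ ≤ 14 * (K + D) * (1 / δ) ^ 3 := by
            gcongr
            linarith
        _ = _ := by rw [hδY]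
    have hbig : 14 * (K + D) * (Y / 10) ^ 3 + 2 * C * Y * ℓ ≤
        Y * (Real.log ℓ ^ 2 * (K + D) + 2 * C * ℓ) := by
      rw [show 14 * (K + D) * (Y / 10) ^ 3 = Y * (14 * 4 / 1000 * (Real.log ℓ ^ 2 * (K + D))) by
        rw [hY]; ring]
      have : 0 ≤ Real.log ℓ ^ 2 * (K + D) := by positivity
      have h8 : 14 * 4 / 1000 * (Real.log ℓ ^ 2 * (K + D)) ≤ Real.log ℓ ^ 2 * (K + D) := by linarith
      linarith [mul_le_mul_of_nonneg_left h8 (show 0 ≤ Y by linarith)]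
    rw [hnormφ, hz3]
    have hsqz := hsq z.re h1 h2
    calc ‖H z‖ * (Real.exp ((z.re - (1 / 2 + δ)) * Y) * Real.exp ((z.re - σ) ^ 2 - ℓ ^ 2))
        ≤ (Y * (Real.log ℓ ^ 2 * (K + D) + 2 * C * ℓ)) *
          (ℓ ^ 5 * (Real.exp 7 * Real.exp (-ℓ ^ 2))) := by
          have h5 : Real.exp ((z.re - σ) ^ 2 - ℓ ^ 2) ≤ Real.exp 7 * Real.exp (-ℓ ^ 2) := by
            rw [← Real.exp_add, Real.exp_le_exp]; linarith
          have h6 := hexpZ z.re h2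
          have h7 := hHz.trans hbig
          gcongr
      _ = Real.exp 7 * Y * ((Real.log ℓ ^ 2 * (K + D) + 2 * C * ℓ) *
          (ℓ ^ 5 * Real.exp (-ℓ ^ 2))) := by ring
      _ ≤ Real.exp 7 * Y * 1 := by gcongr
      _ ≤ Real.exp 7 * Y * (4 / 5 * N + (18 * C + 1) * ℓ) := by
          gcongr
          linarith [mul_pos hC hℓ0]
      _ = _ := by rw [hK₀]; ring
  -- By monotonicity, going from 1/2 + 2δ to 1/2 + δ costs (2δ/δ)² = 4; then 2 · 4N/δ = (4/5)NY.
  have hleft : ∀ z : ℂ, z.re = 1 / 2 + δ → t - ℓ ≤ z.im → z.im ≤ t + ℓ → ‖φ z‖ ≤ K₀ := by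
    intro z hz h1 h2
    have hz1 : T / 2 + 3 ≤ z.im := by linarith
    have hz2 : z.im ≤ 2 * T - 3 := by linarith
    have hder := h.norm_deriv_logDeriv_le (σ := 1 / 2 + δ) hT hD (by linarith) (by linarith)
      hz1 hz2
    have hre := h.sq_mul_shiftedRe_le (σ₁ := 1 / 2 + δ) (σ₂ := 1 / 2 + 2 * δ) hT hD (by linarith)
      (by linarith) (by linarith) hz1 hz2
    have hNz := hN z.im h1 h2
    rw [← hz, ← hpt, hz] at hder
    rw [← hz, ← hpt, hz, add_sub_cancel_left, add_sub_cancel_left] at hre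
    rw [add_sub_cancel_left] at hder
    have hre' : shiftedRe L D z ≤ 4 * N := by
      have : δ ^ 2 * shiftedRe L D z ≤ δ ^ 2 * (4 * N) := by
        refine hre.trans ?_
        rw [show δ ^ 2 * (4 * N) = (2 * δ) ^ 2 * N by ring]
        gcongr
      exact le_of_mul_le_mul_left this (by positivity)
    have hHz : ‖H z‖ ≤ Y * (4 / 5 * N + 2 * C * ℓ) := by
      refine (norm_sub_le _ _).trans ((add_le_add hder (hpoly z (by linarith))).trans ?_)
      calc 2 * shiftedRe L D z / δ + 2 * C * Y * ℓ ≤ 2 * (4 * N) / δ + 2 * C * Y * ℓ := by gcongr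
        _ = 8 * N * (1 / δ) + 2 * C * Y * ℓ := by ring
        _ = _ := by rw [hδY]; ring
    rw [hnormφ, hz, sub_self, zero_mul, Real.exp_zero, one_mul]
    have hsqz := hsq z.re hz.ge (by linarith)
    rw [hz] at hsqz
    calc ‖H z‖ * Real.exp ((1 / 2 + δ - σ) ^ 2 - (z.im - t) ^ 2)
        ≤ (Y * (4 / 5 * N + 2 * C * ℓ)) * Real.exp 7 := by
          have : (1 / 2 + δ - σ) ^ 2 - (z.im - t) ^ 2 ≤ 7 := by linarith [sq_nonneg (z.im - t)]
          gcongr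
      _ ≤ (Y * (4 / 5 * N + (18 * C + 1) * ℓ)) * Real.exp 7 := by
          gcongr
          linarith
      _ = _ := by rw [hK₀]; ring
  -- The truncation error is O(Y/ℓ⁴) and the exponential weight is at most ℓ⁵, which leaves O(ℓY).
  have hright : ∀ z : ℂ, z.re = 3 → t - ℓ ≤ z.im → z.im ≤ t + ℓ → ‖φ z‖ ≤ K₀ := by
    intro z hz h1 h2
    have hHz := h.norm_deriv_logDeriv_sub_dirichletPoly_le hz hx3
    rw [hlogx] at hHz
    rw [hnormφ]
    have hsqz := hsq z.re (by linarith) hz.le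
    calc ‖H z‖ * (Real.exp ((z.re - (1 / 2 + δ)) * Y) *
          Real.exp ((z.re - σ) ^ 2 - (z.im - t) ^ 2))
        ≤ 16 * C * Y / (ℓ ^ 2) ^ 2 * (ℓ ^ 5 * Real.exp 7) := by
          have h5 : (z.re - σ) ^ 2 - (z.im - t) ^ 2 ≤ 7 := by linarith [sq_nonneg (z.im - t)]
          have h6 := hexpZ z.re hz.le
          gcongr
      _ = Real.exp 7 * (16 * C * ℓ) * Y := by field_simp
      _ ≤ _ := by
          rw [hK₀]
          gcongr
          linarith [mul_pos hC hℓ0]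
  have hφd : ∀ z : ℂ, 1 / 2 + δ ≤ z.re → z.re ≤ 3 → t - ℓ ≤ z.im → z.im ≤ t + ℓ →
      DifferentiableAt ℂ φ z := by
    intro z h1 _ h3 _
    have hd1 := h.differentiableAt_deriv_logDeriv (s := z) (by linarith) (by linarith)
    have hd2 := (hasDerivAt_dirichletPoly β ⌊ℓ ^ 2⌋₊ 2 z).differentiableAt
    exact (hd1.sub hd2).mul (by fun_prop)
  have hfin := norm_le_of_norm_le_on_rectangle (φ := φ) (a := 1 / 2 + δ) (b := 3) (c := t - ℓ)
    (d := t + ℓ) (K := K₀) (by linarith) (by linarith) hφd hleft hright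
    (fun z hz => hedge z (Or.inl hz)) (fun z hz => hedge z (Or.inr hz)) (z := s₀)
    (by rw [hs₀re]; exact hσ) (by rw [hs₀re]; exact hσ') (by rw [hs₀im]; linarith)
    (by rw [hs₀im]; linarith)
  rw [hnormφ, hs₀re, hs₀im, sub_self, sub_self, zero_pow two_ne_zero, sub_self, Real.exp_zero,
    mul_one] at hfin
  have hE : Real.exp (-(σ - (1 / 2 + δ)) * Y) = (Real.exp ((σ - (1 / 2 + δ)) * Y))⁻¹ := by
    rw [← Real.exp_neg]; congr 1; ring
  rw [hE, ← div_eq_mul_inv, le_div_iff₀ (Real.exp_pos _)]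
  exact hfin

end IsZeroFreeLFunction

/-! ### Iteration of the bound, and integration to log|L| -/

theorem hasDerivAt_log_norm {f : ℝ → ℂ} {f' : ℂ} {x : ℝ} (hf : HasDerivAt f f' x) (h0 : f x ≠ 0) :
    HasDerivAt (fun x => Real.log ‖f x‖) (f' / f x).re x := by
  have hp : 0 < ‖f x‖ := norm_pos_iff.2 h0
  have h1 := (hf.norm_sq.log (by positivity)).const_mul (1 / 2 : ℝ)
  have h2 : (fun x => 1 / 2 * Real.log (‖f x‖ ^ 2)) = fun x => Real.log ‖f x‖ := by
    funext y
    rw [Real.log_pow]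
    push_cast
    ring
  rw [h2] at h1
  refine h1.congr_deriv ?_
  rw [Complex.inner, Complex.sq_norm, Complex.div_re, Complex.mul_re, Complex.conj_re,
    Complex.conj_im]
  ring

namespace IsZeroFreeLFunction

variable {L : ℂ → ℂ} {β : ℕ → ℂ} {A C : ℝ}

theorem norm_sub_dirichletPoly_le (h : IsZeroFreeLFunction L β A C) {T ℓ D K N δ t σ : ℝ}
    (hT : 16 ≤ T) (hℓ : 3 ≤ ℓ)
    (hD : ∀ z : ℂ, 1 / 2 < z.re → T / 2 ≤ z.im → z.im ≤ 2 * T → 0 ≤ shiftedRe L D z)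
    (hK : ∀ s : ℂ, 3 ≤ s.re → ‖logDeriv L s‖ ≤ K) (hK0 : 0 ≤ K) (hD0 : 0 ≤ D)
    (hδ : δ = 5 / Real.log ℓ) (hδ1 : δ ≤ 1)
    (hsmall : (Real.log ℓ ^ 2 * (K + D) + 2 * C * ℓ) * (ℓ ^ 5 * Real.exp (-ℓ ^ 2)) ≤ 1)
    (ht : T / 2 + 3 ≤ t - ℓ) (ht' : t + ℓ ≤ 2 * T - 3) (hN0 : 0 ≤ N)
    (hN : ∀ u : ℝ, t - ℓ ≤ u → u ≤ t + ℓ →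
      shiftedRe L D (((1 / 2 + 2 * δ : ℝ) : ℂ) + u * Complex.I) ≤ N)
    (hσ : 1 / 2 + δ ≤ σ) (hσ' : σ ≤ 3) :
    ‖logDeriv L ((σ : ℂ) + t * Complex.I) -
        dirichletPoly β ⌊ℓ ^ 2⌋₊ 1 ((σ : ℂ) + t * Complex.I)‖ ≤
      16 * C / (ℓ ^ 2) ^ 2 + Real.exp 7 * (4 / 5 * N + (18 * C + 1) * ℓ) *
        Real.exp (-(σ - (1 / 2 + δ)) * (2 * Real.log ℓ)) := by
  have hC := h.chebyshev_pos
  have hδ0 : 0 < δ := by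
    have : 0 < Real.log ℓ := Real.log_pos (by linarith)
    rw [hδ]; positivity
  have hℓ0 : 0 < ℓ := by linarith
  refine norm_le_of_norm_deriv_le_exp (a := 1 / 2 + δ) (b := 3)
    (f := fun x : ℝ => logDeriv L ((x : ℂ) + t * Complex.I) -
        dirichletPoly β ⌊ℓ ^ 2⌋₊ 1 ((x : ℂ) + t * Complex.I))
    (f' := fun x : ℝ => deriv (logDeriv L) ((x : ℂ) + t * Complex.I) -
        dirichletPoly β ⌊ℓ ^ 2⌋₊ 2 ((x : ℂ) + t * Complex.I)) (by positivity)
    (fun x hx => ?_) (fun x hx => ?_) ?_ ⟨hσ, hσ'⟩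
  · refine hasDerivAt_comp_ofReal_add (g := fun z => logDeriv L z - dirichletPoly β ⌊ℓ ^ 2⌋₊ 1 z)
      (HasDerivAt.sub ?_ (hasDerivAt_dirichletPoly β _ 1 _))
    refine h.hasDerivAt_logDeriv ?_ ?_
    · have := hx.1
      simp only [Complex.add_re, Complex.ofReal_re, Complex.mul_re, Complex.I_re, mul_zero,
        Complex.ofReal_im, zero_mul, sub_zero, add_zero]
      linarith
    · simp
      linarith
  · exact h.norm_deriv_sub_dirichletPoly_le hT hℓ hD hK hK0 hD0 hδ hδ1 hsmall ht ht' hN hx.1 hx.2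
  · exact h.norm_logDeriv_sub_dirichletPoly_le (by simp) (by nlinarith)

/-- The self-improvement. At 1/2 + 2δ the decay is exp(-δY) = exp(-10), which outweighs the Gaussian
loss exp 7, so the coefficient of `N` falls below 1/2. The polynomial and the shift give O(ℓ) + D.
-/
theorem shiftedRe_le_half_add (h : IsZeroFreeLFunction L β A C) {T ℓ D K N δ t : ℝ}
    (hT : 16 ≤ T) (hℓ : 3 ≤ ℓ)
    (hD : ∀ z : ℂ, 1 / 2 < z.re → T / 2 ≤ z.im → z.im ≤ 2 * T → 0 ≤ shiftedRe L D z)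
    (hK : ∀ s : ℂ, 3 ≤ s.re → ‖logDeriv L s‖ ≤ K) (hK0 : 0 ≤ K) (hD0 : 0 ≤ D)
    (hδ : δ = 5 / Real.log ℓ) (hδ1 : δ ≤ 1)
    (hsmall : (Real.log ℓ ^ 2 * (K + D) + 2 * C * ℓ) * (ℓ ^ 5 * Real.exp (-ℓ ^ 2)) ≤ 1)
    (ht : T / 2 + 3 ≤ t - ℓ) (ht' : t + ℓ ≤ 2 * T - 3) (hN0 : 0 ≤ N)
    (hN : ∀ u : ℝ, t - ℓ ≤ u → u ≤ t + ℓ →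
      shiftedRe L D (((1 / 2 + 2 * δ : ℝ) : ℂ) + u * Complex.I) ≤ N) :
    shiftedRe L D (((1 / 2 + 2 * δ : ℝ) : ℂ) + t * Complex.I) ≤
      N / 2 + ((36 * C + 1) * ℓ + D) := by
  have hC := h.chebyshev_pos
  have hlog : 0 < Real.log ℓ := Real.log_pos (by linarith)
  have hδ0 : 0 < δ := by rw [hδ]; positivity
  have hℓ0 : 0 < ℓ := by linarith
  have h1 := h.norm_sub_dirichletPoly_le hT hℓ hD hK hK0 hD0 hδ hδ1 hsmall ht ht' hN0 hN
    (σ := 1 / 2 + 2 * δ) (by linarith) (by linarith)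
  have hexp : Real.exp (-(1 / 2 + 2 * δ - (1 / 2 + δ)) * (2 * Real.log ℓ)) = Real.exp (-10) := by
    congr 1
    rw [hδ]
    field_simp
    ring
  rw [hexp] at h1
  set s : ℂ := ((1 / 2 + 2 * δ : ℝ) : ℂ) + t * Complex.I with hs
  have hsre : s.re = 1 / 2 + 2 * δ := by simp [hs]
  have h2 := norm_dirichletPoly_succ_le hC h.chebyshev (x := ℓ ^ 2) (by nlinarith) 0 (s := s)
    (by rw [hsre]; linarith)
  rw [pow_zero, mul_one, Real.sqrt_sq hℓ0.le] at h2
  have h3 : 16 * C / (ℓ ^ 2) ^ 2 ≤ 16 * C * ℓ := by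
    rw [div_le_iff₀ (by positivity), mul_assoc]
    refine le_mul_of_one_le_right (by positivity) ?_
    have : 1 ≤ ℓ ^ 5 := one_le_pow₀ (by linarith)
    calc (1 : ℝ) ≤ ℓ ^ 5 := this
      _ = _ := by ring
  have h4 : Real.exp 7 * Real.exp (-10) ≤ 1 / 2 := by
    rw [← Real.exp_add, show (7 : ℝ) + -10 = -3 by norm_num, Real.exp_neg]
    rw [one_div]
    apply inv_anti₀ two_pos
    linarith [Real.add_one_le_exp (3 : ℝ)]
  have h5 : Real.exp 7 * (4 / 5 * N + (18 * C + 1) * ℓ) * Real.exp (-10) ≤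
      1 / 2 * (4 / 5 * N + (18 * C + 1) * ℓ) := by
    calc _ = Real.exp 7 * Real.exp (-10) * (4 / 5 * N + (18 * C + 1) * ℓ) := by ring
      _ ≤ _ := by gcongr
  have h6 : shiftedRe L D s ≤ ‖logDeriv L s‖ + D := by
    rw [shiftedRe, Complex.add_re, Complex.ofReal_re]
    linarith [Complex.re_le_norm (logDeriv L s)]
  have h7 := norm_le_norm_sub_add (logDeriv L s) (dirichletPoly β ⌊ℓ ^ 2⌋₊ 1 s)
  have hCℓ : 0 < C * ℓ := by positivity
  rw [zero_add] at h2
  linarith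

/-- Each halving uses the previous bound on a window of radius ℓ, so `k` steps use up kℓ of the
height range. The additive term is the fixed point of N ↦ N/2 + B, namely 2B. -/
theorem shiftedRe_le_geometric (h : IsZeroFreeLFunction L β A C) {T ℓ D K δ : ℝ}
    (hT : 16 ≤ T) (hℓ : 3 ≤ ℓ)
    (hD : ∀ z : ℂ, 1 / 2 < z.re → T / 2 ≤ z.im → z.im ≤ 2 * T → 0 ≤ shiftedRe L D z)
    (hK : ∀ s : ℂ, 3 ≤ s.re → ‖logDeriv L s‖ ≤ K) (hK0 : 0 ≤ K) (hD0 : 0 ≤ D)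
    (hδ : δ = 5 / Real.log ℓ) (hδ1 : δ ≤ 1)
    (hsmall : (Real.log ℓ ^ 2 * (K + D) + 2 * C * ℓ) * (ℓ ^ 5 * Real.exp (-ℓ ^ 2)) ≤ 1)
    (hTℓ : ℓ + 3 ≤ T / 4) (k : ℕ) (t : ℝ) (ht : |t - T| + k * ℓ ≤ T / 4) :
    shiftedRe L D (((1 / 2 + 2 * δ : ℝ) : ℂ) + t * Complex.I) ≤
      7 * (K + D) / (2 * δ) ^ 2 / 2 ^ k + 2 * ((36 * C + 1) * ℓ + D) := by
  have hC := h.chebyshev_pos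
  have hδ0 : 0 < δ := by
    have : 0 < Real.log ℓ := Real.log_pos (by linarith)
    rw [hδ]; positivity
  induction k generalizing t with
  | zero =>
    rw [Nat.cast_zero, zero_mul, add_zero] at ht
    have := abs_le.1 ht
    have h1 := h.shiftedRe_le_div_sq hT hD hK (σ := 1 / 2 + 2 * δ) (t := t) (by linarith)
      (by linarith) (by linarith) (by linarith)
    rw [add_sub_cancel_left] at h1
    have : 0 ≤ 2 * ((36 * C + 1) * ℓ + D) := by positivity
    rw [pow_zero, div_one]
    linarith
  | succ k ih =>
    push_cast at ht
    have hk : 0 ≤ (k : ℝ) * ℓ := by positivity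
    have htT := abs_le.1 (show |t - T| ≤ T / 4 by linarith)
    have h1 := h.shiftedRe_le_half_add hT hℓ hD hK hK0 hD0 hδ hδ1 hsmall (t := t)
      (N := 7 * (K + D) / (2 * δ) ^ 2 / 2 ^ k + 2 * ((36 * C + 1) * ℓ + D))
      (by linarith) (by linarith) (by positivity) (fun u hu hu' => ih u (by
        have h2 := abs_sub_le u t T
        have h3 : |u - t| ≤ ℓ := abs_le.2 ⟨by linarith, by linarith⟩
        linarith))
    refine h1.trans (le_of_eq ?_)
    rw [pow_succ]
    ring

theorem abs_log_norm_sub_le (h : IsZeroFreeLFunction L β A C) {T ℓ D K δ σ : ℝ} {k : ℕ}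
    (hT : 16 ≤ T) (hℓ : 3 ≤ ℓ)
    (hD : ∀ z : ℂ, 1 / 2 < z.re → T / 2 ≤ z.im → z.im ≤ 2 * T → 0 ≤ shiftedRe L D z)
    (hK : ∀ s : ℂ, 3 ≤ s.re → ‖logDeriv L s‖ ≤ K) (hK0 : 0 ≤ K) (hD0 : 0 ≤ D)
    (hδ : δ = 5 / Real.log ℓ) (hδ1 : δ ≤ 1)
    (hsmall : (Real.log ℓ ^ 2 * (K + D) + 2 * C * ℓ) * (ℓ ^ 5 * Real.exp (-ℓ ^ 2)) ≤ 1)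
    (hTℓ : ℓ + 3 ≤ T / 4) (hk : (k + 1) * ℓ ≤ T / 4)
    (hk' : 7 * (K + D) / (2 * δ) ^ 2 / 2 ^ k ≤ ℓ)
    (hK2 : ∀ s : ℂ, 3 ≤ s.re → Real.exp (-K) ≤ ‖L s‖)
    (hK3 : ∀ s : ℂ, 3 ≤ s.re → ‖L s‖ ≤ Real.exp K)
    (hK4 : ∀ (s : ℂ) (N : ℕ), s.re = 3 → ‖dirichletPoly β N 0 s‖ ≤ K)
    (hσ : 1 / 2 + δ ≤ σ) (hσ' : σ ≤ 3) :
    |Real.log ‖L ((σ : ℂ) + T * Complex.I)‖ -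
        (dirichletPoly β ⌊ℓ ^ 2⌋₊ 0 ((σ : ℂ) + T * Complex.I)).re| ≤
      2 * K + (16 * C * ℓ + Real.exp 7 * (4 / 5 * (ℓ + 2 * ((36 * C + 1) * ℓ + D)) +
        (18 * C + 1) * ℓ)) / (2 * Real.log ℓ) *
        Real.exp (-(σ - (1 / 2 + δ)) * (2 * Real.log ℓ)) := by
  have hC := h.chebyshev_pos
  have hlog : 0 < Real.log ℓ := Real.log_pos (by linarith)
  have hδ0 : 0 < δ := by rw [hδ]; positivity
  have hℓ0 : 0 < ℓ := by linarith
  set N : ℝ := ℓ + 2 * ((36 * C + 1) * ℓ + D) with hN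
  have hN0 : 0 ≤ N := by positivity
  set M : ℝ := 16 * C * ℓ + Real.exp 7 * (4 / 5 * N + (18 * C + 1) * ℓ) with hM
  have hM0 : 0 < M := by positivity
  have hre : ∀ x : ℝ, ((x : ℂ) + T * Complex.I).re = x := fun x => by simp
  have him : ∀ x : ℝ, ((x : ℂ) + T * Complex.I).im = T := fun x => by simp
  have hgeo : ∀ u : ℝ, T - ℓ ≤ u → u ≤ T + ℓ →
      shiftedRe L D (((1 / 2 + 2 * δ : ℝ) : ℂ) + u * Complex.I) ≤ N := by
    intro u hu hu'
    have h1 : |u - T| ≤ ℓ := abs_le.2 ⟨by linarith, by linarith⟩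
    refine (h.shiftedRe_le_geometric hT hℓ hD hK hK0 hD0 hδ hδ1 hsmall hTℓ k u
      (by linarith)).trans ?_
    linarith
  have hH : ∀ x : ℝ, 1 / 2 + δ ≤ x → x ≤ 3 →
      ‖logDeriv L ((x : ℂ) + T * Complex.I) -
        dirichletPoly β ⌊ℓ ^ 2⌋₊ 1 ((x : ℂ) + T * Complex.I)‖ ≤
      M * Real.exp (-(x - (1 / 2 + δ)) * (2 * Real.log ℓ)) := by
    intro x hx hx'
    refine (h.norm_sub_dirichletPoly_le hT hℓ hD hK hK0 hD0 hδ hδ1 hsmall (t := T)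
      (by linarith) (by linarith) hN0 hgeo hx hx').trans ?_
    -- For x ≤ 3 the decaying exponential is at least ℓ^{-5}, so it absorbs the error coming from Re
    -- s = 3.
    have h5 : ((ℓ ^ 5 : ℝ))⁻¹ ≤ Real.exp (-(x - (1 / 2 + δ)) * (2 * Real.log ℓ)) := by
      have : (ℓ ^ 5 : ℝ)⁻¹ = Real.exp (-(5 * Real.log ℓ)) := by
        rw [Real.exp_neg, show 5 * Real.log ℓ = (5 : ℕ) * Real.log ℓ by norm_num,
          Real.exp_nat_mul, Real.exp_log hℓ0]
      rw [this, Real.exp_le_exp]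
      nlinarith
    have h6 : 16 * C / (ℓ ^ 2) ^ 2 ≤
        16 * C * ℓ * Real.exp (-(x - (1 / 2 + δ)) * (2 * Real.log ℓ)) := by
      calc 16 * C / (ℓ ^ 2) ^ 2 = 16 * C * ℓ * (ℓ ^ 5)⁻¹ := by field_simp
        _ ≤ _ := by gcongr
    refine (add_le_add h6 le_rfl).trans_eq ?_
    rw [hM]
    ring
  have hfin := norm_le_of_norm_deriv_le_exp (a := 1 / 2 + δ) (b := 3) (Y := 2 * Real.log ℓ)
    (K := M / (2 * Real.log ℓ)) (B := 2 * K) (σ := σ)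
    (f := fun x : ℝ => ((Real.log ‖L ((x : ℂ) + T * Complex.I)‖ -
        (dirichletPoly β ⌊ℓ ^ 2⌋₊ 0 ((x : ℂ) + T * Complex.I)).re : ℝ) : ℂ))
    (f' := fun x : ℝ => (((logDeriv L ((x : ℂ) + T * Complex.I) -
        dirichletPoly β ⌊ℓ ^ 2⌋₊ 1 ((x : ℂ) + T * Complex.I)).re : ℝ) : ℂ)) (by positivity)
    (fun x hx => by
      refine HasDerivAt.ofReal_comp ?_
      have hx1 : 1 / 2 < x := by linarith [hx.1]
      have hL0 := h.ne_zero ((x : ℂ) + T * Complex.I) (by rwa [hre]) (by rw [him]; linarith)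
      have hd := (h.differentiableAt ((x : ℂ) + T * Complex.I) (by rw [him]; linarith)).hasDerivAt
      rw [Complex.sub_re, logDeriv_apply]
      exact (hasDerivAt_log_norm (hasDerivAt_comp_ofReal_add hd) hL0).sub
        (hasDerivAt_re_comp_ofReal_add (hasDerivAt_dirichletPoly β _ 0 _)))
    (fun x hx => by
      rw [Complex.norm_real, Real.norm_eq_abs, div_mul_cancel₀ _ (by positivity)]
      exact (Complex.abs_re_le_norm _).trans (hH x hx.1 hx.2))
    (by
      rw [Complex.norm_real, Real.norm_eq_abs]
      have hs3 : 3 ≤ (((3 : ℝ) : ℂ) + T * Complex.I).re := by rw [hre]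
      have hp : 0 < ‖L (((3 : ℝ) : ℂ) + T * Complex.I)‖ :=
        (Real.exp_pos _).trans_le (hK2 _ hs3)
      have h1 : |Real.log ‖L (((3 : ℝ) : ℂ) + T * Complex.I)‖| ≤ K := by
        rw [abs_le]
        exact ⟨(Real.le_log_iff_exp_le hp).2 (hK2 _ hs3), (Real.log_le_iff_le_exp hp).2 (hK3 _ hs3)⟩
      have h2 := (Complex.abs_re_le_norm _).trans
        (hK4 (((3 : ℝ) : ℂ) + T * Complex.I) ⌊ℓ ^ 2⌋₊ (hre 3))
      refine (abs_sub _ _).trans ?_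
      linarith) ⟨hσ, hσ'⟩
  rwa [Complex.norm_real, Real.norm_eq_abs] at hfin

end IsZeroFreeLFunction

/-! ### Mertens-type bound for the sum at s = 1 -/

theorem eventually_const_mul_pow_mul_exp_neg_le_one (K : ℝ) (n : ℕ) :
    ∀ᶠ x : ℝ in atTop, K * (x ^ n * Real.exp (-x)) ≤ 1 := by
  have h := (Real.tendsto_pow_mul_exp_neg_atTop_nhds_zero n).const_mul K
  rw [mul_zero] at h
  exact h.eventually_le_const one_pos

/-- Telescoping majorants: the first sums to log log N + O(1), the second to O(1). -/
theorem inv_mul_log_le {n : ℕ} (hn : 2 ≤ n) :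
    1 / ((n + 1 : ℝ) * Real.log n) ≤
      (Real.log (Real.log (n + 1)) - Real.log (Real.log n)) +
        (1 / Real.log n - 1 / Real.log (n + 1)) ∧
    1 / ((n + 1 : ℝ) * Real.log n ^ 2) ≤ 2 * (1 / Real.log n - 1 / Real.log (n + 1)) := by
  have hn2 : (2 : ℝ) ≤ n := by exact_mod_cast hn
  have hn0 : (0 : ℝ) < n := by linarith
  set u := Real.log n with hu
  set v := Real.log (n + 1) with hv
  have hu0 : 0 < u := Real.log_pos (by linarith)
  have huv : u ≤ v := Real.log_le_log hn0 (by linarith)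
  have hv0 : 0 < v := hu0.trans_le huv
  have hd : 1 / (n + 1 : ℝ) ≤ v - u := by
    have h := Real.one_sub_inv_le_log_of_pos (show (0 : ℝ) < (n + 1) / n by positivity)
    rw [Real.log_div (by linarith) hn0.ne', ← hu, ← hv] at h
    refine le_trans (le_of_eq ?_) h
    field_simp
    ring
  have hv2 : v ≤ 2 * u := by
    have : (n + 1 : ℝ) ≤ (n : ℝ) ^ 2 := by nlinarith
    have := Real.log_le_log (by linarith) this
    rwa [Real.log_pow, Nat.cast_ofNat, ← hu, ← hv] at this
  have hloglog : 1 / (n + 1 : ℝ) / v ≤ Real.log v - Real.log u := by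
    have h := Real.one_sub_inv_le_log_of_pos (show 0 < v / u by positivity)
    rw [Real.log_div hv0.ne' hu0.ne'] at h
    refine le_trans ?_ h
    rw [inv_div, one_sub_div hv0.ne']
    gcongr
  have hdiff : 1 / u - 1 / v = (v - u) / (u * v) := by field_simp
  have hn1 : 1 / (n + 1 : ℝ) ≤ 1 := by rw [div_le_one (by linarith)]; linarith
  refine ⟨?_, ?_⟩
  · have h1 : 1 / ((n + 1 : ℝ) * u) = 1 / (n + 1 : ℝ) / v + 1 / (n + 1 : ℝ) * (1 / u - 1 / v) := by
      field_simp
      ring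
    have h2 : 0 ≤ 1 / u - 1 / v := by rw [hdiff]; exact div_nonneg (by linarith) (by positivity)
    have h3 : 1 / (n + 1 : ℝ) * (1 / u - 1 / v) ≤ 1 * (1 / u - 1 / v) := by gcongr
    rw [h1]
    linarith
  · rw [hdiff]
    calc 1 / ((n + 1 : ℝ) * u ^ 2) = 2 * (1 / (n + 1 : ℝ) / (u * (2 * u))) := by field_simp
      _ ≤ 2 * ((v - u) / (u * v)) := by gcongr

/-- Partial summation reduces to ∑ P(n)/(n(n + 1)). The main term of P gives κ log log N. The error
O(x/log² x) gives a convergent sum, which an error of only o(x/log x) need not do. -/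
theorem exists_sum_prime_div_le {a : ℕ → ℂ} {κ : ℝ} (hκ : 0 < κ) (h : StrongPrimeAsymptotic a κ) :
    ∃ C : ℝ, ∀ᶠ N : ℕ in atTop,
      ∑ p ∈ Finset.Icc 1 N with p.Prime, ‖a p‖ / p ≤ κ * Real.log (Real.log N) + C := by
  obtain ⟨C, hC0, hC⟩ := (h.comp_tendsto tendsto_natCast_atTop_atTop).exists_pos
  obtain ⟨N₀, hN₀⟩ := eventually_atTop.1 hC.bound
  set N₁ := max N₀ 3 with hN₁
  set P : ℕ → ℝ := fun N => ∑ p ∈ Finset.Icc 1 N with p.Prime, ‖a p‖ with hP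
  set S : ℕ → ℝ := fun N => ∑ p ∈ Finset.Icc 1 N with p.Prime, ‖a p‖ / p with hS
  have hPle : ∀ N, N₁ ≤ N → P N ≤ κ * (N / Real.log N) + C * (N / Real.log N ^ 2) := by
    intro N hN
    have h1 := hN₀ N ((le_max_left _ _).trans hN)
    simp only [Function.comp_apply] at h1
    rw [Real.norm_of_nonneg (by positivity : (0 : ℝ) ≤ N / Real.log N ^ 2), primeSum_natCast] at h1
    have := (le_abs_self _).trans h1
    linarith
  have hstep : ∀ N, N₁ ≤ N → S (N + 1) - P (N + 1) / (N + 1 : ℕ) =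
      S N - P N / N + P N / (N * (N + 1)) := by
    intro N hN
    have hN0 : (0 : ℝ) < N := by
      have : 3 ≤ N := (le_max_right _ _).trans hN
      exact_mod_cast (by omega : 0 < N)
    have hN1 : ((N + 1 : ℕ) : ℝ) ≠ 0 := by positivity
    simp only [hS, hP, Finset.sum_filter]
    rw [Finset.sum_Icc_succ_top (by omega), Finset.sum_Icc_succ_top (by omega)]
    split_ifs
    · push_cast at hN1 ⊢
      field_simp
      ring
    · push_cast at hN1 ⊢
      field_simp
      ring
  have hind : ∀ N, N₁ ≤ N → S N - P N / N ≤
      S N₁ + κ * (Real.log (Real.log N) - Real.log (Real.log N₁)) +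
        (κ + 2 * C) * (1 / Real.log N₁ - 1 / Real.log N) := by
    intro N hN
    induction N, hN using Nat.le_induction with
    | base =>
      have : 0 ≤ P N₁ / N₁ := div_nonneg (Finset.sum_nonneg fun _ _ => norm_nonneg _)
        (Nat.cast_nonneg _)
      linarith
    | succ N hN ih =>
      have hN3 : 3 ≤ N := (le_max_right _ _).trans hN
      have hN3' : (3 : ℝ) ≤ N := by exact_mod_cast hN3
      have hlog : 0 < Real.log N := Real.log_pos (by linarith)
      obtain ⟨h1, h2⟩ := inv_mul_log_le (n := N) (by omega)
      rw [hstep N hN]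
      have h3 : P N / (N * (N + 1)) ≤
          κ * (1 / ((N + 1 : ℝ) * Real.log N)) + C * (1 / ((N + 1 : ℝ) * Real.log N ^ 2)) := by
        calc P N / (N * (N + 1)) ≤ (κ * (N / Real.log N) + C * (N / Real.log N ^ 2)) /
              (N * (N + 1)) := by
              gcongr
              exact hPle N hN
          _ = _ := by field_simp
      have h4 := mul_le_mul_of_nonneg_left h1 hκ.le
      have h5 := mul_le_mul_of_nonneg_left h2 hC0.le
      push_cast
      linarith
  refine ⟨S N₁ - κ * Real.log (Real.log N₁) + (κ + 2 * C) * (1 / Real.log N₁) + κ + C, ?_⟩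
  filter_upwards [eventually_ge_atTop N₁] with N hN
  have hN3 : (3 : ℝ) ≤ N := by exact_mod_cast (le_max_right _ _).trans hN
  have hlog : 1 ≤ Real.log N := by
    rw [Real.le_log_iff_exp_le (by linarith)]
    linarith [Real.exp_one_lt_d9]
  have hPN : P N / N ≤ κ + C := by
    rw [div_le_iff₀ (by linarith)]
    refine (hPle N hN).trans ?_
    have h1 : N / Real.log N ≤ N := div_le_self (by linarith) hlog
    have h2 : N / Real.log N ^ 2 ≤ N := div_le_self (by linarith) (one_le_pow₀ hlog)
    have := mul_le_mul_of_nonneg_left h1 hκ.le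
    have := mul_le_mul_of_nonneg_left h2 hC0.le
    linarith
  have h1 := hind N hN
  have h2 : 0 ≤ (κ + 2 * C) * (1 / Real.log N) := by positivity
  change S N ≤ _
  linarith

/-- Non-prime prime powers contribute O(1): their partial sums are O(N^r) with r < 1, so their
series converges absolutely at s = 1. -/
theorem exists_sum_norm_primePowCoeff_div_le {a b : ℕ → ℂ} {κ : ℝ} (hκ : 0 < κ)
    (h : StrongPrimeAsymptotic a κ)
    (hb : ∃ δ C : ℝ, δ < 1 / 2 ∧ ∀ p j : ℕ, p.Prime → 1 ≤ j →
      ‖b (p ^ j)‖ ≤ C * (p : ℝ) ^ ((j : ℝ) * δ))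
    (hab : ∀ p : ℕ, p.Prime → b p = a p) :
    ∃ C : ℝ, ∀ᶠ N : ℕ in atTop,
      ∑ n ∈ Finset.Icc 1 N, ‖primePowCoeff b n‖ / n ≤ κ * Real.log (Real.log N) + C := by
  obtain ⟨C₁, h₁⟩ := exists_sum_prime_div_le hκ h
  obtain ⟨r, C₂, hr0, hr, hC₂, h₂⟩ := exists_sum_norm_primePowCoeff_not_prime_le hb
  set f : ℕ → ℂ := fun n => if n.Prime then 0 else primePowCoeff b n with hf
  have hsum : LSeriesSummable f 1 := by
    refine LSeriesSummable_of_sum_norm_bigO (r := r) ?_ hr0 (by simpa using hr)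
    refine IsBigO.of_bound C₂ (Eventually.of_forall fun N => ?_)
    rw [Real.norm_of_nonneg (Finset.sum_nonneg fun _ _ => norm_nonneg _),
      Real.norm_of_nonneg (by positivity)]
    refine le_of_eq_of_le ?_ (h₂ N)
    rw [Finset.sum_filter]
    refine Finset.sum_congr rfl fun n _ => ?_
    simp only [hf]
    split_ifs <;> simp
  refine ⟨C₁ + ∑' n, ‖LSeries.term f 1 n‖, ?_⟩
  filter_upwards [h₁] with N hN
  rw [← Finset.sum_filter_add_sum_filter_not (Finset.Icc 1 N) Nat.Prime, ← add_assoc]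
  refine add_le_add ?_ ?_
  · refine le_of_eq_of_le (Finset.sum_congr rfl fun p hp => ?_) hN
    have hp := (Finset.mem_filter.1 hp).2
    rw [primePowCoeff_of_isPrimePow hp.isPrimePow, hab p hp]
  · refine le_of_eq_of_le (Finset.sum_congr rfl fun p hp => ?_)
      (hsum.norm.sum_le_tsum ((Finset.Icc 1 N).filter fun n => ¬ n.Prime) fun _ _ => norm_nonneg _)
    obtain ⟨hp1, hp2⟩ := Finset.mem_filter.1 hp
    have hp0 : 0 < p := (Finset.mem_Icc.1 hp1).1
    rw [LSeries.norm_term_eq, if_neg hp0.ne', Complex.one_re, Real.rpow_one, hf]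
    simp only [if_neg hp2]

/-! ### Choice of parameters: ℓ = log T, D = 2C₀ℓ, ⌈ℓ⌉ iterations -/

namespace IsZeroFreeLFunction

variable {L : ℂ → ℂ} {β : ℕ → ℂ} {A C : ℝ}

/-- The ⌈ℓ⌉ iterations use about ℓ² of the available height T/4, while 2^{⌈ℓ⌉} ≥ e^{ℓ/2} defeats the
initial bound O(ℓ³). The iterated bound N is then O(ℓ). -/
theorem eventually_abs_log_norm_sub_le (h : IsZeroFreeLFunction L β A C) :
    ∃ K : ℝ, 0 < K ∧ ∀ᶠ T : ℝ in atTop, ∀ σ : ℝ, 1 / 2 + 5 / Real.log (Real.log T) ≤ σ → σ ≤ 3 →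
      |Real.log ‖L ((σ : ℂ) + T * Complex.I)‖ -
          (dirichletPoly β ⌊Real.log T ^ 2⌋₊ 0 ((σ : ℂ) + T * Complex.I)).re| ≤
        K * (Real.log T ^ (2 - 2 * σ) / Real.log (Real.log T) + 1) := by
  have hC := h.chebyshev_pos
  obtain ⟨K, hK0, hK1, hK2, hK3, hK4⟩ := h.exists_bounds_right
  obtain ⟨C₀, hC₀, hLandau⟩ := h.exists_neg_le_re_logDeriv
  set M : ℝ := 16 * C + Real.exp 7 * (4 / 5 * (1 + 2 * ((36 * C + 1) + 2 * C₀)) + (18 * C + 1))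
    with hM
  have hM0 : 0 < M := by positivity
  refine ⟨2 * K + M / 2 * Real.exp 10, by positivity, ?_⟩
  have hlogT : Tendsto Real.log atTop atTop := Real.tendsto_log_atTop
  have hev1 := hlogT.eventually
    (eventually_const_mul_pow_mul_exp_neg_le_one (K + 2 * C₀ + 2 * C) 8)
  have hev2 := hlogT.eventually (eventually_const_mul_pow_mul_exp_neg_le_one 12 2)
  have hev3 := (hlogT.atTop_div_const two_pos).eventually
    (eventually_const_mul_pow_mul_exp_neg_le_one (7 / 25 * (K + 2 * C₀)) 2)
  filter_upwards [eventually_ge_atTop (16 : ℝ), hlogT.eventually_ge_atTop 3,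
    (hlogT.comp hlogT).eventually_ge_atTop 5, hev1, hev2, hev3] with T hT hℓ hℓℓ he1 he2 he3
  set ℓ := Real.log T with hℓdef
  simp only [Function.comp_apply] at hℓℓ
  rw [← hℓdef] at hℓℓ
  have hT0 : 0 < T := by linarith
  have hℓ0 : 0 < ℓ := by linarith
  have hexpℓ : Real.exp ℓ = T := Real.exp_log hT0
  have hlogℓ0 : 0 < Real.log ℓ := by linarith
  have hlogℓ : Real.log ℓ ≤ ℓ := (Real.log_le_sub_one_of_pos hℓ0).trans (by linarith)
  intro σ hσ hσ'
  set δ : ℝ := 5 / Real.log ℓ with hδ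
  have hδ0 : 0 < δ := by positivity
  have hδ1 : δ ≤ 1 := by rw [hδ, div_le_one hlogℓ0]; exact hℓℓ
  have hD : ∀ z : ℂ, 1 / 2 < z.re → T / 2 ≤ z.im → z.im ≤ 2 * T →
      0 ≤ shiftedRe L (2 * C₀ * ℓ) z := by
    intro z h1 h2 h3
    have h4 := hLandau z h1 (by linarith)
    have h5 : Real.log z.im ≤ 2 * ℓ := by
      have : z.im ≤ T ^ 2 := by nlinarith
      have := Real.log_le_log (by linarith) this
      rwa [Real.log_pow, Nat.cast_ofNat] at this
    have h6 := mul_le_mul_of_nonneg_left h5 hC₀.le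
    rw [shiftedRe, Complex.add_re, Complex.ofReal_re]
    linarith
  have hKℓ : K ≤ K * ℓ := le_mul_of_one_le_right hK0.le (by linarith)
  have hsmall : (Real.log ℓ ^ 2 * (K + 2 * C₀ * ℓ) + 2 * C * ℓ) *
      (ℓ ^ 5 * Real.exp (-ℓ ^ 2)) ≤ 1 := by
    refine le_trans ?_ he1
    have h1 : Real.log ℓ ^ 2 * (K + 2 * C₀ * ℓ) + 2 * C * ℓ ≤ (K + 2 * C₀ + 2 * C) * ℓ ^ 3 := by
      have h2 : Real.log ℓ ^ 2 * (K + 2 * C₀ * ℓ) ≤ ℓ ^ 2 * ((K + 2 * C₀) * ℓ) := by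
        gcongr
        linarith
      have h3 : ℓ ≤ ℓ ^ 3 := by
        refine le_self_pow₀ (by linarith) (by norm_num)
      have h4 := mul_le_mul_of_nonneg_left h3 hC.le
      calc _ ≤ ℓ ^ 2 * ((K + 2 * C₀) * ℓ) + 2 * C * ℓ ^ 3 := by linarith
        _ = _ := by ring
    have h5 : Real.exp (-ℓ ^ 2) ≤ Real.exp (-ℓ) := by
      rw [Real.exp_le_exp]; nlinarith
    calc _ ≤ (K + 2 * C₀ + 2 * C) * ℓ ^ 3 * (ℓ ^ 5 * Real.exp (-ℓ)) := by gcongr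
      _ = _ := by ring
  have hk : ((⌈ℓ⌉₊ : ℝ) + 1) * ℓ ≤ T / 4 := by
    have h1 : (⌈ℓ⌉₊ : ℝ) ≤ ℓ + 1 := (Nat.ceil_lt_add_one hℓ0.le).le
    rw [Real.exp_neg, hexpℓ, ← mul_assoc, ← div_eq_mul_inv, div_le_one hT0] at he2
    nlinarith
  have hTℓ : ℓ + 3 ≤ T / 4 := by
    have : ℓ ≤ (⌈ℓ⌉₊ : ℝ) := Nat.le_ceil ℓ
    nlinarith
  have hk' : 7 * (K + 2 * C₀ * ℓ) / (2 * δ) ^ 2 / 2 ^ ⌈ℓ⌉₊ ≤ ℓ := by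
    have h1 : Real.exp (ℓ / 2) ≤ 2 ^ ⌈ℓ⌉₊ := by
      have h1 : (2 : ℝ) ^ ⌈ℓ⌉₊ = Real.exp (⌈ℓ⌉₊ * Real.log 2) := by
        rw [Real.exp_nat_mul, Real.exp_log two_pos]
      rw [h1, Real.exp_le_exp]
      have h2 := Nat.le_ceil ℓ
      have h3 : (1 / 2 : ℝ) ≤ Real.log 2 := by linarith [Real.log_two_gt_d9]
      calc ℓ / 2 = ℓ * (1 / 2) := by ring
        _ ≤ _ := by gcongr
    rw [div_le_iff₀ (by positivity)]
    have h4 : 1 / (2 * δ) ^ 2 ≤ ℓ ^ 2 / 100 := by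
      rw [hδ]
      have : 1 / (2 * (5 / Real.log ℓ)) ^ 2 = Real.log ℓ ^ 2 / 100 := by field_simp; norm_num
      rw [this]
      gcongr
    rw [Real.exp_neg, ← mul_assoc, ← div_eq_mul_inv, div_le_one (Real.exp_pos _)] at he3
    calc 7 * (K + 2 * C₀ * ℓ) / (2 * δ) ^ 2 = 7 * (K + 2 * C₀ * ℓ) * (1 / (2 * δ) ^ 2) := by ring
      _ ≤ 7 * ((K + 2 * C₀) * ℓ) * (ℓ ^ 2 / 100) := by
          gcongr
          linarith
      _ = ℓ * (7 / 25 * (K + 2 * C₀) * (ℓ / 2) ^ 2) := by ring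
      _ ≤ ℓ * Real.exp (ℓ / 2) := by gcongr
      _ ≤ _ := by gcongr
  refine (h.abs_log_norm_sub_le (D := 2 * C₀ * ℓ) (K := K) hT hℓ hD hK1 hK0.le (by positivity)
    hδ hδ1 hsmall hTℓ hk hk' hK2 hK3 hK4 hσ hσ').trans ?_
  -- The offset δ costs exp(2δ log ℓ) = exp 10.
  have hE : Real.exp (-(σ - (1 / 2 + δ)) * (2 * Real.log ℓ)) =
      Real.exp 10 * ℓ ^ (1 - 2 * σ) := by
    rw [Real.rpow_def_of_pos hℓ0, ← Real.exp_add]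
    congr 1
    rw [hδ]
    field_simp
    ring
  have hpow : ℓ ^ (2 - 2 * σ) = ℓ * ℓ ^ (1 - 2 * σ) := by
    rw [show (2 - 2 * σ) = 1 + (1 - 2 * σ) by ring, Real.rpow_add hℓ0, Real.rpow_one]
  have hMeq : 16 * C * ℓ + Real.exp 7 * (4 / 5 * (ℓ + 2 * ((36 * C + 1) * ℓ + 2 * C₀ * ℓ)) +
      (18 * C + 1) * ℓ) = M * ℓ := by rw [hM]; ring
  rw [hMeq, hE]
  have hq : 0 ≤ ℓ ^ (2 - 2 * σ) / Real.log ℓ := by positivity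
  calc 2 * K + M * ℓ / (2 * Real.log ℓ) * (Real.exp 10 * ℓ ^ (1 - 2 * σ))
      = 2 * K + M / 2 * Real.exp 10 * (ℓ ^ (2 - 2 * σ) / Real.log ℓ) := by
        rw [hpow]; field_simp
    _ ≤ _ := by
        have : 0 ≤ M / 2 * Real.exp 10 := by positivity
        nlinarith [mul_nonneg hK0.le hq]

/-- Re L'/L is the derivative of log|L| in σ, so its lower bound limits how much log|L| can grow on
moving left. -/
theorem log_norm_le_add (h : IsZeroFreeLFunction L β A C) {C₀ T σ₁ σ₂ : ℝ}
    (hLandau : ∀ z : ℂ, 1 / 2 < z.re → 8 ≤ z.im → -(C₀ * Real.log z.im) ≤ (logDeriv L z).re)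
    (hT : 8 ≤ T) (h₁ : 1 / 2 < σ₁) (h₁₂ : σ₁ ≤ σ₂) :
    Real.log ‖L ((σ₁ : ℂ) + T * Complex.I)‖ ≤
      Real.log ‖L ((σ₂ : ℂ) + T * Complex.I)‖ + C₀ * Real.log T * (σ₂ - σ₁) := by
  have hre : ∀ x : ℝ, ((x : ℂ) + T * Complex.I).re = x := fun x => by simp
  have him : ∀ x : ℝ, ((x : ℂ) + T * Complex.I).im = T := fun x => by simp
  have hder : ∀ x ∈ Icc σ₁ σ₂, HasDerivAt
      (fun x : ℝ => Real.log ‖L ((x : ℂ) + T * Complex.I)‖ + C₀ * Real.log T * x)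
      ((logDeriv L ((x : ℂ) + T * Complex.I)).re + C₀ * Real.log T) x := by
    intro x hx
    have hL0 := h.ne_zero ((x : ℂ) + T * Complex.I) (by rw [hre]; linarith [hx.1])
      (by rw [him]; linarith)
    have hd := (h.differentiableAt ((x : ℂ) + T * Complex.I) (by rw [him]; linarith)).hasDerivAt
    rw [logDeriv_apply]
    refine (hasDerivAt_log_norm (hasDerivAt_comp_ofReal_add hd) hL0).add ?_
    simpa using (hasDerivAt_id x).const_mul (C₀ * Real.log T)
  have hmono : MonotoneOn
      (fun x : ℝ => Real.log ‖L ((x : ℂ) + T * Complex.I)‖ + C₀ * Real.log T * x)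
      (Icc σ₁ σ₂) := by
    refine monotoneOn_of_deriv_nonneg (convex_Icc _ _)
      (fun x hx => (hder x hx).continuousAt.continuousWithinAt)
      (fun x hx => (hder x (interior_subset hx)).differentiableAt.differentiableWithinAt) ?_
    intro x hx
    have hx' := interior_subset hx
    rw [(hder x hx').deriv]
    have := hLandau ((x : ℂ) + T * Complex.I) (by rw [hre]; linarith [hx'.1]) (by rw [him]; exact hT)
    rw [him] at this
    linarith
  have := hmono ⟨le_rfl, h₁₂⟩ ⟨h₁₂, le_rfl⟩ h₁₂
  simp only at this
  linarith

end IsZeroFreeLFunction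

/-! ### From the Selberg class to the final estimates -/

theorem IsSelberg.exists_isZeroFreeLFunction {a : ℕ → ℂ} {L : ℂ → ℂ} (hL : IsSelberg a L)
    (hRH : ∀ s : ℂ, 1 / 2 < s.re → s ≠ 1 → L s ≠ 0)
    (hprime : primeSum a =O[atTop] fun x : ℝ => x / Real.log x) :
    ∃ (b : ℕ → ℂ) (A C : ℝ),
      (∃ δ C : ℝ, δ < 1 / 2 ∧ ∀ p j : ℕ, p.Prime → 1 ≤ j →
        ‖b (p ^ j)‖ ≤ C * (p : ℝ) ^ ((j : ℝ) * δ)) ∧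
      (∀ p : ℕ, p.Prime → b p = a p) ∧ IsZeroFreeLFunction L (primePowCoeff b) A C := by
  obtain ⟨b, hb, hprod⟩ := hL.euler
  obtain ⟨A, hA, hgrowth⟩ := hL.exists_norm_le_exp_mul_log
  have habs := abscissaOfAbsConv_primePowCoeff_le hb
  have hexp : ∀ s : ℂ, 3 / 2 < s.re → L s = Complex.exp (LSeries (primePowCoeff b) s) :=
    fun s hs => eq_exp_LSeries_of_hasProd
      (LSeriesSummable_of_abscissaOfAbsConv_lt_re (lt_re_of_abscissaOfAbsConv_le habs hs))
      (hprod s (by linarith))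
  have hab : ∀ p : ℕ, p.Prime → b p = a p := fun p hp =>
    apply_prime_eq_of_LSeries_eq_exp hL.dirichlet habs hexp hp
  obtain ⟨C, hC, hcheb⟩ := exists_sum_norm_primePowCoeff_mul_log_le hprime hb hab
  have hne : ∀ s : ℂ, 0 < s.im → s ≠ 1 := by
    rintro s hs rfl
    simp at hs
  refine ⟨b, A, C, hb, hab, hA, hC, fun s hs => ?_, hgrowth, fun s hs hs' => hRH s hs (hne s hs'),
    habs, hexp, hcheb⟩
  obtain ⟨m, F, ⟨hF, -⟩, hFL⟩ := hL.continuation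
  have hs1 : (s - 1) ^ m ≠ 0 := pow_ne_zero _ (sub_ne_zero.2 (hne s hs))
  have hev : L =ᶠ[𝓝 s] fun z => F z / (z - 1) ^ m := by
    filter_upwards [isOpen_ne.mem_nhds (hne s hs)] with z hz
    rw [hFL z hz, mul_div_cancel_left₀ _ (pow_ne_zero _ (sub_ne_zero.2 hz))]
  exact (DifferentiableAt.div (hF s) (by fun_prop) hs1).congr_of_eventuallyEq hev

namespace IsZeroFreeLFunction

variable {L : ℂ → ℂ} {β : ℕ → ℂ} {A C : ℝ}

theorem exists_eventually_log_norm_le (h : IsZeroFreeLFunction L β A C) (hβ1 : β 1 = 0) {σ : ℝ}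
    (h0 : 1 / 2 ≤ σ) (h1 : σ < 1) :
    ∃ c : ℝ, 0 < c ∧ ∀ᶠ T : ℝ in atTop, ∀ τ : ℝ, σ ≤ τ → τ ≤ 3 →
      1 / 2 + 5 / Real.log (Real.log T) ≤ τ →
      Real.log ‖L ((τ : ℂ) + T * Complex.I)‖ ≤
        c * (Real.log T ^ (2 - 2 * σ) / Real.log (Real.log T)) := by
  obtain ⟨K, hK, hev⟩ := h.eventually_abs_log_norm_sub_le
  obtain ⟨K', hK', hsum⟩ := exists_sum_norm_mul_rpow_neg_le h.chebyshev_pos hβ1 h.chebyshev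
    (by linarith : 0 ≤ σ) h1
  have hσ : 0 < 2 - 2 * σ := by linarith
  refine ⟨K' / 2 + K * (1 + 1 / (2 - 2 * σ)), by positivity, ?_⟩
  filter_upwards [hev, Real.tendsto_log_atTop.eventually_ge_atTop 3] with T hT hℓ τ hστ hτ hδτ
  set ℓ := Real.log T
  have hℓ0 : 0 < ℓ := by linarith
  have hlog : 0 < Real.log ℓ := Real.log_pos (by linarith)
  set q := ℓ ^ (2 - 2 * σ) / Real.log ℓ with hq
  have hmain := (abs_le.1 (hT τ hδτ hτ)).2
  have hD : (dirichletPoly β ⌊ℓ ^ 2⌋₊ 0 ((τ : ℂ) + T * Complex.I)).re ≤ K' / 2 * q := by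
    refine ((Complex.re_le_norm _).trans (norm_dirichletPoly_le β _ 0 _)).trans ?_
    have hle : ∑ n ∈ Finset.Icc 1 ⌊ℓ ^ 2⌋₊, ‖β n‖ * Real.log n ^ 0 *
        (n : ℝ) ^ (-((τ : ℂ) + T * Complex.I).re) ≤
        ∑ n ∈ Finset.Icc 1 ⌊ℓ ^ 2⌋₊, ‖β n‖ * (n : ℝ) ^ (-σ) := by
      refine Finset.sum_le_sum fun n hn => ?_
      have hn1 : (1 : ℝ) ≤ n := by exact_mod_cast (Finset.mem_Icc.1 hn).1
      rw [pow_zero, mul_one]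
      gcongr
      simpa using hστ
    refine (hle.trans (hsum (ℓ ^ 2) (by nlinarith))).trans_eq ?_
    rw [Real.log_pow, ← Real.rpow_natCast, ← Real.rpow_mul hℓ0.le, hq]
    push_cast
    rw [show 2 * (1 - σ) = 2 - 2 * σ by ring]
    field_simp
  have hpow : ℓ ^ (2 - 2 * τ) / Real.log ℓ ≤ q := by
    rw [hq]
    gcongr
    linarith
  -- Since log ℓ ≤ ℓ^{2-2σ}/(2 - 2σ), the additive 1 is absorbed in the main term; this needs σ < 1.
  have hone : 1 ≤ 1 / (2 - 2 * σ) * q := by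
    have := Real.log_le_rpow_div hℓ0.le hσ
    rw [hq]
    rw [le_div_iff₀ hσ] at this
    rw [one_div_mul_eq_div, div_div, le_div_iff₀ (by positivity)]
    linarith
  have h3 : K * (ℓ ^ (2 - 2 * τ) / Real.log ℓ + 1) ≤ K * (q + 1 / (2 - 2 * σ) * q) := by gcongr
  linarith

theorem exists_isBigO_of_lt_one (h : IsZeroFreeLFunction L β A C) (hβ1 : β 1 = 0) {σ : ℝ}
    (h0 : 1 / 2 ≤ σ) (h1 : σ < 1) :
    ∃ c : ℝ, 0 < c ∧ (fun t : ℝ => L ((σ : ℂ) + (t : ℂ) * Complex.I)) =O[atTop]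
      fun t : ℝ => Real.exp (c * (Real.log t ^ (2 - 2 * σ) / Real.log (Real.log t))) := by
  obtain ⟨c, hc, hev⟩ := h.exists_eventually_log_norm_le hβ1 h0 h1
  have hdiv : Tendsto (fun t : ℝ => 5 / Real.log (Real.log t)) atTop (𝓝 0) :=
    (Real.tendsto_log_atTop.comp Real.tendsto_log_atTop).const_div_atTop 5
  -- For σ > 1/2 the approximation eventually applies at σ itself. For σ = 1/2 it is used at 1/2 +
  -- 5/log ℓ, followed by a descent to the critical line.
  rcases h0.eq_or_lt with rfl | h0
  · obtain ⟨C₀, hC₀, hLandau⟩ := h.exists_neg_le_re_logDeriv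
    refine ⟨c + 5 * C₀, by positivity, IsBigO.of_bound 1 ?_⟩
    filter_upwards [hev, eventually_ge_atTop (8 : ℝ),
      Real.tendsto_log_atTop.eventually_ge_atTop 3, hdiv.eventually_le_const one_pos]
      with T hT hT8 hℓ hδ1
    set ℓ := Real.log T
    have hlog : 0 < Real.log ℓ := Real.log_pos (by linarith)
    have hδ0 : 0 < 5 / Real.log ℓ := by positivity
    have hbase := hT (1 / 2 + 5 / Real.log ℓ) (by linarith) (by linarith) le_rfl
    rw [one_mul, Real.norm_of_nonneg (Real.exp_nonneg _)]
    have him : ∀ x : ℝ, ((x : ℂ) + T * Complex.I).im = T := fun x => by simp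
    -- L may vanish on the critical line, where log|L| says nothing; the bound is proved just to the
    -- right and passed to the limit.
    have hcont : Tendsto (fun x : ℝ => ‖L ((x : ℂ) + T * Complex.I)‖) (𝓝[>] (1 / 2 : ℝ))
        (𝓝 ‖L (((1 / 2 : ℝ) : ℂ) + T * Complex.I)‖) := by
      have hL := (h.differentiableAt (((1 / 2 : ℝ) : ℂ) + T * Complex.I)
        (by rw [him]; linarith)).continuousAt
      have : ContinuousAt (fun x : ℝ => ‖L ((x : ℂ) + T * Complex.I)‖) (1 / 2) :=
        (ContinuousAt.comp (f := fun x : ℝ => (x : ℂ) + T * Complex.I) hL (by fun_prop)).norm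
      exact this.tendsto.mono_left nhdsWithin_le_nhds
    refine le_of_tendsto hcont ?_
    filter_upwards [Ioc_mem_nhdsGT (show (1 / 2 : ℝ) < 1 / 2 + 5 / Real.log ℓ by linarith)]
      with x hx
    have hpos : 0 < ‖L ((x : ℂ) + T * Complex.I)‖ :=
      norm_pos_iff.2 (h.ne_zero _ (by simpa using hx.1) (by rw [him]; linarith))
    rw [← Real.log_le_iff_le_exp hpos]
    refine (h.log_norm_le_add hLandau hT8 hx.1 hx.2).trans ?_
    have h2 : C₀ * ℓ * (1 / 2 + 5 / Real.log ℓ - x) ≤ C₀ * ℓ * (5 / Real.log ℓ) := by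
      gcongr
      linarith [hx.1]
    have h3 : ℓ ^ (2 - 2 * (1 / 2) : ℝ) = ℓ := by norm_num
    rw [h3] at hbase ⊢
    have h4 : C₀ * ℓ * (5 / Real.log ℓ) = 5 * C₀ * (ℓ / Real.log ℓ) := by ring
    linarith
  · refine ⟨c, hc, IsBigO.of_bound 1 ?_⟩
    filter_upwards [hev, eventually_ge_atTop (8 : ℝ),
      hdiv.eventually_le_const (show 0 < σ - 1 / 2 by linarith)] with T hT hT8 hδ
    rw [one_mul, Real.norm_of_nonneg (Real.exp_nonneg _)]
    have hpos : 0 < ‖L ((σ : ℂ) + T * Complex.I)‖ :=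
      norm_pos_iff.2 (h.ne_zero _ (by simpa using h0) (by simp; linarith))
    rw [← Real.log_le_iff_le_exp hpos]
    exact hT σ le_rfl (by linarith) (by linarith)

/-- The polynomial has length ℓ², and log log ℓ² = log log ℓ + log 2, so squaring costs only a
factor 2^κ. The approximation error is bounded at σ = 1. -/
theorem isBigO_one_line (h : IsZeroFreeLFunction L β A C) {κ B : ℝ} (hκ : 0 < κ)
    (hB : ∀ᶠ N : ℕ in atTop,
      ∑ n ∈ Finset.Icc 1 N, ‖β n‖ / n ≤ κ * Real.log (Real.log N) + B) :
    (fun t : ℝ => L (1 + (t : ℂ) * Complex.I)) =O[atTop]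
      fun t : ℝ => Real.log (Real.log t) ^ κ := by
  obtain ⟨K, hK, hev⟩ := h.eventually_abs_log_norm_sub_le
  have hfloor : Tendsto (fun t : ℝ => ⌊Real.log t ^ 2⌋₊) atTop atTop :=
    tendsto_nat_floor_atTop.comp ((tendsto_pow_atTop two_ne_zero).comp Real.tendsto_log_atTop)
  refine IsBigO.of_bound (Real.exp (κ * Real.log 2 + B + 2 * K)) ?_
  filter_upwards [hev, hfloor.eventually hB, eventually_ge_atTop (8 : ℝ),
    Real.tendsto_log_atTop.eventually_ge_atTop 3,
    (Real.tendsto_log_atTop.comp Real.tendsto_log_atTop).eventually_ge_atTop 10]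
    with T hT hN hT8 hℓ hℓℓ
  simp only [Function.comp_apply] at hℓℓ
  set ℓ := Real.log T
  have hℓ0 : 0 < ℓ := by linarith
  have hlog : 0 < Real.log ℓ := by linarith
  have hpos : 0 < ‖L (1 + T * Complex.I)‖ :=
    norm_pos_iff.2 (h.ne_zero _ (by simp; norm_num) (by simp; linarith))
  have hmain := (abs_le.1 (hT 1 (by
    have : 5 / Real.log ℓ ≤ 1 / 2 := by rw [div_le_iff₀ hlog]; linarith
    linarith) (by norm_num))).2
  rw [Complex.ofReal_one] at hmain
  have hfl : (1 : ℝ) < ⌊ℓ ^ 2⌋₊ := by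
    have : 2 ≤ ⌊ℓ ^ 2⌋₊ := Nat.le_floor (by push_cast; nlinarith)
    exact_mod_cast this
  have hloglog : Real.log (Real.log ⌊ℓ ^ 2⌋₊) ≤ Real.log 2 + Real.log (Real.log ℓ) := by
    rw [← Real.log_mul two_ne_zero hlog.ne']
    refine Real.log_le_log (Real.log_pos hfl) ?_
    have := Real.log_le_log (by linarith) (Nat.floor_le (sq_nonneg ℓ))
    rwa [Real.log_pow, Nat.cast_ofNat] at this
  have hD : (dirichletPoly β ⌊ℓ ^ 2⌋₊ 0 (1 + T * Complex.I)).re ≤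
      κ * (Real.log 2 + Real.log (Real.log ℓ)) + B := by
    refine ((Complex.re_le_norm _).trans (norm_dirichletPoly_le β _ 0 _)).trans ?_
    have hle : ∑ n ∈ Finset.Icc 1 ⌊ℓ ^ 2⌋₊, ‖β n‖ * Real.log n ^ 0 *
        (n : ℝ) ^ (-(1 + T * Complex.I).re) = ∑ n ∈ Finset.Icc 1 ⌊ℓ ^ 2⌋₊, ‖β n‖ / n := by
      refine Finset.sum_congr rfl fun n _ => ?_
      rw [pow_zero, mul_one, show (1 + T * Complex.I).re = 1 by simp, Real.rpow_neg_one,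
        div_eq_mul_inv]
    have := mul_le_mul_of_nonneg_left hloglog hκ.le
    linarith
  have hK1 : K * (ℓ ^ (2 - 2 * 1 : ℝ) / Real.log ℓ + 1) ≤ K * 2 := by
    gcongr
    have : 1 / Real.log ℓ ≤ 1 := by rw [div_le_one hlog]; linarith
    rw [show (2 - 2 * 1 : ℝ) = 0 by norm_num, Real.rpow_zero]
    linarith
  rw [Real.norm_of_nonneg (by positivity), Real.rpow_def_of_pos hlog, ← Real.exp_add,
    ← Real.log_le_iff_le_exp hpos]
  linarith

end IsZeroFreeLFunction

end

end SelbergClass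

theorem proposition1 (a : ℕ → ℂ) (L : ℂ → ℂ) (hL : SelbergClass.IsSelberg a L)
    (hRH : ∀ s : ℂ, 1 / 2 < s.re → s ≠ 1 → L s ≠ 0)
    (κ : ℝ) (hκ : 0 < κ) (hprime : SelbergClass.PrimeAsymptotic a κ) :
    (∀ σ : ℝ, 1 / 2 ≤ σ → σ < 1 → ∃ c : ℝ, 0 < c ∧
      (fun t : ℝ => L ((σ : ℂ) + (t : ℂ) * Complex.I)) =O[atTop]
        fun t : ℝ => Real.exp (c * (Real.log t ^ (2 - 2 * σ) / Real.log (Real.log t)))) ∧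
    (SelbergClass.StrongPrimeAsymptotic a κ →
      (fun t : ℝ => L (1 + (t : ℂ) * Complex.I)) =O[atTop]
        fun t : ℝ => Real.log (Real.log t) ^ κ) := by
  obtain ⟨b, A, C, hb, hab, h⟩ := hL.exists_isZeroFreeLFunction hRH hprime.isBigO
  refine ⟨fun σ h0 h1 => h.exists_isBigO_of_lt_one (SelbergClass.primePowCoeff_one b) h0 h1,
    fun hstrong => ?_⟩
  obtain ⟨B, hB⟩ := SelbergClass.exists_sum_norm_primePowCoeff_div_le hκ hstrong hb hab
  exact h.isBigO_one_line hκ hB
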